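/- Let $e\in\{1,2,3,\dots\}\cup\{\infty\}$, $I=\mathbb Z/e\mathbb Z$ (with $I=\mathbb Z$ if $e=\infty$), regarded as the vertex set of the quiver with edges $i\to i+1$, with Cartan matrix $(c_{ij})$, simple roots $\alpha_i$ and fundamental weights $\Lambda_i$, so that $(\Lambda_i,\alpha_j)=\delta_{ij}$. Let $n\ge 0$, $\ell\ge0$, let $\kappa=(\kappa_1,\dots,\kappa_\ell)\in\mathbb Z^\ell$ and let $\Lambda=\Lambda_{\bar\kappa_1}+\dots+\Lambda_{\bar\kappa_\ell}$, where $\bar a=a+e\mathbb Z$. Let $\mathcal Z$ be an integral domain and let $\mathscr R_n^\Lambda=\bigoplus_{\beta}\mathscr R_\beta^\Lambda$ be the cyclotomic quiver Hecke (KLR) algebra over $\mathcal Z$: here $\beta\in\bigoplus_{i\in I}\mathbb N\alpha_i$, $I^\beta=\{i\in I^n:\alpha_{i_1}+\dots+\alpha_{i_n}=\beta\}$, and $\mathscr R_\beta^\Lambda$ is the unital associative algebra generated by $\psi_1,\dots,\psi_{n-1},y_1,\dots,y_n$ and $e(i)$, $i\in I^\beta$, subject to the quiver Hecke relations $$e(i)e(j)=\delta_{ij}e(i),\quad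 \sum_{i\in I^\beta}e(i)=1,\quad y_re(i)=e(i)y_r,\quad \psi_re(i)=e(s_r\cdot i)\psi_r,\quad y_ry_s=y_sy_r,$$ $$\psi_r\psi_s=\psi_s\psi_r\ (|r-s|>1),\qquad \psi_ry_s=y_s\psi_r\ (s\ne r,r+1),$$ $$\psi_ry_{r+1}e(i)=(y_r\psi_r+\delta_{i_ri_{r+1}})e(i),\qquad y_{r+1}\psi_re(i)=(\psi_ry_r+\delta_{i_ri_{r+1}})e(i),$$ $\psi_r^2e(i)=0$ if $i_r=i_{r+1}$, and otherwise $\psi_r^2e(i)=(y_{r+1}-y_r)(y_r-y_{r+1})e(i)$, $(y_r-y_{r+1})e(i)$, $(y_{r+1}-y_r)e(i)$ or $e(i)$ according as $i_r\rightleftarrows i_{r+1}$, $i_r\to i_{r+1}$ only, $i_r\leftarrow i_{r+1}$ only, or there is no edge; $(\psi_r\psi_{r+1}\psi_r-\psi_{r+1}\psi_r\psi_{r+1})e(i)=(y_r+y_{r+2}-2y_{r+1})e(i)$, $-e(i)$ or $e(i)$ according as $i_{r+2}=i_r\rightleftarrows i_{r+1}$, $i_{r+2}=i_r\to i_{r+1}$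 only or $i_{r+2}=i_r\leftarrow i_{r+1}$ only, and $0$ otherwise; and to the cyclotomic relation $y_1^{(\Lambda,\alpha_{i_1})}e(i)=0$. It is graded by $\deg e(i)=0$, $\deg y_r=2$, $\deg\psi_re(i)=-c_{i_r,i_{r+1}}$. For each $w\in\mathfrak S_n$ (acting from the right) fix an arbitrary reduced expression $w=s_{r_1}\cdots s_{r_k}$ and put $\psi_w=\psi_{r_1}\cdots\psi_{r_k}$. Order the set $\mathcal P$ of $\ell$-multipartitions of $n$ by dominance. For $\lambda\in\mathcal P$ let $\mathrm{Std}(\lambda)$ be the set of standard $\lambda$-tableaux, $t^\lambda$ the standard tableau with $1,\dots,n$ entered in order along the rows of the successive components, $i^\lambda\in I^n$ its residue sequence (the node in component $l$, row $r$, column $c$ has residue $\kappa_l+c-r+e\mathbb Z$), and for $t\in\mathrm{Std}(\lambda)$ let $d(t)\in\mathfrak S_n$ be the permutation with $t=t^\lambda d(t)$. For $s,t\in\mathrm{Std}(\lambda)$ put $e_{st}=\psi_{d(s)^{-1}}e(i^\lambda)\psi_{d(t)}$. Suppose that $e>n$ and that $(\Lambda,\alpha_i+\alpha_{i+1}+\dots+\alpha_{i+n-1})\le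 1$ for all $i\in I$. Then all but finitely many of the algebras $\mathscr R_\beta^\Lambda$ are zero (so that $\mathscr R_n^\Lambda$ is a unital graded algebra), and $\mathscr R_n^\Lambda$ is a graded cellular algebra, free of finite rank over $\mathcal Z$, with weight poset $\mathcal P$ and graded cellular basis $\{e_{st}: s,t\in\mathrm{Std}(\lambda),\ \lambda\in\mathcal P\}$, where $\deg e_{st}=0$ for all $s,t$. Moreover these elements are matrix units: $e_{st}e_{uv}=\delta_{tu}e_{sv}$ (in particular $e_{st}e_{uv}=0$ if $s,t$ and $u,v$ have different shapes). Consequently, as $\mathcal Z$-algebras, $$\mathscr R_n^\Lambda\cong\bigoplus_{\lambda\in\mathcal P}\mathrm{Mat}_{\#\mathrm{Std}(\lambda)}(\mathcal Z).$$ -/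

import Mathlib

namespace CycKLR

noncomputable section

/-! ### Lie theoretic data of the quiver with vertex set `ℤ/eℤ`

The vertex set is `I = ZMod e`; the value `e = 0` stands for `e = ∞` (then `I = ℤ`).
The edges are `i → i + 1`. -/

/-- The edge relation `i → j`. -/
def Arrow {e : ℕ} (i j : ZMod e) : Prop := j = i + 1

instance {e : ℕ} (i j : ZMod e) : Decidable (Arrow i j) :=
  inferInstanceAs (Decidable (j = i + 1))

/-- The Cartan matrix of the quiver. -/
def cartan {e : ℕ} (i j : ZMod e) : ℤ :=
  if i = j then 2
  else if Arrow i j ∧ Arrow j i then -2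
  else if Arrow i j ∨ Arrow j i then -1
  else 0

/-- The positive weight lattice `P⁺ = ⨁ᵢ ℕ Λᵢ`. -/
abbrev PosWeight (e : ℕ) : Type := ZMod e →₀ ℕ

/-- The positive root lattice `Q⁺ = ⨁ᵢ ℕ αᵢ`. -/
abbrev PosRoot (e : ℕ) : Type := ZMod e →₀ ℕ

/-- The pairing `P⁺ × Q⁺ → ℕ` with `(Λᵢ, αⱼ) = δᵢⱼ`. -/
def pairing {e : ℕ} (Λ : PosWeight e) (β : PosRoot e) : ℕ :=
  β.sum fun i m => m * Λ i

/-- The simple root `αᵢ`. -/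
def simpleRoot {e : ℕ} (i : ZMod e) : PosRoot e := Finsupp.single i 1

/-- The `i`-string `α_{i,n} = αᵢ + α_{i+1} + ⋯ + α_{i+n-1}`. -/
def rootString {e : ℕ} (i : ZMod e) (n : ℕ) : PosRoot e :=
  ∑ k ∈ Finset.range n, simpleRoot (i + (k : ZMod e))

/-- The dominant weight `Λ(κ) = Λ_{κ₁} + ⋯ + Λ_{κ_ℓ}` of a multicharge `κ`. -/
def weightOf (e : ℕ) {ℓ : ℕ} (κ : Fin ℓ → ℤ) : PosWeight e :=
  ∑ l, Finsupp.single ((κ l : ℤ) : ZMod e) 1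

/-! ### Residue sequences and simple transpositions

Positions `1, …, n` are numbered by `Fin n`, and the simple transpositions
`s₁, …, s_{n-1}` by `Fin (n - 1)`. -/

/-- The first position moved by `s_r`. -/
def lo {n : ℕ} (r : Fin (n - 1)) : Fin n := ⟨r.1, by omega⟩

/-- The second position moved by `s_r`. -/
def hi {n : ℕ} (r : Fin (n - 1)) : Fin n := ⟨r.1 + 1, by omega⟩

/-- The simple transposition `s_r`. -/
def simpleSwap {n : ℕ} (r : Fin (n - 1)) : Equiv.Perm (Fin n) := Equiv.swap (lo r) (hi r)

/-- The sum `α_{i₁} + ⋯ + α_{iₙ}`. -/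
def rootSum {e n : ℕ} (i : Fin n → ZMod e) : PosRoot e := ∑ r, simpleRoot (i r)

/-- The set `I^β` of sequences in `Iⁿ` with `α_{i₁} + ⋯ + α_{iₙ} = β`. -/
def Seq {e : ℕ} (n : ℕ) (β : PosRoot e) : Type := {i : Fin n → ZMod e // rootSum i = β}

instance {e n : ℕ} (β : PosRoot e) : Finite (Seq n β) := by
  have key : ∀ (x : Seq n β) (r : Fin n), x.1 r ∈ β.support := by
    rintro ⟨i, rfl⟩ r
    rw [Finsupp.mem_support_iff]
    intro h
    simp only [rootSum, simpleRoot, Finsupp.finsetSum_apply, Finset.sum_eq_zero_iff] at h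
    simpa using h r (Finset.mem_univ r)
  refine Finite.of_injective (β := Fin n → β.support) (fun x r => ⟨x.1 r, key x r⟩) ?_
  intro x y h
  apply Subtype.ext
  funext r
  simpa using congrFun h r

instance {e n : ℕ} (β : PosRoot e) : Fintype (Seq n β) := Fintype.ofFinite _

/-- The place permutation action `s_r · i` on `I^β`. -/
def Seq.swap {e n : ℕ} {β : PosRoot e} (r : Fin (n - 1)) (i : Seq n β) : Seq n β :=
  ⟨i.1 ∘ simpleSwap r,
    (Equiv.sum_comp (simpleSwap r) fun k => simpleRoot (i.1 k)).trans i.2⟩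

/-! ### Cyclotomic quiver Hecke algebras -/

/-- The generators `ψ_r`, `y_r` and `e(i)`, for `i ∈ I^β`. -/
inductive Gen {e : ℕ} (n : ℕ) (β : PosRoot e) : Type
  | psi (r : Fin (n - 1)) : Gen n β
  | y (r : Fin n) : Gen n β
  | idem (i : Seq n β) : Gen n β

section Relations

variable (Z : Type*) [CommRing Z] {e n : ℕ} (β : PosRoot e)

/-- The free generator `ψ_r`. -/
def fpsi (r : Fin (n - 1)) : FreeAlgebra Z (Gen n β) := FreeAlgebra.ι Z (Gen.psi r)

/-- The free generator `y_r`. -/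
def fy (r : Fin n) : FreeAlgebra Z (Gen n β) := FreeAlgebra.ι Z (Gen.y r)

variable {β}

/-- The free generator `e(i)`. -/
def fe (i : Seq n β) : FreeAlgebra Z (Gen n β) := FreeAlgebra.ι Z (Gen.idem i)

/-- The right hand side of the quadratic relation for `ψ_r² e(i)`. -/
def quadRHS (r : Fin (n - 1)) (i : Seq n β) : FreeAlgebra Z (Gen n β) :=
  if i.1 (lo r) = i.1 (hi r) then 0
  else if Arrow (i.1 (lo r)) (i.1 (hi r)) ∧ Arrow (i.1 (hi r)) (i.1 (lo r)) then
    (fy Z β (hi r) - fy Z β (lo r)) * (fy Z β (lo r) - fy Z β (hi r)) * fe Z i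
  else if Arrow (i.1 (lo r)) (i.1 (hi r)) then (fy Z β (lo r) - fy Z β (hi r)) * fe Z i
  else if Arrow (i.1 (hi r)) (i.1 (lo r)) then (fy Z β (hi r) - fy Z β (lo r)) * fe Z i
  else fe Z i

/-- The right hand side of the braid relation for
`(ψ_r ψ_{r+1} ψ_r - ψ_{r+1} ψ_r ψ_{r+1}) e(i)`; here `r'` is `r + 1`. -/
def braidRHS (r r' : Fin (n - 1)) (i : Seq n β) : FreeAlgebra Z (Gen n β) :=
  if i.1 (hi r') = i.1 (lo r) then
    if Arrow (i.1 (lo r)) (i.1 (hi r)) ∧ Arrow (i.1 (hi r)) (i.1 (lo r)) then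
      (fy Z β (lo r) + fy Z β (hi r') - 2 * fy Z β (hi r)) * fe Z i
    else if Arrow (i.1 (lo r)) (i.1 (hi r)) then -fe Z i
    else if Arrow (i.1 (hi r)) (i.1 (lo r)) then fe Z i
    else 0
  else 0

/-- The quiver Hecke (KLR) relations for `β`, together with the cyclotomic relation
`y₁^{(Λ, α_{i₁})} e(i) = 0`. -/
inductive Rel (Λ : PosWeight e) (β : PosRoot e) :
    FreeAlgebra Z (Gen n β) → FreeAlgebra Z (Gen n β) → Prop
  | idem_mul_self (i : Seq n β) : Rel Λ β (fe Z i * fe Z i) (fe Z i)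
  | idem_mul_ne (i j : Seq n β) (h : i ≠ j) : Rel Λ β (fe Z i * fe Z j) 0
  | sum_idem : Rel Λ β (∑ i : Seq n β, fe Z i) 1
  | y_idem (r : Fin n) (i : Seq n β) : Rel Λ β (fy Z β r * fe Z i) (fe Z i * fy Z β r)
  | psi_idem (r : Fin (n - 1)) (i : Seq n β) :
      Rel Λ β (fpsi Z β r * fe Z i) (fe Z (i.swap r) * fpsi Z β r)
  | y_y (r s : Fin n) : Rel Λ β (fy Z β r * fy Z β s) (fy Z β s * fy Z β r)
  | psi_psi (r s : Fin (n - 1)) (h : r.1 + 1 < s.1 ∨ s.1 + 1 < r.1) :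
      Rel Λ β (fpsi Z β r * fpsi Z β s) (fpsi Z β s * fpsi Z β r)
  | psi_y (r : Fin (n - 1)) (s : Fin n) (h₁ : s ≠ lo r) (h₂ : s ≠ hi r) :
      Rel Λ β (fpsi Z β r * fy Z β s) (fy Z β s * fpsi Z β r)
  | psi_y_hi (r : Fin (n - 1)) (i : Seq n β) :
      Rel Λ β (fpsi Z β r * fy Z β (hi r) * fe Z i)
        ((fy Z β (lo r) * fpsi Z β r + if i.1 (lo r) = i.1 (hi r) then 1 else 0) * fe Z i)
  | y_hi_psi (r : Fin (n - 1)) (i : Seq n β) :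
      Rel Λ β (fy Z β (hi r) * fpsi Z β r * fe Z i)
        ((fpsi Z β r * fy Z β (lo r) + if i.1 (lo r) = i.1 (hi r) then 1 else 0) * fe Z i)
  | quadratic (r : Fin (n - 1)) (i : Seq n β) :
      Rel Λ β (fpsi Z β r ^ 2 * fe Z i) (quadRHS Z r i)
  | braid (r r' : Fin (n - 1)) (h : r'.1 = r.1 + 1) (i : Seq n β) :
      Rel Λ β
        ((fpsi Z β r * fpsi Z β r' * fpsi Z β r - fpsi Z β r' * fpsi Z β r * fpsi Z β r')
          * fe Z i)
        (braidRHS Z r r' i)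
  | cyclotomic (h : 0 < n) (i : Seq n β) :
      Rel Λ β (fy Z β ⟨0, h⟩ ^ pairing Λ (simpleRoot (i.1 ⟨0, h⟩)) * fe Z i) 0

end Relations

/-- The unital algebra `R_β^Λ`: generators `ψ_r`, `y_r`, `e(i)` with `i ∈ I^β`, subject to the
KLR relations and the cyclotomic relation. It is zero when `β` does not have height `n`. -/
abbrev Block (Z : Type*) [CommRing Z] {e : ℕ} (n : ℕ) (Λ : PosWeight e) (β : PosRoot e) : Type _ :=
  RingQuot (Rel Z (n := n) Λ β)

/-- The cyclotomic quiver Hecke algebra `R_n^Λ = ⨁_{β ∈ Q⁺} R_β^Λ`. Only finitely many of the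
summands are non-zero (for every `Λ`), so the sum is the product, which is used here because
it carries the unit `(1)_β`. -/
abbrev Alg (Z : Type*) [CommRing Z] {e : ℕ} (n : ℕ) (Λ : PosWeight e) : Type _ :=
  (β : PosRoot e) → Block Z n Λ β

section Generators

variable (Z : Type*) [CommRing Z] {e n : ℕ} (Λ : PosWeight e)

/-- The image of a free generator in `R_β^Λ`. -/
def gen {β : PosRoot e} (g : Gen n β) : Block Z n Λ β :=
  RingQuot.mkAlgHom Z (Rel Z Λ β) (FreeAlgebra.ι Z g)

/-- The generator `ψ_r` of `R_n^Λ`. -/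
def psi (r : Fin (n - 1)) : Alg Z n Λ := fun _ => gen Z Λ (Gen.psi r)

/-- The generator `y_r` of `R_n^Λ`. -/
def y (r : Fin n) : Alg Z n Λ := fun _ => gen Z Λ (Gen.y r)

open Classical in
/-- The idempotent `e(i)` of `R_n^Λ`, for `i ∈ Iⁿ`: it lies in the block of `β = ∑ α_{i_r}`. -/
def idem (i : Fin n → ZMod e) : Alg Z n Λ := fun β =>
  if h : rootSum i = β then gen Z Λ (Gen.idem ⟨i, h⟩) else 0

/-- Products of the elements `e(i)`, `y_r` and `ψ_r e(i)` of `R_β^Λ`, with their degrees, where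
`deg e(i) = 0`, `deg y_r = 2` and `deg ψ_r e(i) = -c_{i_r, i_{r+1}}`. -/
inductive Monomial (β : PosRoot e) : ℤ → Block Z n Λ β → Prop
  | one : Monomial β 0 1
  | idem (d : ℤ) (x : Block Z n Λ β) (i : Seq n β) (hx : Monomial β d x) :
      Monomial β d (x * gen Z Λ (Gen.idem i))
  | y (d : ℤ) (x : Block Z n Λ β) (r : Fin n) (hx : Monomial β d x) :
      Monomial β (d + 2) (x * gen Z Λ (Gen.y r))
  | psi (d : ℤ) (x : Block Z n Λ β) (r : Fin (n - 1)) (i : Seq n β) (hx : Monomial β d x) :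
      Monomial β (d - cartan (i.1 (lo r)) (i.1 (hi r)))
        (x * (gen Z Λ (Gen.psi r) * gen Z Λ (Gen.idem i)))

variable (n)

/-- The homogeneous component of degree `d` of `R_n^Λ`. -/
def homogeneous (d : ℤ) : Submodule Z (Alg Z n Λ) :=
  Submodule.pi Set.univ fun β => Submodule.span Z {x | Monomial Z Λ β d x}

end Generators

/-! ### Multipartitions and tableaux -/

/-- An `ℓ`-multipartition of `n`. Partitions are given by their Young diagrams. -/
@[ext]
structure Multipartition (ℓ n : ℕ) : Type where
  /-- the components -/
  comp : Fin ℓ → YoungDiagram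
  sum_card : ∑ l, (comp l).card = n

namespace Multipartition

variable {ℓ n : ℕ}

/-- `∑_{k < l} |λ^(k)| + ∑_{j ≤ i} λ^(l)_j`, the rows being numbered `1, 2, …`. -/
def partialSum (lam : Multipartition ℓ n) (l : Fin ℓ) (i : ℕ) : ℕ :=
  ∑ k ∈ Finset.univ.filter (· < l), (lam.comp k).card +
    ∑ j ∈ Finset.range i, (lam.comp l).rowLen j

/-- The dominance order: `mu ≤ lam` if `lam` dominates `mu`. (The inequalities for `i = 0`
follow from the others.) -/
instance : PartialOrder (Multipartition ℓ n) where
  le mu lam := ∀ l i, mu.partialSum l i ≤ lam.partialSum l i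
  le_refl _ _ _ := le_rfl
  le_trans _ _ _ h₁ h₂ l i := (h₁ l i).trans (h₂ l i)
  le_antisymm lam mu h₁ h₂ := by
    have h : ∀ l i, lam.partialSum l i = mu.partialSum l i := fun l i =>
      le_antisymm (h₁ l i) (h₂ l i)
    have hr : ∀ l i, (lam.comp l).rowLen i = (mu.comp l).rowLen i := by
      intro l i
      have a := h l i
      have b := h l (i + 1)
      simp only [partialSum, Finset.sum_range_succ] at a b
      omega
    apply Multipartition.ext
    funext l
    apply YoungDiagram.ext
    ext ⟨a, b⟩
    rw [YoungDiagram.mem_cells, YoungDiagram.mem_cells, YoungDiagram.mem_iff_lt_rowLen,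
      YoungDiagram.mem_iff_lt_rowLen, hr]

instance : Finite (Multipartition ℓ n) := by
  have hsub : ∀ (lam : Multipartition ℓ n) (l : Fin ℓ),
      (lam.comp l).cells ∈ (Finset.range n ×ˢ Finset.range n).powerset := by
    intro lam l
    rw [Finset.mem_powerset]
    rintro ⟨a, b⟩ hab
    have hc : (lam.comp l).card ≤ n :=
      (Finset.single_le_sum (f := fun l => (lam.comp l).card) (fun _ _ => Nat.zero_le _)
        (Finset.mem_univ l)).trans lam.sum_card.le
    have hmem := (YoungDiagram.mem_cells _).1 hab
    have h1 : (lam.comp l).colLen b ≤ (lam.comp l).card := by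
      rw [YoungDiagram.colLen_eq_card]
      exact Finset.card_le_card (Finset.filter_subset _ _)
    have h2 : (lam.comp l).rowLen a ≤ (lam.comp l).card := by
      rw [YoungDiagram.rowLen_eq_card]
      exact Finset.card_le_card (Finset.filter_subset _ _)
    have h3 := YoungDiagram.mem_iff_lt_colLen.1 hmem
    have h4 := YoungDiagram.mem_iff_lt_rowLen.1 hmem
    simp only [Finset.mem_product, Finset.mem_range]
    omega
  refine Finite.of_injective
    (β := Fin ℓ → (Finset.range n ×ˢ Finset.range n).powerset)
    (fun lam l => ⟨(lam.comp l).cells, hsub lam l⟩) ?_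
  intro lam mu h
  apply Multipartition.ext
  funext l
  apply YoungDiagram.ext
  exact congrArg Subtype.val (congrFun h l)

/-- The nodes `(l, r, c)` of (the diagram of) a multipartition, in lexicographic order:
component, row, column, each numbered from `0`. -/
def Node (lam : Multipartition ℓ n) : Type :=
  {x : Fin ℓ ×ₗ ℕ ×ₗ ℕ // ((ofLex (ofLex x).2).1, (ofLex (ofLex x).2).2) ∈ lam.comp (ofLex x).1}

instance (lam : Multipartition ℓ n) : LinearOrder lam.Node :=
  inferInstanceAs (LinearOrder (Subtype _))

namespace Node

variable {lam : Multipartition ℓ n}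

/-- The component containing a node. -/
def component (x : lam.Node) : Fin ℓ := (ofLex x.1).1

/-- The row of a node. -/
def row (x : lam.Node) : ℕ := (ofLex (ofLex x.1).2).1

/-- The column of a node. -/
def col (x : lam.Node) : ℕ := (ofLex (ofLex x.1).2).2

end Node

/-- Nodes as pairs of a component and a cell of that component. -/
def nodeEquiv (lam : Multipartition ℓ n) : lam.Node ≃ Σ l : Fin ℓ, (lam.comp l).cells where
  toFun x := ⟨x.component, (x.row, x.col), (YoungDiagram.mem_cells _).2 x.2⟩
  invFun y := ⟨toLex (y.1, toLex (y.2.1.1, y.2.1.2)), (YoungDiagram.mem_cells _).1 y.2.2⟩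
  left_inv _ := rfl
  right_inv _ := rfl

instance (lam : Multipartition ℓ n) : Fintype lam.Node := Fintype.ofEquiv _ lam.nodeEquiv.symm

theorem card_node (lam : Multipartition ℓ n) : Fintype.card lam.Node = n := by
  rw [Fintype.card_congr lam.nodeEquiv, Fintype.card_sigma]
  simpa using lam.sum_card

/-- A standard `lam`-tableau: a bijection from the nodes to `{1, …, n}` (here `Fin n`) which
increases along rows and down columns in each component. -/
@[ext]
structure Std (lam : Multipartition ℓ n) : Type where
  /-- the entries -/
  entry : lam.Node ≃ Fin n
  row_lt : ∀ x z : lam.Node, x.component = z.component → x.row = z.row → x.col < z.col →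
    entry x < entry z
  col_lt : ∀ x z : lam.Node, x.component = z.component → x.col = z.col → x.row < z.row →
    entry x < entry z

instance (lam : Multipartition ℓ n) : Finite lam.Std :=
  Finite.of_injective Std.entry fun _ _ h => Std.ext h

instance (lam : Multipartition ℓ n) : Fintype lam.Std := Fintype.ofFinite _

/-- The initial tableau `t^lam`: the numbers are entered in order along the rows of the first
component, then of the second component, and so on. -/
def initial (lam : Multipartition ℓ n) : lam.Std where
  entry := (Fintype.orderIsoFinOfCardEq lam.Node lam.card_node).symm.toEquiv
  row_lt x z h₁ h₂ h₃ := by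
    refine (Fintype.orderIsoFinOfCardEq lam.Node lam.card_node).symm.strictMono ?_
    change x.1 < z.1
    rw [Prod.Lex.lt_iff]
    refine Or.inr ⟨h₁, ?_⟩
    rw [Prod.Lex.lt_iff]
    exact Or.inr ⟨h₂, h₃⟩
  col_lt x z h₁ _ h₃ := by
    refine (Fintype.orderIsoFinOfCardEq lam.Node lam.card_node).symm.strictMono ?_
    change x.1 < z.1
    rw [Prod.Lex.lt_iff]
    refine Or.inr ⟨h₁, ?_⟩
    rw [Prod.Lex.lt_iff]
    exact Or.inl h₃

/-- The residue sequence of a tableau, with respect to a multicharge `κ`: the residue of a node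
`(l, r, c)` is `κ_l + c - r` modulo `e`. -/
def Std.residues {lam : Multipartition ℓ n} (e : ℕ) (κ : Fin ℓ → ℤ) (t : lam.Std) :
    Fin n → ZMod e := fun k =>
  let x := t.entry.symm k
  ((κ x.component + (x.col : ℤ) - (x.row : ℤ) : ℤ) : ZMod e)

/-- The permutation `d(t)` with `t = t^lam d(t)`, where permutations act from the right on the
entries of tableaux. -/
def Std.perm {lam : Multipartition ℓ n} (t : lam.Std) : Equiv.Perm (Fin n) :=
  lam.initial.entry.symm.trans t.entry

end Multipartition

/-! ### Reduced words and the elements `e_{st}` -/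

/-- The product `s_{r₁} ⋯ s_{r_k}` of a word, for permutations acting from the right: `s_{r₁}`
is applied first. -/
def wordPerm {n : ℕ} : List (Fin (n - 1)) → Equiv.Perm (Fin n)
  | [] => Equiv.refl _
  | r :: w => (simpleSwap r).trans (wordPerm w)

/-- `w` is a reduced expression for the permutation `σ`. -/
def IsReduced {n : ℕ} (σ : Equiv.Perm (Fin n)) (w : List (Fin (n - 1))) : Prop :=
  wordPerm w = σ ∧ ∀ w' : List (Fin (n - 1)), wordPerm w' = σ → w.length ≤ w'.length

section Basis

variable (Z : Type*) [CommRing Z] {e n ℓ : ℕ} (Λ : PosWeight e)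

/-- The product `ψ_{r₁} ⋯ ψ_{r_k}` of a word. -/
def psiWord (w : List (Fin (n - 1))) : Alg Z n Λ := (w.map (psi Z Λ)).prod

/-- The element `e_{st} = ψ_{d(s)⁻¹} e(i^lam) ψ_{d(t)}`, where `red` is the chosen reduced
expression of each permutation. -/
def eElt (κ : Fin ℓ → ℤ) (red : Equiv.Perm (Fin n) → List (Fin (n - 1)))
    {lam : Multipartition ℓ n} (s t : lam.Std) : Alg Z n Λ :=
  psiWord Z Λ (red s.perm⁻¹) * idem Z Λ (lam.initial.residues e κ) * psiWord Z Λ (red t.perm)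

end Basis

/-! ### Graded cellular algebras -/

/-- The family `c` is a cellular basis of the `Z`-algebra `A`, for the weight poset `P` and the
finite sets `T lam`. -/
structure IsCellularBasis (Z A : Type*) [CommRing Z] [Ring A] [Algebra Z A]
    {P : Type*} [PartialOrder P] (T : P → Type*) [∀ lam, Fintype (T lam)]
    (c : (lam : P) → T lam → T lam → A) : Prop where
  free : Module.Free Z A
  finite : Module.Finite Z A
  injective : Function.Injective fun x : Σ lam : P, T lam × T lam => c x.1 x.2.1 x.2.2
  linearIndependent :
    LinearIndependent Z fun x : Σ lam : P, T lam × T lam => c x.1 x.2.1 x.2.2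
  span_eq_top :
    Submodule.span Z (Set.range fun x : Σ lam : P, T lam × T lam => c x.1 x.2.1 x.2.2) = ⊤
  mul_right : ∀ (lam : P) (t : T lam) (a : A), ∃ r : T lam → Z, ∀ s : T lam,
    c lam s t * a - ∑ v : T lam, r v • c lam s v ∈
      Submodule.span Z {x : A | ∃ mu : P, lam < mu ∧ ∃ u v : T mu, x = c mu u v}
  star : ∃ φ : A ≃ₐ[Z] Aᵐᵒᵖ, ∀ (lam : P) (s t : T lam),
    φ (c lam s t) = MulOpposite.op (c lam t s)

/-- The family `c` is a graded cellular basis, with degree function `deg`, of the algebra `A`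
which is graded by the submodules `𝒜 d`. -/
structure IsGradedCellularBasis (Z A : Type*) [CommRing Z] [Ring A] [Algebra Z A]
    (𝒜 : ℤ → Submodule Z A)
    {P : Type*} [PartialOrder P] (T : P → Type*) [∀ lam, Fintype (T lam)]
    (c : (lam : P) → T lam → T lam → A) (deg : (lam : P) → T lam → ℤ) : Prop where
  graded : Nonempty (GradedAlgebra 𝒜)
  cellular : IsCellularBasis Z A T c
  homogeneous : ∀ (lam : P) (s t : T lam), c lam s t ∈ 𝒜 (deg lam s + deg lam t)

end

end CycKLR

/-! The hypotheses say that `e` is too large and the charges too far apart for residues to interfere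
inside a diagram with few boxes: distinct boxes addable to a diagram with at most n - 1 boxes have
different residues, and even non-adjacent ones if it has at most n - 2 boxes (`Addable.res_sub_ne`).
Hence a residue sequence determines its standard tableau and even the shape. Two consecutive entries
can be swapped exactly when their residues are neither equal nor adjacent, and no residue sequence
contains consecutive letters (i, i) or (i, i ± 1, i).

Upper bound. Induction on the length of a prefix (`SatisfiesKLR.growth_and_y`) derives from the
relations that e(i) = 0 unless i is the residue sequence of a standard tableau, and that every y_r
is 0. The exceptional braid terms then disappear, so ψ_w depends only on w by Matsumoto's theorem.
If i is the residue sequence of t, then ψ_r² e(i) = e(i) when r, r+1 can be swapped in t, and ψ_r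
e(i) = 0 otherwise. So right multiplication by ψ_r sends e_{st} to some e_{su} or to 0, e_{tt} is
the idempotent of the residues of t, and the e_{st} span (`span_eElt`).

Lower bound. On the free module over Std(λ), let e(i) project onto the tableaux with residues i, let
ψ_r swap r and r+1 where this is possible and be 0 elsewhere, and let y_r be 0. All relations hold
(`freeRep_rel`), and e_{st} acts as a matrix unit for its own shape and as 0 for the others
(`rep_eElt`). A spanning set is thus carried bijectively onto the standard basis of a product of
matrix rings, so the representation is an isomorphism (`rep_bijective`). Multiplication and the
cellular anti-involution, which is transposition, are read off there. The grading is concentrated in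
degree 0, because y_r = 0 and each ψ_r e(i) is either zero or of degree 0. -/

namespace CycKLR

/-! ### Symmetric groups: inversions, reduced words, Matsumoto's theorem -/

section Words

variable {n : ℕ}

theorem lo_ne_hi (r : Fin (n - 1)) : lo r ≠ hi r := by
  simp [lo, hi, Fin.ext_iff]

theorem lo_lt_hi (r : Fin (n - 1)) : lo r < hi r := by
  simp [lo, hi, Fin.lt_def]

@[simp] theorem simpleSwap_lo (r : Fin (n - 1)) : simpleSwap r (lo r) = hi r :=
  Equiv.swap_apply_left _ _

@[simp] theorem simpleSwap_hi (r : Fin (n - 1)) : simpleSwap r (hi r) = lo r :=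
  Equiv.swap_apply_right _ _

theorem simpleSwap_of_ne {r : Fin (n - 1)} {a : Fin n} (h₁ : a ≠ lo r) (h₂ : a ≠ hi r) :
    simpleSwap r a = a :=
  Equiv.swap_apply_of_ne_of_ne h₁ h₂

@[simp] theorem simpleSwap_simpleSwap (r : Fin (n - 1)) (a : Fin n) :
    simpleSwap r (simpleSwap r a) = a :=
  Equiv.swap_apply_self _ _ _

@[simp] theorem simpleSwap_symm (r : Fin (n - 1)) : (simpleSwap r).symm = simpleSwap r :=
  Equiv.symm_swap _ _

@[simp] theorem simpleSwap_trans_self (r : Fin (n - 1)) :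
    (simpleSwap r).trans (simpleSwap r) = Equiv.refl _ := by
  ext a; simp

theorem simpleSwap_val (r : Fin (n - 1)) (a : Fin n) :
    ((simpleSwap r a : Fin n) : ℕ) =
      if (a : ℕ) = r then (r : ℕ) + 1 else if (a : ℕ) = r + 1 then (r : ℕ) else a := by
  by_cases h₁ : a = lo r
  · subst h₁; rw [simpleSwap_lo]; simp [lo, hi]
  by_cases h₂ : a = hi r
  · subst h₂; rw [simpleSwap_hi]; simp [lo, hi]
  rw [simpleSwap_of_ne h₁ h₂, if_neg, if_neg]
  · exact fun h => h₂ (Fin.ext h)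
  · exact fun h => h₁ (Fin.ext h)

theorem simpleSwap_comm {r s : Fin (n - 1)} (h : r.1 + 1 < s.1) (σ : Equiv.Perm (Fin n)) :
    (simpleSwap s).trans ((simpleSwap r).trans σ) =
      (simpleSwap r).trans ((simpleSwap s).trans σ) := by
  ext a
  simp only [Equiv.trans_apply]
  congr 2
  rw [Fin.ext_iff]
  simp only [simpleSwap_val]
  split_ifs <;> omega

theorem simpleSwap_braid {r s : Fin (n - 1)} (h : s.1 = r.1 + 1) (σ : Equiv.Perm (Fin n)) :
    (simpleSwap r).trans ((simpleSwap s).trans ((simpleSwap r).trans σ)) =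
      (simpleSwap s).trans ((simpleSwap r).trans ((simpleSwap s).trans σ)) := by
  have e₀ : hi r = lo s := by simp [lo, hi, h]
  have e₂ : simpleSwap r (hi s) = hi s := simpleSwap_of_ne
    (by simp [lo, hi, Fin.ext_iff]; omega) (by simp [hi, Fin.ext_iff]; omega)
  have e₃ : simpleSwap s (lo r) = lo r := simpleSwap_of_ne
    (by simp [lo, Fin.ext_iff]; omega) (by simp [lo, hi, Fin.ext_iff]; omega)
  have e₄ : simpleSwap r (lo s) = lo r := by rw [← e₀, simpleSwap_hi]
  ext a
  simp only [Equiv.trans_apply]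
  congr 2
  by_cases h₁ : a = lo r
  · subst h₁
    simp [e₀, e₂, e₃]
  by_cases h₂ : a = lo s
  · subst h₂
    simp [e₂, e₃, e₄, e₀]
  by_cases h₃ : a = hi s
  · subst h₃
    simp [e₂, e₃, e₄]
  simp [simpleSwap_of_ne h₁ (e₀ ▸ h₂), simpleSwap_of_ne h₂ h₃]

theorem wordPerm_append (w w' : List (Fin (n - 1))) :
    wordPerm (w ++ w') = (wordPerm w).trans (wordPerm w') := by
  induction w with
  | nil => rfl
  | cons r w ih => simp [wordPerm, ih, Equiv.trans_assoc]

/-- The set of inversions of a permutation. -/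
def inversions (σ : Equiv.Perm (Fin n)) : Finset (Fin n × Fin n) :=
  Finset.univ.filter fun p => p.1 < p.2 ∧ σ p.2 < σ p.1

theorem mem_inversions {σ : Equiv.Perm (Fin n)} {p : Fin n × Fin n} :
    p ∈ inversions σ ↔ p.1 < p.2 ∧ σ p.2 < σ p.1 := by
  simp [inversions]

/-- The number of inversions of a permutation. -/
def inv (σ : Equiv.Perm (Fin n)) : ℕ := (inversions σ).card

theorem simpleSwap_lt_simpleSwap {r : Fin (n - 1)} {a b : Fin n} (h : a < b)
    (hne : ¬(a = lo r ∧ b = hi r)) : simpleSwap r a < simpleSwap r b := by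
  rw [Fin.lt_def] at h ⊢
  rw [simpleSwap_val, simpleSwap_val]
  have : ¬((a : ℕ) = r ∧ (b : ℕ) = r + 1) := fun h' => hne ⟨Fin.ext h'.1, Fin.ext h'.2⟩
  split_ifs <;> omega

/-- Applying s_r to both coordinates matches the inversions of `σ` with those of the new permutation
other than (`lo r`, `hi r`), the only pair of positions whose order s_r changes. -/
theorem inv_swap_of_lt {r : Fin (n - 1)} {σ : Equiv.Perm (Fin n)} (h : σ (lo r) < σ (hi r)) :
    inv ((simpleSwap r).trans σ) = inv σ + 1 := by
  have hmem : (lo r, hi r) ∈ inversions ((simpleSwap r).trans σ) := by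
    rw [mem_inversions]
    exact ⟨lo_lt_hi r, by simpa using h⟩
  unfold inv
  rw [← Finset.card_erase_add_one hmem]
  congr 1
  refine Finset.card_nbij' (fun p => (simpleSwap r p.1, simpleSwap r p.2))
    (fun p => (simpleSwap r p.1, simpleSwap r p.2)) ?_ ?_ ?_ ?_
  · rintro ⟨a, b⟩ hp
    simp only [Finset.coe_erase, Set.mem_sdiff, Finset.mem_coe, mem_inversions,
      Set.mem_singleton_iff, Prod.mk.injEq] at hp ⊢
    exact ⟨simpleSwap_lt_simpleSwap hp.1.1 hp.2, hp.1.2⟩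
  · rintro ⟨a, b⟩ hp
    simp only [Finset.coe_erase, Set.mem_sdiff, Finset.mem_coe, mem_inversions,
      Set.mem_singleton_iff, Prod.mk.injEq] at hp ⊢
    have hne : ¬(a = lo r ∧ b = hi r) := by
      rintro ⟨rfl, rfl⟩
      exact absurd hp.2 h.not_gt
    refine ⟨⟨simpleSwap_lt_simpleSwap hp.1 hne, by simpa using hp.2⟩, ?_⟩
    rintro ⟨h₁, h₂⟩
    have h₁' := congrArg (simpleSwap r) h₁
    have h₂' := congrArg (simpleSwap r) h₂
    simp only [simpleSwap_simpleSwap, simpleSwap_lo, simpleSwap_hi] at h₁' h₂'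
    exact absurd hp.1 (by rw [h₁', h₂']; exact (lo_lt_hi r).not_gt)
  · rintro ⟨a, b⟩ _; simp
  · rintro ⟨a, b⟩ _; simp

theorem inv_swap_of_gt {r : Fin (n - 1)} {σ : Equiv.Perm (Fin n)} (h : σ (hi r) < σ (lo r)) :
    inv ((simpleSwap r).trans σ) + 1 = inv σ := by
  rw [← inv_swap_of_lt (r := r) (σ := (simpleSwap r).trans σ) (by simpa using h),
    ← Equiv.trans_assoc, simpleSwap_trans_self, Equiv.refl_trans]

theorem inv_swap_le (r : Fin (n - 1)) (σ : Equiv.Perm (Fin n)) :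
    inv ((simpleSwap r).trans σ) ≤ inv σ + 1 := by
  rcases lt_or_gt_of_ne (σ.injective.ne (lo_ne_hi r)) with h | h
  · exact (inv_swap_of_lt h).le
  · have := inv_swap_of_gt h
    omega

theorem inv_refl : inv (Equiv.refl (Fin n)) = 0 := by
  rw [inv, Finset.card_eq_zero, Finset.eq_empty_iff_forall_notMem]
  intro p hp
  rw [mem_inversions] at hp
  exact absurd hp.1 hp.2.not_gt

theorem inv_symm (σ : Equiv.Perm (Fin n)) : inv σ.symm = inv σ := by
  refine Finset.card_nbij' (fun p => (σ.symm p.2, σ.symm p.1)) (fun p => (σ p.2, σ p.1)) ?_ ?_ ?_ ?_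
  · rintro ⟨a, b⟩ hp
    simp only [Finset.mem_coe, mem_inversions] at hp ⊢
    simpa using hp.symm
  · rintro ⟨a, b⟩ hp
    simp only [Finset.mem_coe, mem_inversions] at hp ⊢
    simpa using hp.symm
  · rintro ⟨a, b⟩ _; simp
  · rintro ⟨a, b⟩ _; simp

/-- A bijection from a linear order onto `Fin n` without descents is monotone. -/
theorem strictMono_of_lo_lt_hi {α : Type*} [LinearOrder α] {f : Fin n → α}
    (h : ∀ r : Fin (n - 1), f (lo r) < f (hi r)) : StrictMono f := by
  cases n with
  | zero => exact fun a => a.elim0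
  | succ m =>
    rw [Fin.strictMono_iff_lt_succ]
    intro i
    exact h i

theorem exists_descent {σ : Equiv.Perm (Fin n)} (h : σ ≠ Equiv.refl _) :
    ∃ r : Fin (n - 1), σ (hi r) < σ (lo r) := by
  by_contra! hcon
  apply h
  have hm : StrictMono σ := strictMono_of_lo_lt_hi fun r =>
    lt_of_le_of_ne (hcon r) (σ.injective.ne (lo_ne_hi r))
  have : hm.orderIsoOfSurjective σ σ.surjective = OrderIso.refl _ := Subsingleton.elim _ _
  ext a
  exact congrArg Fin.val (DFunLike.congr_fun this a)

theorem inv_wordPerm_le (w : List (Fin (n - 1))) : inv (wordPerm w) ≤ w.length := by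
  induction w with
  | nil => exact inv_refl.le
  | cons r w ih => exact (inv_swap_le r _).trans (by simpa using ih)

/-- Bubble sort: composing with s_r at a descent removes exactly one inversion, until none is left.
-/
theorem exists_word (σ : Equiv.Perm (Fin n)) : ∃ w, wordPerm w = σ ∧ w.length = inv σ := by
  induction hk : inv σ generalizing σ with
  | zero =>
    refine ⟨[], ?_, rfl⟩
    by_contra hne
    obtain ⟨r, hr⟩ := exists_descent (Ne.symm hne)
    have := inv_swap_of_gt hr
    omega
  | succ k ih =>
    have hne : σ ≠ Equiv.refl _ := by
      rintro rfl
      rw [inv_refl] at hk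
      omega
    obtain ⟨r, hr⟩ := exists_descent hne
    have h := inv_swap_of_gt hr
    obtain ⟨w, hw, hl⟩ := ih ((simpleSwap r).trans σ) (by omega)
    refine ⟨r :: w, ?_, by simp [hl]⟩
    rw [wordPerm, hw, ← Equiv.trans_assoc, simpleSwap_trans_self, Equiv.refl_trans]

/-- Replaces minimality over all words by a count that can be followed letter by letter: each letter
changes the number of inversions by one, and bubble sort attains the resulting bound. -/
theorem isReduced_iff {σ : Equiv.Perm (Fin n)} {w : List (Fin (n - 1))} :
    IsReduced σ w ↔ wordPerm w = σ ∧ w.length = inv σ := by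
  constructor
  · rintro ⟨rfl, h⟩
    obtain ⟨w', hw', hl⟩ := exists_word (wordPerm w)
    exact ⟨rfl, le_antisymm (hl ▸ h w' hw') (inv_wordPerm_le w)⟩
  · rintro ⟨rfl, h⟩
    exact ⟨rfl, fun w' hw' => by rw [h, ← hw']; exact inv_wordPerm_le w'⟩

/-- Removing the first letter of a reduced expression. -/
theorem IsReduced.of_cons {σ : Equiv.Perm (Fin n)} {r : Fin (n - 1)} {w : List (Fin (n - 1))}
    (h : IsReduced σ (r :: w)) : IsReduced ((simpleSwap r).trans σ) w ∧ σ (hi r) < σ (lo r) := by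
  rw [isReduced_iff] at h
  obtain ⟨rfl, hl⟩ := h
  have hw : (simpleSwap r).trans (wordPerm (r :: w)) = wordPerm w := by
    rw [wordPerm, ← Equiv.trans_assoc, simpleSwap_trans_self, Equiv.refl_trans]
  have h₁ := inv_wordPerm_le w
  rw [List.length_cons] at hl
  rcases lt_or_gt_of_ne ((wordPerm (r :: w)).injective.ne (lo_ne_hi r)) with h | h
  · have := inv_swap_of_lt h
    rw [hw] at this
    omega
  · have := inv_swap_of_gt h
    rw [isReduced_iff, hw]
    rw [hw] at this
    exact ⟨⟨rfl, by omega⟩, h⟩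

/-- Prepending a letter to a reduced expression. -/
theorem IsReduced.cons {σ : Equiv.Perm (Fin n)} {r : Fin (n - 1)} {w : List (Fin (n - 1))}
    (h : IsReduced ((simpleSwap r).trans σ) w) (hr : σ (hi r) < σ (lo r)) :
    IsReduced σ (r :: w) := by
  rw [isReduced_iff] at h ⊢
  have := inv_swap_of_gt hr
  refine ⟨?_, by rw [List.length_cons]; omega⟩
  rw [wordPerm, h.1, ← Equiv.trans_assoc, simpleSwap_trans_self, Equiv.refl_trans]

theorem exists_isReduced (σ : Equiv.Perm (Fin n)) : ∃ w, IsReduced σ w := by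
  obtain ⟨w, hw⟩ := exists_word σ
  exact ⟨w, isReduced_iff.2 hw⟩

/-- Matsumoto's theorem for the symmetric group: the product over a reduced expression of
elements satisfying the braid relations depends only on the permutation. -/
theorem prod_eq_of_isReduced {M : Type*} [Monoid M] (f : Fin (n - 1) → M)
    (hcomm : ∀ r s : Fin (n - 1), r.1 + 1 < s.1 → f r * f s = f s * f r)
    (hbraid : ∀ r s : Fin (n - 1), s.1 = r.1 + 1 → f r * f s * f r = f s * f r * f s)
    {σ : Equiv.Perm (Fin n)} {w w' : List (Fin (n - 1))} (hw : IsReduced σ w)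
    (hw' : IsReduced σ w') : (w.map f).prod = (w'.map f).prod := by
  induction hk : w.length generalizing σ w w' with
  | zero =>
    have h' : w'.length = 0 := by
      rw [(isReduced_iff.1 hw').2, ← (isReduced_iff.1 hw).2, hk]
    rw [List.length_eq_zero_iff.1 hk, List.length_eq_zero_iff.1 h']
  | succ k ih =>
    have h' : w'.length = k + 1 := by
      rw [(isReduced_iff.1 hw').2, ← (isReduced_iff.1 hw).2, hk]
    -- Both `r` and `s` are descents of `σ`, so `σ` also has reduced words r s x and s r x with a
    -- common tail x. The induction hypothesis compares `u` with s x and `v` with r x.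
    have far : ∀ (σ : Equiv.Perm (Fin n)) (r s : Fin (n - 1)) (u v : List (Fin (n - 1))),
        r.1 + 1 < s.1 → IsReduced σ (r :: u) → IsReduced σ (s :: v) → u.length = k →
        v.length = k → ((r :: u).map f).prod = ((s :: v).map f).prod := by
      intro σ r s u v hrs hu hv hku hkv
      obtain ⟨hu, hr⟩ := hu.of_cons
      obtain ⟨hv, hs⟩ := hv.of_cons
      have e₁ : simpleSwap r (lo s) = lo s := simpleSwap_of_ne
        (by simp [lo, Fin.ext_iff]; omega) (by simp [lo, hi, Fin.ext_iff]; omega)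
      have e₂ : simpleSwap r (hi s) = hi s := simpleSwap_of_ne
        (by simp [lo, hi, Fin.ext_iff]; omega) (by simp [hi, Fin.ext_iff]; omega)
      have e₃ : simpleSwap s (lo r) = lo r := simpleSwap_of_ne
        (by simp [lo, Fin.ext_iff]; omega) (by simp [lo, hi, Fin.ext_iff]; omega)
      have e₄ : simpleSwap s (hi r) = hi r := simpleSwap_of_ne
        (by simp [lo, hi, Fin.ext_iff]; omega) (by simp [hi, Fin.ext_iff]; omega)
      obtain ⟨x, hx⟩ := exists_isReduced ((simpleSwap s).trans ((simpleSwap r).trans σ))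
      have hcs := simpleSwap_comm hrs σ
      have h₁ := ih hu (hx.cons (by simpa [e₁, e₂] using hs)) hku
      have h₂ := ih hv ((hcs ▸ hx).cons (by simpa [e₃, e₄] using hr)) hkv
      simp only [List.map_cons, List.prod_cons] at h₁ h₂ ⊢
      rw [h₁, h₂, ← mul_assoc, ← mul_assoc, hcomm r s hrs]
    -- The same argument with the reduced words r s r x and s r s x: the two descents force `σ` to
    -- reverse all three positions involved.
    have near : ∀ (σ : Equiv.Perm (Fin n)) (r s : Fin (n - 1)) (u v : List (Fin (n - 1))),
        s.1 = r.1 + 1 → IsReduced σ (r :: u) → IsReduced σ (s :: v) → u.length = k →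
        v.length = k → ((r :: u).map f).prod = ((s :: v).map f).prod := by
      intro σ r s u v hrs hu hv hku hkv
      obtain ⟨hu, hr⟩ := hu.of_cons
      obtain ⟨hv, hs⟩ := hv.of_cons
      have e₀ : lo s = hi r := by simp [lo, hi, hrs]
      have e₂ : simpleSwap r (hi s) = hi s := simpleSwap_of_ne
        (by simp [lo, hi, Fin.ext_iff]; omega) (by simp [hi, Fin.ext_iff]; omega)
      have e₃ : simpleSwap s (lo r) = lo r := simpleSwap_of_ne
        (by simp [lo, Fin.ext_iff]; omega) (by simp [lo, hi, Fin.ext_iff]; omega)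
      have e₄ : simpleSwap s (hi r) = hi s := by rw [← e₀, simpleSwap_lo]
      rw [e₀] at hs
      have hcs := simpleSwap_braid hrs σ
      obtain ⟨x, hx⟩ := exists_isReduced
        ((simpleSwap r).trans ((simpleSwap s).trans ((simpleSwap r).trans σ)))
      have h₁ := ih hu ((hx.cons (by simpa [e₃, e₄, e₂] using hs)).cons
        (by simpa [e₀, e₂] using hs.trans hr)) hku
      have h₂ := ih hv (((hcs ▸ hx).cons (by simpa [e₀, e₂, e₃, e₄] using hr)).cons
        (by simpa [e₃, e₄] using hs.trans hr)) hkv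
      simp only [List.map_cons, List.prod_cons] at h₁ h₂ ⊢
      rw [h₁, h₂]
      simp only [← mul_assoc]
      rw [hbraid r s hrs]
    cases w with
    | nil => simp at hk
    | cons r u =>
    cases w' with
    | nil => simp at h'
    | cons s v =>
    simp only [List.length_cons, add_left_inj] at hk h'
    rcases lt_trichotomy r.1 s.1 with hrs | hrs | hrs
    · rcases Nat.eq_or_lt_of_le (Nat.succ_le_of_lt hrs) with h | h
      · exact near σ r s u v h.symm hw hw' hk h'
      · exact far σ r s u v h hw hw' hk h'
    · obtain rfl := Fin.ext hrs
      simp only [List.map_cons, List.prod_cons]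
      rw [ih hw.of_cons.1 hw'.of_cons.1 hk]
    · rcases Nat.eq_or_lt_of_le (Nat.succ_le_of_lt hrs) with h | h
      · exact (near σ s r v u h.symm hw' hw h' hk).symm
      · exact (far σ s r v u h hw' hw h' hk).symm

/-- Appending a letter to a reduced expression. -/
theorem IsReduced.append {σ : Equiv.Perm (Fin n)} {r : Fin (n - 1)} {w : List (Fin (n - 1))}
    (h : IsReduced σ w) (hr : σ.symm (lo r) < σ.symm (hi r)) :
    IsReduced (σ.trans (simpleSwap r)) (w ++ [r]) := by
  rw [isReduced_iff] at h ⊢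
  refine ⟨by rw [wordPerm_append, h.1]; rfl, ?_⟩
  have := inv_swap_of_lt hr
  rw [inv_symm] at this
  rw [← inv_symm (σ.trans _)]
  change _ = inv ((simpleSwap r).symm.trans σ.symm)
  rw [simpleSwap_symm, this, List.length_append, h.2]
  rfl

end Words
end CycKLR

namespace CycKLR

/-! ### Addable boxes of small diagrams and their residues -/

section Boxes

theorem intCast_ne_zero {e n : ℕ} (he : e = 0 ∨ n < e) {x : ℤ} (hx : x ≠ 0) (hn : |x| ≤ n) :
    (x : ZMod e) ≠ 0 := by
  intro h
  have h' : ((x : ℤ) : ZMod e) = ((0 : ℤ) : ZMod e) := by simpa using h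
  rw [ZMod.intCast_eq_intCast_iff, Int.modEq_zero_iff_dvd] at h'
  rcases he with rfl | he
  · exact hx (by simpa using h')
  · exact hx (Int.eq_zero_of_abs_lt_dvd h' (by omega))

variable {ℓ : ℕ}

/-- Possible nodes of `ℓ`-multipartitions: component, row, column. -/
abbrev Box (ℓ : ℕ) : Type := Fin ℓ × ℕ × ℕ

/-- The box `a` lies weakly to the north-west of `b`, in the same component. -/
def Box.Below (a b : Box ℓ) : Prop := a.1 = b.1 ∧ a.2.1 ≤ b.2.1 ∧ a.2.2 ≤ b.2.2

/-- The residue of a box. -/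
def Box.res (e : ℕ) (κ : Fin ℓ → ℤ) (a : Box ℓ) : ZMod e :=
  ((κ a.1 + (a.2.2 : ℤ) - (a.2.1 : ℤ) : ℤ) : ZMod e)

/-- The box `a` can be added to the diagram `S`. -/
def Addable (S : Finset (Box ℓ)) (a : Box ℓ) : Prop :=
  a ∉ S ∧ ∀ b : Box ℓ, b.Below a → b ≠ a → b ∈ S

/-- A diagram with a hook of arm length `C` and leg length `R` has at least `R + C - 1` boxes. -/
theorem hook_le_card {S : Finset (Box ℓ)} (l : Fin ℓ) {R C : ℕ}
    (hR : ∀ p < R, ((l, p, 0) : Box ℓ) ∈ S) (hC : ∀ q < C, ((l, 0, q) : Box ℓ) ∈ S) :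
    R + C ≤ (S.filter (·.1 = l)).card + 1 := by
  have : (Finset.range (R + C - 1)).card ≤ (S.filter (·.1 = l)).card := by
    -- Runs down the first column and then along the first row from column 1, so that the corner is
    -- counted once.
    refine Finset.card_le_card_of_injOn
      (fun t => if t < R then (l, t, 0) else (l, 0, t - R + 1)) ?_ ?_
    · intro t ht
      simp only [Finset.coe_range, Set.mem_Iio] at ht
      simp only [Finset.coe_filter, Set.mem_ofPred_eq]
      split_ifs with h
      · exact ⟨hR t h, rfl⟩
      · exact ⟨hC _ (by omega), rfl⟩
    · intro t ht u hu h
      simp only [Finset.coe_range, Set.mem_Iio] at ht hu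
      simp only at h
      split_ifs at h <;> simp only [Prod.mk.injEq, true_and] at h <;> omega
  rw [Finset.card_range] at this
  omega

/-- All other boxes north-west of the addable box are present, in particular a hook along the first
row and column. This bounds the content c - r by the number of boxes in the same component. -/
theorem Addable.content_le_card {S : Finset (Box ℓ)} {l : Fin ℓ} {r c : ℕ}
    (h : Addable S (l, r, c)) : r + c ≤ (S.filter (·.1 = l)).card := by
  have key : ∀ p q, p ≤ r → q ≤ c → (p < r ∨ q < c) → ((l, p, q) : Box ℓ) ∈ S := by
    intro p q hp hq hpq
    refine h.2 _ ⟨rfl, hp, hq⟩ ?_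
    simp only [ne_eq, Prod.mk.injEq, true_and]
    omega
  rcases Nat.eq_zero_or_pos r with hr | hr <;> rcases Nat.eq_zero_or_pos c with hc | hc
  · omega
  · have := hook_le_card (S := S) l (R := 1) (C := c) (fun p hp => key _ _ (by omega) (by omega)
      (by omega)) (fun q hq => key _ _ (by omega) (by omega) (by omega))
    omega
  · have := hook_le_card (S := S) l (R := r) (C := 1) (fun p hp => key _ _ (by omega) (by omega)
      (by omega)) (fun q hq => key _ _ (by omega) (by omega) (by omega))
    omega
  · have := hook_le_card (S := S) l (R := r) (C := c) (fun p hp => key _ _ (by omega) (by omega)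
      (by omega)) (fun q hq => key _ _ (by omega) (by omega) (by omega))
    have := hook_le_card (S := S) l (R := r + 1) (C := c + 1) (fun p hp => key _ _ (by omega)
      (by omega) (by omega)) (fun q hq => key _ _ (by omega) (by omega) (by omega))
    omega

/-- The charges of `κ` are pairwise at distance at least `n` in `ℤ/eℤ`. -/
def Separated (e n : ℕ) (κ : Fin ℓ → ℤ) : Prop :=
  ∀ l m : Fin ℓ, l ≠ m → ∀ d : ℤ, |d| + 1 ≤ n → ((κ l - κ m - d : ℤ) : ZMod e) ≠ 0

variable {e n : ℕ} {κ : Fin ℓ → ℤ}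

theorem res_sub_res_eq (a b : Box ℓ) (d : ℤ) :
    a.res e κ - b.res e κ - (d : ZMod e) =
      ((κ a.1 - κ b.1 + (a.2.2 - a.2.1) - (b.2.2 - b.2.1) - d : ℤ) : ZMod e) := by
  simp only [Box.res]
  push_cast
  ring

/-- Distinct addable boxes of a small diagram have residues which are far apart. -/
theorem Addable.res_sub_ne (he : e = 0 ∨ n < e) (hs : Separated e n κ) {S : Finset (Box ℓ)}
    {a b : Box ℓ} (ha : Addable S a) (hb : Addable S b) (hab : a ≠ b) {d : ℤ} (hd : |d| ≤ 1)
    (hn : (S.card : ℤ) + 1 + |d| ≤ n) : a.res e κ - b.res e κ - (d : ZMod e) ≠ 0 := by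
  -- Two addable boxes of one component lie strictly north-east and south-west of each other, so
  -- their contents differ by at least 2. The difference is at most r' + c, which is bounded by the
  -- hook with these leg and arm lengths.
  have key : ∀ (l : Fin ℓ) (r c r' c' : ℕ), Addable S (l, r, c) → Addable S (l, r', c') →
      (r, c) ≠ (r', c') → r ≤ r' → r < r' ∧ c' < c ∧ r' + c ≤ S.card + 1 := by
    intro l r c r' c' h h' hne hr
    have hc : c' < c := by
      by_contra hc
      exact h.1 (h'.2 _ ⟨rfl, hr, not_lt.1 hc⟩ fun h => hne (congrArg Prod.snd h))
    have hr : r < r' := by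
      refine lt_of_le_of_ne hr ?_
      rintro rfl
      refine h'.1 (h.2 _ ⟨rfl, le_rfl, hc.le⟩ ?_)
      simp only [ne_eq, Prod.mk.injEq, true_and]
      omega
    refine ⟨hr, hc, (hook_le_card l ?_ ?_).trans (Nat.add_le_add_right (Finset.card_filter_le _ _) 1)⟩
    · intro p hp
      refine h'.2 _ ⟨rfl, hp.le, Nat.zero_le _⟩ ?_
      simp only [ne_eq, Prod.mk.injEq, true_and]
      omega
    · intro q hq
      refine h.2 _ ⟨rfl, Nat.zero_le _, hq.le⟩ ?_
      simp only [ne_eq, Prod.mk.injEq, true_and]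
      omega
  obtain ⟨l, r, c⟩ := a
  obtain ⟨m, r', c'⟩ := b
  rw [res_sub_res_eq]
  by_cases hlm : l = m
  · subst hlm
    have hne : (r, c) ≠ (r', c') := fun h => hab (by rw [h])
    rcases le_total r r' with hr | hr
    · have := key l r c r' c' ha hb hne hr
      apply intCast_ne_zero he
      · dsimp only; intro h; cases abs_cases d <;> omega
      · dsimp only; rw [abs_le]; cases abs_cases d <;> constructor <;> omega
    · have := key l r' c' r c hb ha hne.symm hr
      apply intCast_ne_zero he
      · dsimp only; intro h; cases abs_cases d <;> omega
      · dsimp only; rw [abs_le]; cases abs_cases d <;> constructor <;> omega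
  -- In different components the two contents together are bounded by the number of boxes of two
  -- disjoint parts of `S`, so the shift between the charges has absolute value at most n - 1.
  · have h := hs l m hlm (d + (c' - r') - (c - r)) (by
      have h₁ := ha.content_le_card
      have h₂ := hb.content_le_card
      have h₃ : (S.filter (·.1 = l)).card + (S.filter (·.1 = m)).card ≤ S.card := by
        rw [← Finset.card_union_of_disjoint]
        · exact Finset.card_le_card (Finset.union_subset (Finset.filter_subset _ _)
            (Finset.filter_subset _ _))
        · rw [Finset.disjoint_filter]
          rintro x _ rfl h
          exact hlm h
      have : |d + (c' - r' : ℤ) - (c - r)| ≤ n - 1 := by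
        rw [abs_le]; cases abs_cases d <;> constructor <;> omega
      omega)
    convert h using 2
    ring

theorem Addable.eq_of_res_eq (he : e = 0 ∨ n < e) (hs : Separated e n κ) {S : Finset (Box ℓ)}
    {a b : Box ℓ} (ha : Addable S a) (hb : Addable S b) (hn : S.card + 1 ≤ n)
    (h : a.res e κ = b.res e κ) : a = b := by
  by_contra hab
  refine ha.res_sub_ne he hs hb hab (d := 0) (by simp) ?_ (by simp [h])
  simp
  omega

/-- Two residues which are neither equal nor adjacent. -/
def Far (i j : ZMod e) : Prop := i ≠ j ∧ ¬Arrow i j ∧ ¬Arrow j i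

/-- The two edges correspond to the residue differences 1 and -1. Excluding them costs one box more
than excluding equality. -/
theorem Addable.far (he : e = 0 ∨ n < e) (hs : Separated e n κ) {S : Finset (Box ℓ)}
    {a b : Box ℓ} (ha : Addable S a) (hb : Addable S b) (hn : S.card + 2 ≤ n)
    (hab : a ≠ b) : Far (a.res e κ) (b.res e κ) := by
  refine ⟨fun h => hab (ha.eq_of_res_eq he hs hb (by omega) h), fun h => ?_, fun h => ?_⟩
  · refine ha.res_sub_ne he hs hb hab (d := -1) (by simp) (by simp; omega) ?_
    rw [Arrow] at h
    rw [h]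
    push_cast
    ring
  · refine ha.res_sub_ne he hs hb hab (d := 1) (by simp) (by simp; omega) ?_
    rw [Arrow] at h
    rw [h]
    push_cast
    ring

/-! ### The pairing of a weight with a root string -/

theorem pairing_add (Λ : PosWeight e) (β γ : PosRoot e) :
    pairing Λ (β + γ) = pairing Λ β + pairing Λ γ :=
  Finsupp.sum_add_index' (fun _ => Nat.zero_mul _) fun _ _ _ => Nat.add_mul _ _ _

theorem pairing_simpleRoot (Λ : PosWeight e) (i : ZMod e) : pairing Λ (simpleRoot i) = Λ i := by
  simp [pairing, simpleRoot]

theorem pairing_rootString (Λ : PosWeight e) (i : ZMod e) (n : ℕ) :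
    pairing Λ (rootString i n) = ∑ k ∈ Finset.range n, Λ (i + k) := by
  induction n with
  | zero => simp [pairing, rootString]
  | succ n ih =>
    rw [Finset.sum_range_succ, ← ih, rootString, Finset.sum_range_succ, pairing_add,
      pairing_simpleRoot]
    rfl

theorem weightOf_apply (κ : Fin ℓ → ℤ) (i : ZMod e) :
    weightOf e κ i = ∑ l, if ((κ l : ℤ) : ZMod e) = i then 1 else 0 := by
  simp [weightOf, Finsupp.single_apply]

/-- The pairing with the string starting at κ_m counts the charges congruent to one of κ_m, …, κ_m +
n - 1. The charge κ_m itself already accounts for the permitted 1. -/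
theorem separated_of_pairing_le (hΛ : ∀ i : ZMod e, pairing (weightOf e κ) (rootString i n) ≤ 1) :
    Separated e n κ := by
  have key : ∀ l m : Fin ℓ, l ≠ m → ∀ d : ℕ, d < n → ((κ l : ℤ) : ZMod e) ≠ (κ m : ℤ) + d := by
    intro l m hlm d hd h
    have h₁ := hΛ (κ m : ℤ)
    rw [pairing_rootString] at h₁
    simp only [weightOf_apply] at h₁
    rw [Finset.sum_comm] at h₁
    have h₂ : ∀ x k, k < n → ((κ x : ℤ) : ZMod e) = (κ m : ℤ) + (k : ℕ) →
        1 ≤ ∑ k ∈ Finset.range n, if ((κ x : ℤ) : ZMod e) = (κ m : ℤ) + (k : ℕ) then 1 else 0 := by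
      intro x k hk hx
      refine le_trans ?_ (Finset.single_le_sum (fun _ _ => Nat.zero_le _) (Finset.mem_range.2 hk))
      rw [if_pos hx]
    have h₃ := Finset.sum_le_sum_of_subset (f := fun x => ∑ k ∈ Finset.range n,
      if ((κ x : ℤ) : ZMod e) = (κ m : ℤ) + (k : ℕ) then 1 else 0) (Finset.subset_univ {l, m})
    rw [Finset.sum_pair hlm] at h₃
    have := h₂ l d hd h
    have := h₂ m 0 (by omega) (by simp)
    omega
  intro l m hlm d hd h
  have h' : ((κ l : ℤ) : ZMod e) = (κ m : ℤ) + (d : ZMod e) := by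
    push_cast at h
    linear_combination h
  rcases Int.eq_nat_or_neg d with ⟨k, rfl | rfl⟩
  · exact key l m hlm k (by simp at hd; omega) (by simpa using h')
  · refine key m l hlm.symm k (by simp at hd; omega) ?_
    push_cast at h'
    linear_combination -h'

/-! ### Growing diagrams -/

/-- The diagram consisting of the first `k` boxes of a sequence. -/
def shape (x : Fin n → Box ℓ) (k : ℕ) : Finset (Box ℓ) :=
  (Finset.univ.filter fun j : Fin n => j.1 < k).image x

theorem mem_shape {x : Fin n → Box ℓ} {k : ℕ} {a : Box ℓ} :
    a ∈ shape x k ↔ ∃ j : Fin n, j.1 < k ∧ x j = a := by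
  simp [shape]

/-- The first `k` boxes of the sequence `x` are added one by one, starting from the empty
diagram. -/
def IsGrowth (k : ℕ) (x : Fin n → Box ℓ) : Prop :=
  ∀ j : Fin n, j.1 < k → Addable (shape x j) (x j)

theorem shape_card_le (x : Fin n → Box ℓ) (k : ℕ) : (shape x k).card ≤ k := by
  refine Finset.card_image_le.trans ?_
  rw [← Finset.card_map Fin.valEmbedding]
  refine (Finset.card_le_card ?_).trans (Finset.card_range k).le
  intro a
  simp only [Finset.mem_map, Finset.mem_filter, Finset.mem_univ, true_and, Finset.mem_range,
    Fin.valEmbedding_apply]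
  rintro ⟨j, hj, rfl⟩
  exact hj

theorem shape_congr {x y : Fin n → Box ℓ} {k : ℕ} (h : ∀ j : Fin n, j.1 < k → x j = y j) :
    shape x k = shape y k := by
  ext a
  rw [mem_shape, mem_shape]
  exact exists_congr fun j => and_congr_right fun hj => by rw [h j hj]

theorem IsGrowth.congr {x y : Fin n → Box ℓ} {k : ℕ} (hx : IsGrowth k x)
    (h : ∀ j : Fin n, j.1 < k → x j = y j) : IsGrowth k y := by
  intro j hj
  rw [← h j hj, ← shape_congr fun i hi => h i (hi.trans hj)]
  exact hx j hj

theorem IsGrowth.mono {x : Fin n → Box ℓ} {k k' : ℕ} (hx : IsGrowth k x) (h : k' ≤ k) :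
    IsGrowth k' x := fun j hj => hx j (hj.trans_le h)

theorem IsGrowth.ne {x : Fin n → Box ℓ} {k : ℕ} (hx : IsGrowth k x) {i j : Fin n} (hij : i < j)
    (hj : j.1 < k) : x i ≠ x j :=
  fun h => (hx j hj).1 (mem_shape.2 ⟨i, hij, h⟩)

theorem Box.Below.trans {a b c : Box ℓ} (h : a.Below b) (h' : b.Below c) : a.Below c :=
  ⟨h.1.trans h'.1, h.2.1.trans h'.2.1, h.2.2.trans h'.2.2⟩

/-- A growth lists its boxes along a linear extension of the north-west order. -/
theorem IsGrowth.exists_le {x : Fin n → Box ℓ} {k : ℕ} (hx : IsGrowth k x) {j : Fin n}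
    (hj : j.1 < k) {a : Box ℓ} (ha : a.Below (x j)) : ∃ i ≤ j, x i = a := by
  by_cases h : a = x j
  · exact ⟨j, le_rfl, h.symm⟩
  · obtain ⟨i, hi, h⟩ := mem_shape.1 ((hx j hj).2 a ha h)
    exact ⟨i, le_of_lt hi, h⟩

/-- A growth is determined by its residues. -/
theorem IsGrowth.eq_of_res_eq (he : e = 0 ∨ n < e) (hs : Separated e n κ) {x y : Fin n → Box ℓ}
    {k : ℕ} (hx : IsGrowth k x) (hy : IsGrowth k y)
    (h : ∀ j : Fin n, j.1 < k → (x j).res e κ = (y j).res e κ) (j : Fin n) (hj : j.1 < k) :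
    x j = y j := by
  obtain ⟨j, hjn⟩ := j
  induction j using Nat.strong_induction_on with
  | _ j ih =>
  have hsh : shape x j = shape y j := shape_congr fun i hi => ih i hi i.2 (hi.trans hj)
  refine (hx ⟨j, hjn⟩ hj).eq_of_res_eq he hs (b := y ⟨j, hjn⟩) ?_ ?_ (h _ hj)
  · rw [hsh]
    exact hy ⟨j, hjn⟩ hj
  · have := shape_card_le x j
    simp only
    omega

/-- If the box `x j` is the second of two consecutive boxes, and could not have been added one
step earlier, then it is right of or below its predecessor. -/
theorem IsGrowth.addable_or {x : Fin n → Box ℓ} {k : ℕ} (hx : IsGrowth k x) {i j : Fin n}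
    (hij : j.1 = i.1 + 1) (hj : j.1 < k) : Addable (shape x i) (x j) ∨
      x j = ((x i).1, (x i).2.1, (x i).2.2 + 1) ∨ x j = ((x i).1, (x i).2.1 + 1, (x i).2.2) := by
  by_cases hb : (x i).Below (x j)
  · right
    have hne := hx.ne (i := i) (j := j) (by rw [Fin.lt_def]; omega) hj
    -- A box between `x i` and `x j` in the north-west order must be added at a step from `i` to
    -- `j`, and these steps are consecutive. So the interval has only its two ends, which makes it
    -- one step right or down.
    have key : ∀ a : Box ℓ, (x i).Below a → a.Below (x j) → a = x i ∨ a = x j := by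
      intro a h₁ h₂
      obtain ⟨m, hm, rfl⟩ := hx.exists_le hj h₂
      obtain ⟨m', hm', h⟩ := hx.exists_le (lt_of_le_of_lt hm hj) h₁
      have : i ≤ m := by
        by_contra hlt
        exact hx.ne (lt_of_le_of_lt hm' (not_le.1 hlt)) (by omega) h
      rw [Fin.le_def] at this hm
      rcases Nat.eq_or_lt_of_le this with h | h
      · exact Or.inl (by rw [Fin.ext h])
      · exact Or.inr (by rw [Fin.ext (show m.1 = j.1 by omega)])
    obtain ⟨h₁, h₂, h₃⟩ := hb
    generalize x i = a at *
    generalize x j = b at *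
    obtain ⟨l, r, c⟩ := a
    obtain ⟨m, r', c'⟩ := b
    simp only at h₁ h₂ h₃
    subst h₁
    simp only [ne_eq, Prod.mk.injEq, true_and] at hne ⊢
    rcases Nat.eq_or_lt_of_le h₂ with h | h
    · left
      have := key (l, r, c + 1) ⟨rfl, le_rfl, Nat.le_succ _⟩ ⟨rfl, by simp; omega, by simp; omega⟩
      simp only [Prod.mk.injEq, true_and] at this
      omega
    · right
      have := key (l, r + 1, c) ⟨rfl, Nat.le_succ _, le_rfl⟩ ⟨rfl, by simp; omega, by simp; omega⟩
      simp only [Prod.mk.injEq, true_and] at this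
      omega
  · left
    refine ⟨fun h => ?_, fun b hb' hne => ?_⟩
    · obtain ⟨m, hm, h⟩ := mem_shape.1 h
      exact hx.ne (show m < j by rw [Fin.lt_def]; omega) hj h
    · obtain ⟨m, hm, rfl⟩ := mem_shape.1 ((hx j hj).2 b hb' hne)
      refine mem_shape.2 ⟨m, ?_, rfl⟩
      refine lt_of_le_of_ne (by omega) ?_
      intro h
      exact hb (Fin.ext h ▸ hb')

end Boxes
end CycKLR

namespace CycKLR

/-! ### Standard tableaux as growths, and swaps of consecutive entries -/

namespace Multipartition

variable {ℓ n e : ℕ} {lam mu : Multipartition ℓ n} {κ : Fin ℓ → ℤ}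

/-- The position of a node. -/
def Node.box (x : lam.Node) : Box ℓ := (x.component, x.row, x.col)

/-- The node at a given position. -/
def mkNode (a : Box ℓ) (h : (a.2.1, a.2.2) ∈ lam.comp a.1) : lam.Node :=
  ⟨toLex (a.1, toLex (a.2.1, a.2.2)), h⟩

theorem mkNode_box (a : Box ℓ) (h : (a.2.1, a.2.2) ∈ lam.comp a.1) : (mkNode a h).box = a := rfl

theorem Node.box_injective : Function.Injective (Node.box (lam := lam)) := fun _ _ h =>
  Subtype.ext h

theorem Node.box_mem (x : lam.Node) : (x.box.2.1, x.box.2.2) ∈ lam.comp x.box.1 := x.2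

theorem Node.mem_of_below (x : lam.Node) {a : Box ℓ} (h : a.Below x.box) :
    (a.2.1, a.2.2) ∈ lam.comp a.1 := by
  rw [h.1]
  exact (lam.comp _).up_left_mem h.2.1 h.2.2 x.box_mem

theorem Node.lt_of_below {x z : lam.Node} (h : x.box.Below z.box) (hne : x ≠ z) : x < z := by
  refine lt_of_le_of_ne ?_ hne
  change x.1 ≤ z.1
  rw [Prod.Lex.le_iff]
  refine Or.inr ⟨h.1, ?_⟩
  rw [Prod.Lex.le_iff]
  rcases Nat.eq_or_lt_of_le h.2.1 with h' | h'
  · exact Or.inr ⟨h', h.2.2⟩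
  · exact Or.inl h'

/-- A bijection with `Fin n` which increases in the south-east direction is a standard tableau. -/
def Std.ofEntry (f : lam.Node ≃ Fin n)
    (hf : ∀ x z : lam.Node, x.box.Below z.box → x ≠ z → f x < f z) : lam.Std where
  entry := f
  row_lt x z h₁ h₂ h₃ := hf x z ⟨h₁, h₂.le, h₃.le⟩ (by rintro rfl; exact lt_irrefl _ h₃)
  col_lt x z h₁ h₂ h₃ := hf x z ⟨h₁, h₃.le, h₂.le⟩ (by rintro rfl; exact lt_irrefl _ h₃)

namespace Std

/-- The box which contains a given entry. -/
def box (t : lam.Std) (k : Fin n) : Box ℓ := (t.entry.symm k).box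

theorem residues_apply (t : lam.Std) (k : Fin n) : t.residues e κ k = (t.box k).res e κ := rfl

theorem box_entry (t : lam.Std) (x : lam.Node) : t.box (t.entry x) = x.box := by
  simp [box]

/-- Standardness compares entries only within a row or a column. The box in the row of `z` and the
column of `x` links the two comparisons. -/
theorem entry_lt_of_below (t : lam.Std) {x z : lam.Node} (h : x.box.Below z.box) (hne : x ≠ z) :
    t.entry x < t.entry z := by
  let w : lam.Node := mkNode (z.component, z.row, x.col)
    (z.mem_of_below ⟨rfl, le_rfl, h.2.2⟩)
  have h₁ : t.entry x ≤ t.entry w := by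
    rcases Nat.eq_or_lt_of_le (show x.row ≤ w.row from h.2.1) with h' | h'
    · have : x = w := Node.box_injective (Prod.ext h.1 (Prod.ext h' rfl))
      rw [← this]
    · exact (t.col_lt x w h.1 rfl h').le
  have h₂ : t.entry w ≤ t.entry z := by
    rcases Nat.eq_or_lt_of_le (show w.col ≤ z.col from h.2.2) with h' | h'
    · have : w = z := Node.box_injective (Prod.ext rfl (Prod.ext rfl h'))
      rw [← this]
    · exact (t.row_lt w z rfl rfl h').le
  exact lt_of_le_of_ne (h₁.trans h₂) (t.entry.injective.ne hne)

/-- Together with `exists_std_of_isGrowth` this identifies standard tableaux with growths of length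
n, so that questions about residues can be settled one box at a time. -/
theorem isGrowth (t : lam.Std) (k : ℕ) : IsGrowth k t.box := by
  intro j _
  constructor
  · intro h
    obtain ⟨i, hi, h⟩ := mem_shape.1 h
    have := t.entry.symm.injective (Node.box_injective h)
    omega
  · intro b hb hne
    refine mem_shape.2 ⟨t.entry (mkNode b ((t.entry.symm j).mem_of_below hb)), ?_, ?_⟩
    · have := t.entry_lt_of_below (x := mkNode b ((t.entry.symm j).mem_of_below hb))
        (z := t.entry.symm j) hb (by
          intro h
          exact hne (congrArg Node.box h))
      rwa [Equiv.apply_symm_apply] at this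
    · rw [box_entry, mkNode_box]

theorem ext_box {t u : lam.Std} (h : t.box = u.box) : t = u := by
  apply Std.ext
  rw [← Equiv.symm_symm t.entry, ← Equiv.symm_symm u.entry]
  congr 1
  ext1 k
  exact Node.box_injective (congrFun h k)

theorem mem_comp_iff (t : lam.Std) (a : Box ℓ) :
    (a.2.1, a.2.2) ∈ lam.comp a.1 ↔ ∃ k, t.box k = a := by
  constructor
  · intro h
    exact ⟨t.entry (mkNode a h), by rw [box_entry, mkNode_box]⟩
  · rintro ⟨k, rfl⟩
    exact (t.entry.symm k).box_mem

theorem shape_eq_of_box_eq {t : lam.Std} {u : mu.Std} (h : t.box = u.box) : lam = mu := by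
  apply Multipartition.ext
  funext l
  apply YoungDiagram.ext
  ext ⟨a, b⟩
  rw [YoungDiagram.mem_cells, YoungDiagram.mem_cells]
  exact (t.mem_comp_iff (l, a, b)).trans ((u.mem_comp_iff (l, a, b)).trans (by rw [h])).symm

/-- The shapes are not assumed to agree: with `shape_eq_of_box_eq` their equality follows. This is
what separates the matrix blocks of different multipartitions. -/
theorem box_eq_of_residues_eq (he : e = 0 ∨ n < e) (hs : Separated e n κ) {t : lam.Std}
    {u : mu.Std} (h : t.residues e κ = u.residues e κ) : t.box = u.box :=
  funext fun j => (t.isGrowth n).eq_of_res_eq he hs (u.isGrowth n) (fun j _ => congrFun h j) j j.2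

end Std

/-- Every growth is given by a standard tableau. -/
theorem exists_std_of_isGrowth {x : Fin n → Box ℓ} (hx : IsGrowth n x) :
    ∃ (lam : Multipartition ℓ n) (t : lam.Std), t.box = x := by
  have hinj : Function.Injective x := by
    intro i j h
    rcases lt_trichotomy i j with hij | hij | hij
    · exact absurd h (hx.ne hij j.2)
    · exact hij
    · exact absurd h.symm (hx.ne hij i.2)
  let D : Fin ℓ → YoungDiagram := fun l =>
    { cells := ((Finset.univ.image x).filter (·.1 = l)).image Prod.snd
      isLowerSet := by
        rintro ⟨a, b⟩ ⟨c, d⟩ hle hmem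
        simp only [Finset.coe_image, Set.mem_image, Finset.coe_filter, Finset.mem_image,
          Finset.mem_univ, true_and, Set.mem_ofPred_eq] at hmem ⊢
        obtain ⟨_, ⟨⟨k, rfl⟩, rfl⟩, hk⟩ := hmem
        have hle : c ≤ a ∧ d ≤ b := hle
        obtain ⟨i, _, hi⟩ := hx.exists_le k.2 (a := ((x k).1, c, d))
          ⟨rfl, by rw [hk]; exact hle.1, by rw [hk]; exact hle.2⟩
        exact ⟨x i, ⟨⟨i, rfl⟩, by rw [hi]⟩, by rw [hi]⟩ }
  have hD : ∀ l p, p ∈ D l ↔ ∃ k, x k = (l, p) := by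
    intro l p
    change p ∈ (D l).cells ↔ _
    simp only [D, Finset.mem_image, Finset.mem_filter, Finset.mem_univ, true_and]
    constructor
    · rintro ⟨_, ⟨⟨k, rfl⟩, rfl⟩, rfl⟩
      exact ⟨k, rfl⟩
    · rintro ⟨k, hk⟩
      exact ⟨x k, ⟨⟨k, rfl⟩, by rw [hk]⟩, by rw [hk]⟩
  have hcard : ∑ l, (D l).card = n := by
    have h₁ : ∀ l, (D l).card = ((Finset.univ.image x).filter (·.1 = l)).card := by
      intro l
      refine Finset.card_image_of_injOn ?_
      intro a ha b hb hab
      simp only [Finset.coe_filter, Set.mem_ofPred_eq] at ha hb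
      exact Prod.ext (ha.2.trans hb.2.symm) hab
    simp only [h₁]
    rw [← Finset.card_eq_sum_card_fiberwise (f := Prod.fst) (fun _ _ => Finset.mem_univ _),
      Finset.card_image_of_injective _ hinj, Finset.card_univ, Fintype.card_fin]
  let lam : Multipartition ℓ n := ⟨D, hcard⟩
  have hmem : ∀ k, ((x k).2.1, (x k).2.2) ∈ lam.comp (x k).1 := fun k => (hD _ _).2 ⟨k, rfl⟩
  let f : Fin n → lam.Node := fun k => mkNode (x k) (hmem k)
  have hbox : ∀ k, (f k).box = x k := fun _ => rfl
  have hf : Function.Bijective f := by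
    constructor
    · intro i j h
      exact hinj (by rw [← hbox, ← hbox, h])
    · intro z
      obtain ⟨k, hk⟩ := (hD _ _).1 z.box_mem
      exact ⟨k, Node.box_injective hk⟩
  refine ⟨lam, Std.ofEntry (Equiv.ofBijective f hf).symm ?_, ?_⟩
  · intro w z hwz hne
    obtain ⟨i, rfl⟩ := hf.2 w
    obtain ⟨j, rfl⟩ := hf.2 z
    have h : ∀ k, (Equiv.ofBijective f hf).symm (f k) = k :=
      fun k => (Equiv.ofBijective f hf).symm_apply_apply k
    rw [h, h]
    obtain ⟨m, hm, h'⟩ := hx.exists_le j.2 hwz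
    rw [hinj h'] at hm
    exact lt_of_le_of_ne hm (by rintro rfl; exact hne rfl)
  · funext k
    rfl

namespace Std

/-- The tableau `u` is obtained from `t` by swapping two consecutive entries. -/
def IsSwap (r : Fin (n - 1)) (t u : lam.Std) : Prop := u.entry = t.entry.trans (simpleSwap r)

theorem IsSwap.symm {r : Fin (n - 1)} {t u : lam.Std} (h : IsSwap r t u) : IsSwap r u t := by
  rw [IsSwap, h, Equiv.trans_assoc, simpleSwap_trans_self, Equiv.trans_refl]

theorem IsSwap.unique {r : Fin (n - 1)} {t u v : lam.Std} (h : IsSwap r t u) (h' : IsSwap r t v) :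
    u = v := Std.ext (h.trans (Eq.symm h'))

theorem IsSwap.box_apply {r : Fin (n - 1)} {t u : lam.Std} (h : IsSwap r t u) (k : Fin n) :
    u.box k = t.box (simpleSwap r k) := by
  rw [box, h]
  rfl

theorem IsSwap.residues_eq {r : Fin (n - 1)} {t u : lam.Std} (h : IsSwap r t u) :
    u.residues e κ = t.residues e κ ∘ simpleSwap r := by
  funext k
  simp only [residues_apply, Function.comp, h.box_apply]

theorem IsSwap.perm_eq {r : Fin (n - 1)} {t u : lam.Std} (h : IsSwap r t u) :
    u.perm = t.perm.trans (simpleSwap r) := by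
  rw [perm, h]
  rfl

theorem exists_isSwap {t : lam.Std} {r : Fin (n - 1)} (h : ¬(t.box (lo r)).Below (t.box (hi r))) :
    ∃ u, IsSwap r t u := by
  refine ⟨Std.ofEntry (t.entry.trans (simpleSwap r)) ?_, rfl⟩
  intro x z hxz hne
  refine simpleSwap_lt_simpleSwap (t.entry_lt_of_below hxz hne) ?_
  rintro ⟨h₁, h₂⟩
  rw [← h₁, ← h₂, box_entry, box_entry] at h
  exact h hxz

/-- If the first of the two boxes were north-west of the second, the standard tableau `u` could not
have reversed their entries. -/
theorem exists_isSwap_of_lt {t u : lam.Std} {r : Fin (n - 1)} {σ : Equiv.Perm (Fin n)}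
    (hu : u.entry = t.entry.trans σ) (h : σ (hi r) < σ (lo r)) : ∃ v, IsSwap r t v := by
  apply exists_isSwap
  intro hb
  have := u.entry_lt_of_below hb (t.entry.symm.injective.ne (lo_ne_hi r))
  rw [hu] at this
  simp only [Equiv.trans_apply, Equiv.apply_symm_apply] at this
  exact this.not_gt h

theorem exists_isSwap_of_addable {t : lam.Std} {r : Fin (n - 1)}
    (h : Addable (shape t.box (lo r)) (t.box (hi r))) : ∃ u, IsSwap r t u := by
  apply exists_isSwap
  intro hb
  have hg := t.isGrowth n
  obtain ⟨m, hm, h'⟩ := mem_shape.1 (h.2 _ hb (hg.ne (lo_lt_hi r) (hi r).2))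
  exact hg.ne hm (lo r).2 h'

theorem IsSwap.shape_eq {r : Fin (n - 1)} {t u : lam.Std} (h : IsSwap r t u) :
    shape u.box (lo r) = shape t.box (lo r) := by
  refine shape_congr fun j hj => ?_
  rw [h.box_apply, simpleSwap_of_ne]
  · rintro rfl
    exact lt_irrefl _ hj
  · rintro rfl
    simp [lo, hi] at hj

theorem shape_lo_card_le (x : Fin n → Box ℓ) (r : Fin (n - 1)) :
    (shape x (lo r)).card + 2 ≤ n := by
  have h := shape_card_le x (lo r)
  have h' : ((lo r : Fin n) : ℕ) = r := rfl
  omega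

theorem IsSwap.addable {r : Fin (n - 1)} {t u : lam.Std} (h : IsSwap r t u) :
    Addable (shape t.box (lo r)) (t.box (hi r)) := by
  have := u.isGrowth n (lo r) (lo r).2
  rwa [h.shape_eq, h.box_apply, simpleSwap_lo] at this

/-- Both boxes can be added to the diagram of the entries preceding the swapped pair, which has at
most n - 2 boxes. -/
theorem IsSwap.far (he : e = 0 ∨ n < e) (hs : Separated e n κ) {r : Fin (n - 1)} {t u : lam.Std}
    (h : IsSwap r t u) : Far (t.residues e κ (lo r)) (t.residues e κ (hi r)) :=
  (t.isGrowth n (lo r) (lo r).2).far he hs h.addable (shape_lo_card_le _ _)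
    ((t.isGrowth n).ne (lo_lt_hi r) (hi r).2)

/-- Two consecutive entries which cannot be swapped are in adjacent boxes. -/
theorem box_hi_of_not_isSwap {t : lam.Std} {r : Fin (n - 1)} (h : ¬∃ u, IsSwap r t u) :
    t.box (hi r) = ((t.box (lo r)).1, (t.box (lo r)).2.1, (t.box (lo r)).2.2 + 1) ∨
      t.box (hi r) = ((t.box (lo r)).1, (t.box (lo r)).2.1 + 1, (t.box (lo r)).2.2) :=
  ((t.isGrowth n).addable_or (i := lo r) (j := hi r) rfl (hi r).2).resolve_left fun h' =>
    h (exists_isSwap_of_addable h')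

theorem _root_.CycKLR.Box.arrow_right (l : Fin ℓ) (r c : ℕ) :
    Arrow (Box.res e κ (l, r, c)) (Box.res e κ (l, r, c + 1)) := by
  simp only [Arrow, Box.res]
  push_cast
  ring

theorem _root_.CycKLR.Box.arrow_below (l : Fin ℓ) (r c : ℕ) :
    Arrow (Box.res e κ (l, r + 1, c)) (Box.res e κ (l, r, c)) := by
  simp only [Arrow, Box.res]
  push_cast
  ring

theorem arrow_of_not_isSwap {t : lam.Std} {r : Fin (n - 1)} (h : ¬∃ u, IsSwap r t u) :
    Arrow (t.residues e κ (lo r)) (t.residues e κ (hi r)) ∨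
      Arrow (t.residues e κ (hi r)) (t.residues e κ (lo r)) := by
  rw [residues_apply, residues_apply]
  rcases box_hi_of_not_isSwap h with h | h <;> rw [h]
  · exact Or.inl (Box.arrow_right _ _ _)
  · exact Or.inr (Box.arrow_below _ _ _)

theorem _root_.CycKLR.not_arrow_self (he : e = 0 ∨ n < e) (hn : 1 ≤ n) (i : ZMod e) :
    ¬Arrow i i := by
  intro h
  rw [Arrow] at h
  refine intCast_ne_zero he (x := 1) (by simp) (by simpa using hn) ?_
  push_cast
  linear_combination -h

/-- Entries that can be swapped have far residues. Otherwise the two boxes are adjacent, with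
residues differing by ±1, which is nonzero here. -/
theorem residues_lo_ne_hi (he : e = 0 ∨ n < e) (hs : Separated e n κ) (t : lam.Std)
    (r : Fin (n - 1)) : t.residues e κ (lo r) ≠ t.residues e κ (hi r) := by
  intro h
  by_cases hu : ∃ u, IsSwap r t u
  · obtain ⟨u, hu⟩ := hu
    exact (hu.far he hs).1 h
  · have hn : 1 ≤ n := by have := r.2; omega
    rcases arrow_of_not_isSwap (κ := κ) (e := e) hu with h' | h' <;> rw [h] at h' <;>
      exact not_arrow_self he hn _ h'

/-- If the residue sequences of two standard tableaux differ by a simple transposition, then so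
do the tableaux. -/
theorem exists_isSwap_of_residues_eq (he : e = 0 ∨ n < e) (hs : Separated e n κ) {t : lam.Std}
    {u : mu.Std} {r : Fin (n - 1)} (h : u.residues e κ = t.residues e κ ∘ simpleSwap r) :
    ∃ v, IsSwap r t v := by
  -- The tableaux agree before the swapped positions. So the boxes of `t` and of `u` at `lo r` are
  -- addable to the same diagram, and their residues are those of `t` at `lo r` and `hi r`.
  have hbox : ∀ j : Fin n, j.1 < (lo r).1 → t.box j = u.box j := by
    refine ((t.isGrowth n).mono (lo r).2.le).eq_of_res_eq he hs
      ((u.isGrowth n).mono (lo r).2.le) ?_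
    intro j hj
    rw [← residues_apply, ← residues_apply, h, Function.comp, simpleSwap_of_ne]
    · rintro rfl
      exact lt_irrefl _ hj
    · rintro rfl
      simp [lo, hi] at hj
  have h₁ := t.isGrowth n (lo r) (lo r).2
  have h₂ := u.isGrowth n (lo r) (lo r).2
  rw [← shape_congr hbox] at h₂
  have hres : (u.box (lo r)).res e κ = t.residues e κ (hi r) := by
    rw [← residues_apply, h, Function.comp, simpleSwap_lo]
  have hfar := h₁.far he hs h₂ (shape_lo_card_le _ _) (by
    intro h'
    refine residues_lo_ne_hi he hs t r ?_
    rw [← hres, ← h', residues_apply])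
  rw [hres, ← residues_apply] at hfar
  by_contra hne
  rcases arrow_of_not_isSwap (κ := κ) (e := e) hne with h' | h'
  · exact hfar.2.1 h'
  · exact hfar.2.2 h'

/-- The residues `(i, i ± 1, i)` do not occur consecutively in a standard tableau. -/
theorem far_of_residues_eq (he : e = 0 ∨ n < e) (hs : Separated e n κ) (t : lam.Std)
    {r r' : Fin (n - 1)} (hr : r'.1 = r.1 + 1)
    (h : t.residues e κ (hi r') = t.residues e κ (lo r)) :
    Far (t.residues e κ (lo r)) (t.residues e κ (hi r)) := by
  by_cases h₁ : ∃ u, IsSwap r t u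
  · obtain ⟨u, hu⟩ := h₁
    exact hu.far he hs
  exfalso
  have hmid : lo r' = hi r := by simp [lo, hi, hr]
  have harr := arrow_of_not_isSwap (κ := κ) (e := e) h₁
  by_cases h₂ : ∃ u, IsSwap r' t u
  · obtain ⟨u, hu⟩ := h₂
    have := hu.far he hs
    rw [h, hmid] at this
    exact harr.elim this.2.2 this.2.1
  have hne : (t.residues e κ (hi r')) - t.residues e κ (lo r) = 0 := by rw [h, sub_self]
  have hmiss : ∀ a : Box ℓ, (t.box (lo r)).Below a → a.Below (t.box (hi r')) →
      a = t.box (lo r) ∨ a = t.box (hi r) ∨ a = t.box (hi r') := by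
    intro a h₁ h₂
    have hg := t.isGrowth n
    obtain ⟨m, hm, rfl⟩ := hg.exists_le (hi r').2 h₂
    obtain ⟨m', hm', h'⟩ := hg.exists_le m.2 h₁
    have : lo r ≤ m := by
      by_contra hlt
      exact hg.ne (lt_of_le_of_lt hm' (not_le.1 hlt)) (lo r).2 h'
    rw [Fin.le_def] at this hm
    simp only [lo, hi] at this hm
    rcases (by omega : m.1 = r ∨ m.1 = r + 1 ∨ m.1 = r' + 1) with h | h | h
    · exact Or.inl (congrArg _ (Fin.ext h))
    · exact Or.inr (Or.inl (congrArg _ (Fin.ext h)))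
    · exact Or.inr (Or.inr (congrArg _ (Fin.ext h)))
  have hb₁ := box_hi_of_not_isSwap h₁
  have hb₂ := box_hi_of_not_isSwap h₂
  rw [hmid] at hb₂
  rw [residues_apply, residues_apply] at hne
  have hn : 2 ≤ n := by have := r.2; omega
  generalize t.box (lo r) = a at *
  generalize t.box (hi r) = b at *
  generalize t.box (hi r') = c at *
  obtain ⟨l, p, q⟩ := a
  have hsq : ∀ b', (Box.Below (l, p, q) b' ∧ Box.Below b' c) → b' = (l, p, q) ∨ b' = b ∨ b' = c :=
    fun b' h => hmiss b' h.1 h.2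
  -- Two steps in the same direction change the residue by ±2, which is nonzero since `e` is 0 or
  -- exceeds n ≥ 2. A turn would leave out the fourth box of a 2 × 2 square, against `hmiss`.
  rcases hb₁ with rfl | rfl <;> rcases hb₂ with rfl | rfl
  · refine intCast_ne_zero he (x := 2) (by simp) (by simpa using hn) ?_
    rw [← hne]
    simp only [Box.res]
    push_cast
    ring
  · have := hsq (l, p + 1, q) ⟨⟨rfl, by simp, by simp⟩, ⟨rfl, by simp, by simp⟩⟩
    simp at this
  · have := hsq (l, p, q + 1) ⟨⟨rfl, by simp, by simp⟩, ⟨rfl, by simp, by simp⟩⟩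
    simp at this
  · refine intCast_ne_zero he (x := -2) (by simp) (by simpa using hn) ?_
    rw [← hne]
    simp only [Box.res]
    push_cast
    ring

/-! ### Induction on standard tableaux -/

theorem initial_strictMono (lam : Multipartition ℓ n) : StrictMono lam.initial.entry :=
  (Fintype.orderIsoFinOfCardEq lam.Node lam.card_node).symm.strictMono

theorem initial_perm (lam : Multipartition ℓ n) : lam.initial.perm = Equiv.refl _ :=
  Equiv.symm_trans_self _

theorem exists_descent_of_ne_initial {t : lam.Std} (h : t ≠ lam.initial) :
    ∃ r : Fin (n - 1), t.entry.symm (hi r) < t.entry.symm (lo r) := by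
  by_contra! hcon
  apply h
  have hm : StrictMono t.entry.symm := strictMono_of_lo_lt_hi fun r =>
    lt_of_le_of_ne (hcon r) (t.entry.symm.injective.ne (lo_ne_hi r))
  have : hm.orderIsoOfSurjective _ t.entry.symm.surjective =
      Fintype.orderIsoFinOfCardEq lam.Node lam.card_node := Subsingleton.elim _ _
  apply ext_box
  funext k
  exact congrArg Node.box (DFunLike.congr_fun this k)

theorem perm_symm_apply (t : lam.Std) (k : Fin n) :
    t.perm.symm k = lam.initial.entry (t.entry.symm k) := rfl

/-- Every standard tableau is obtained from the initial one by swaps which increase the length. -/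
theorem induction_swap {P : lam.Std → Prop} (h₀ : P lam.initial)
    (hP : ∀ (t u : lam.Std) (r : Fin (n - 1)), IsSwap r t u →
      t.perm.symm (lo r) < t.perm.symm (hi r) → P t → P u) (t : lam.Std) : P t := by
  induction hk : inv t.perm using Nat.strong_induction_on generalizing t with
  | _ k ih =>
  by_cases ht : t = lam.initial
  · rwa [ht]
  obtain ⟨r, hr⟩ := exists_descent_of_ne_initial ht
  obtain ⟨u, hu⟩ : ∃ u, IsSwap r t u := by
    apply exists_isSwap
    intro hb
    exact hr.not_gt (Node.lt_of_below hb (t.entry.symm.injective.ne (lo_ne_hi r)))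
  have hlt : t.perm.symm (hi r) < t.perm.symm (lo r) := initial_strictMono lam hr
  have hsymm : u.perm.symm = (simpleSwap r).trans t.perm.symm := by
    rw [hu.perm_eq, Equiv.symm_trans, simpleSwap_symm]
  have hinv := inv_swap_of_gt hlt
  rw [← hsymm, inv_symm, inv_symm] at hinv
  refine hP u t r hu.symm ?_ (ih _ (by omega) u rfl)
  rw [hsymm]
  simpa using hlt

end Std
end Multipartition
end CycKLR

namespace CycKLR

/-! ### Extending a growth by a box of prescribed residue -/

section Extension

variable {ℓ n e : ℕ} {κ : Fin ℓ → ℤ}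

theorem IsGrowth.update {x : Fin n → Box ℓ} {k : Fin n} (hx : IsGrowth k x) {b : Box ℓ}
    (hb : Addable (shape x k) b) : IsGrowth (k + 1) (Function.update x k b) := by
  have hne : ∀ j : Fin n, j.1 < k → x j = Function.update x k b j := fun j hj =>
    (Function.update_of_ne (Fin.ne_of_lt hj) b x).symm
  intro j hj
  rcases Nat.lt_succ_iff_lt_or_eq.1 hj with h | h
  · exact hx.congr hne j h
  · obtain rfl := Fin.ext h
    rw [Function.update_self, ← shape_congr hne]
    exact hb

theorem shape_succ_of_lt (x : Fin n → Box ℓ) (k : Fin n) {a : Box ℓ} :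
    a ∈ shape x (k + 1) ↔ a ∈ shape x k ∨ a = x k := by
  rw [mem_shape, mem_shape]
  constructor
  · rintro ⟨j, hj, rfl⟩
    rcases Nat.lt_succ_iff_lt_or_eq.1 hj with h | h
    · exact Or.inl ⟨j, h, rfl⟩
    · exact Or.inr (by rw [Fin.ext h])
  · rintro (⟨j, hj, rfl⟩ | rfl)
    · exact ⟨j, by omega, rfl⟩
    · exact ⟨k, by omega, rfl⟩

theorem IsGrowth.mem_of_below {x : Fin n → Box ℓ} {k : ℕ} (hx : IsGrowth k x) {a b : Box ℓ}
    (hb : b ∈ shape x k) (h : a.Below b) : a ∈ shape x k := by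
  obtain ⟨j, hj, rfl⟩ := mem_shape.1 hb
  obtain ⟨i, hi, rfl⟩ := hx.exists_le hj h
  exact mem_shape.2 ⟨i, lt_of_le_of_lt hi hj, rfl⟩

/-- Suppose that `x m` is the last box, and that the box `x c` would be removable without it. Then
the residues of the boxes added in between are far from that of `x c`. -/
theorem IsGrowth.far_of_removable (he : e = 0 ∨ n < e) (hs : Separated e n κ)
    {x : Fin n → Box ℓ} {m : Fin n} (hx : IsGrowth (m + 1) x) {c : Fin n}
    (h : ∀ b ∈ shape x (m + 1), (x c).Below b → b = x c ∨ (x m).Below b) {j : Fin n} (hcj : c < j)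
    (hjm : j < m) : Far ((x c).res e κ) ((x j).res e κ) := by
  have hj : j.1 < m + 1 := by omega
  have hc : x c ∈ shape x j := mem_shape.2 ⟨c, hcj, rfl⟩
  -- Once `x c` is deleted from the diagram preceding step `j`, both `x c` and `x j` are addable to
  -- it.
  refine Addable.far he hs (S := (shape x j).erase (x c)) ⟨by simp, fun b hb hne => ?_⟩
    ⟨fun h => (hx j hj).1 (Finset.mem_of_mem_erase h), fun b hb hne => ?_⟩ ?_ (hx.ne hcj hj)
  · exact Finset.mem_erase.2 ⟨hne, (hx.mono hj.le).mem_of_below hc hb⟩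
  · refine Finset.mem_erase.2 ⟨?_, (hx j hj).2 b hb hne⟩
    rintro rfl
    rcases h (x j) (mem_shape.2 ⟨j, hj, rfl⟩) hb with h' | h'
    · exact hne h'.symm
    · obtain ⟨i, hi, h'⟩ := hx.exists_le hj h'
      exact hx.ne (lt_of_le_of_lt hi hjm) (Nat.lt_succ_self _) h'
  · have h₁ := Finset.card_erase_add_one hc
    have h₂ := shape_card_le x j
    omega

theorem IsGrowth.not_mem_of_below {x : Fin n → Box ℓ} {m : Fin n} (hx : IsGrowth (m + 1) x)
    {b : Box ℓ} (hb : (x m).Below b) (hne : b ≠ x m) : b ∉ shape x (m + 1) := by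
  intro h
  obtain ⟨j, hj, rfl⟩ := mem_shape.1 h
  obtain ⟨i, hi, h'⟩ := hx.exists_le hj hb
  have : i = m := by
    by_contra hne'
    exact hx.ne (lt_of_le_of_ne (hi.trans (Nat.lt_succ_iff.1 hj)) hne') (Nat.lt_succ_self _) h'
  subst this
  exact hne (congrArg x (le_antisymm (Nat.lt_succ_iff.1 hj) hi))

/-- The box to the right of `x m` has residue `a`, and is blocked only if the box above it is
missing. In that case the box directly above `x m`, which also has residue `a`, has no right
neighbour and would be removable without `x m`, so `far_of_removable` applies. -/
theorem IsGrowth.addable_right_or (he : e = 0 ∨ n < e) (hs : Separated e n κ)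
    {x : Fin n → Box ℓ} {m : Fin n} (hx : IsGrowth (m + 1) x) {a : ZMod e}
    (ha : Arrow ((x m).res e κ) a) :
    (∃ b, Addable (shape x (m + 1)) b ∧ b.res e κ = a) ∨
      ∃ c < m, (x c).res e κ = a ∧ ∀ j, c < j → j < m → Far ((x c).res e κ) ((x j).res e κ) := by
  have hmem : x m ∈ shape x (m + 1) := mem_shape.2 ⟨m, Nat.lt_succ_self _, rfl⟩
  have hfar := fun c => hx.far_of_removable he hs (c := c)
  have hnot := fun b => hx.not_mem_of_below (b := b)
  obtain ⟨⟨l, p, q⟩, hA⟩ : ∃ a, x m = a := ⟨_, rfl⟩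
  rw [hA] at ha hmem hnot hfar
  have hres := Box.arrow_right (e := e) (κ := κ) l p q
  by_cases hp : p = 0 ∨ ((l, p - 1, q + 1) : Box ℓ) ∈ shape x (m + 1)
  · refine Or.inl ⟨(l, p, q + 1), ⟨hnot _ ⟨rfl, le_rfl, Nat.le_succ _⟩ (by simp), ?_⟩,
      hres.trans ha.symm⟩
    rintro ⟨l', p', q'⟩ ⟨rfl, hp', hq'⟩ hne
    simp only [ne_eq, Prod.mk.injEq, true_and] at hp' hq' hne
    by_cases hq : q' ≤ q
    · exact hx.mem_of_below hmem ⟨rfl, hp', hq⟩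
    · rcases hp with rfl | hp
      · omega
      · exact hx.mem_of_below hp ⟨rfl, show p' ≤ p - 1 by omega, hq'⟩
  · rw [not_or] at hp
    obtain ⟨hp₀, hp⟩ := hp
    have hC : Box.Below (l, p - 1, q) (x m) := by rw [hA]; exact ⟨rfl, Nat.sub_le _ _, le_rfl⟩
    obtain ⟨c, hc, hxc⟩ := hx.exists_le (Nat.lt_succ_self _) hC
    have hcm : c < m := by
      refine lt_of_le_of_ne hc ?_
      rintro rfl
      rw [hA] at hxc
      simp only [Prod.mk.injEq, true_and, and_true] at hxc
      omega
    refine Or.inr ⟨c, hcm, ?_, fun j => hfar c fun b hb hcb => ?_⟩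
    · rw [hxc]
      rw [Arrow] at ha
      rw [ha]
      simp only [Box.res]
      rw [Nat.cast_sub (by omega)]
      push_cast
      ring
    · rw [hxc] at hcb ⊢
      obtain ⟨l', p', q'⟩ := b
      obtain ⟨rfl, h₁, h₂⟩ := hcb
      simp only at h₁ h₂
      by_cases hq : q' = q
      · subst hq
        rcases Nat.eq_or_lt_of_le h₁ with h | h
        · exact Or.inl (by rw [h])
        · exact Or.inr ⟨rfl, show p ≤ p' by omega, le_rfl⟩
      · exact (hp (hx.mem_of_below hb ⟨rfl, h₁, show q + 1 ≤ q' by omega⟩)).elim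

/-- The transposed situation: the new box is below `x m`, and the competing box of the same residue
is to its left. -/
theorem IsGrowth.addable_below_or (he : e = 0 ∨ n < e) (hs : Separated e n κ)
    {x : Fin n → Box ℓ} {m : Fin n} (hx : IsGrowth (m + 1) x) {a : ZMod e}
    (ha : Arrow a ((x m).res e κ)) :
    (∃ b, Addable (shape x (m + 1)) b ∧ b.res e κ = a) ∨
      ∃ c < m, (x c).res e κ = a ∧ ∀ j, c < j → j < m → Far ((x c).res e κ) ((x j).res e κ) := by
  have hmem : x m ∈ shape x (m + 1) := mem_shape.2 ⟨m, Nat.lt_succ_self _, rfl⟩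
  have hfar := fun c => hx.far_of_removable he hs (c := c)
  have hnot := fun b => hx.not_mem_of_below (b := b)
  obtain ⟨⟨l, p, q⟩, hA⟩ : ∃ a, x m = a := ⟨_, rfl⟩
  rw [hA] at ha hmem hnot hfar
  have hres := Box.arrow_below (e := e) (κ := κ) l p q
  by_cases hq : q = 0 ∨ ((l, p + 1, q - 1) : Box ℓ) ∈ shape x (m + 1)
  · refine Or.inl ⟨(l, p + 1, q), ⟨hnot _ ⟨rfl, Nat.le_succ _, le_rfl⟩ (by simp), ?_⟩,
      add_right_cancel (Eq.trans (Eq.symm hres) ha)⟩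
    rintro ⟨l', p', q'⟩ ⟨rfl, hp', hq'⟩ hne
    simp only [ne_eq, Prod.mk.injEq, true_and] at hp' hq' hne
    by_cases hp : p' ≤ p
    · exact hx.mem_of_below hmem ⟨rfl, hp, hq'⟩
    · rcases hq with rfl | hq
      · omega
      · exact hx.mem_of_below hq ⟨rfl, hp', show q' ≤ q - 1 by omega⟩
  · rw [not_or] at hq
    obtain ⟨hq₀, hq⟩ := hq
    have hC : Box.Below (l, p, q - 1) (x m) := by rw [hA]; exact ⟨rfl, le_rfl, Nat.sub_le _ _⟩
    obtain ⟨c, hc, hxc⟩ := hx.exists_le (Nat.lt_succ_self _) hC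
    have hcm : c < m := by
      refine lt_of_le_of_ne hc ?_
      rintro rfl
      rw [hA] at hxc
      simp only [Prod.mk.injEq, true_and] at hxc
      omega
    refine Or.inr ⟨c, hcm, ?_, fun j => hfar c fun b hb hcb => ?_⟩
    · rw [hxc]
      rw [Arrow] at ha
      rw [← add_left_inj (1 : ZMod e), ← ha]
      simp only [Box.res]
      rw [Nat.cast_sub (by omega)]
      push_cast
      ring
    · rw [hxc] at hcb ⊢
      obtain ⟨l', p', q'⟩ := b
      obtain ⟨rfl, h₁, h₂⟩ := hcb
      simp only at h₁ h₂
      by_cases hp : p' = p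
      · subst hp
        rcases Nat.eq_or_lt_of_le h₂ with h | h
        · exact Or.inl (by rw [h])
        · exact Or.inr ⟨rfl, le_rfl, show q ≤ q' by omega⟩
      · exact (hq (hx.mem_of_below hb ⟨rfl, show p + 1 ≤ p' by omega, h₂⟩)).elim

end Extension

/-- Elements of a ring which satisfy the cyclotomic quiver Hecke relations. -/
structure SatisfiesKLR {A : Type*} [Ring A] {e n : ℕ} (Λ : PosWeight e) (ψ : Fin (n - 1) → A)
    (y : Fin n → A) (ε : (Fin n → ZMod e) → A) : Prop where
  ext : ∀ a b : A, (∀ i, a * ε i = b * ε i) → a = b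
  idem_mul_self : ∀ i, ε i * ε i = ε i
  idem_mul_ne : ∀ i j, i ≠ j → ε i * ε j = 0
  y_idem : ∀ r i, y r * ε i = ε i * y r
  psi_idem : ∀ r i, ψ r * ε i = ε (i ∘ simpleSwap r) * ψ r
  psi_psi : ∀ r s : Fin (n - 1), r.1 + 1 < s.1 → ψ r * ψ s = ψ s * ψ r
  psi_y_hi_of_eq : ∀ r i, i (lo r) = i (hi r) →
    ψ r * y (hi r) * ε i = (y (lo r) * ψ r + 1) * ε i
  y_hi_psi_of_eq : ∀ r i, i (lo r) = i (hi r) →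
    y (hi r) * ψ r * ε i = (ψ r * y (lo r) + 1) * ε i
  y_hi_psi_of_ne : ∀ r i, i (lo r) ≠ i (hi r) →
    y (hi r) * ψ r * ε i = ψ r * y (lo r) * ε i
  quadratic_of_eq : ∀ r i, i (lo r) = i (hi r) → ψ r * ψ r * ε i = 0
  quadratic_of_far : ∀ r i, Far (i (lo r)) (i (hi r)) → ψ r * ψ r * ε i = ε i
  quadratic_of_arrow : ∀ r i, i (lo r) ≠ i (hi r) → Arrow (i (lo r)) (i (hi r)) →
    ¬Arrow (i (hi r)) (i (lo r)) → ψ r * ψ r * ε i = (y (lo r) - y (hi r)) * ε i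
  quadratic_of_arrow' : ∀ r i, i (lo r) ≠ i (hi r) → Arrow (i (hi r)) (i (lo r)) →
    ¬Arrow (i (lo r)) (i (hi r)) → ψ r * ψ r * ε i = (y (hi r) - y (lo r)) * ε i
  braid_of_arrow : ∀ r r' : Fin (n - 1), r'.1 = r.1 + 1 → ∀ i, i (hi r') = i (lo r) →
    Arrow (i (lo r)) (i (hi r)) → ¬Arrow (i (hi r)) (i (lo r)) →
    (ψ r * ψ r' * ψ r - ψ r' * ψ r * ψ r') * ε i = -ε i
  braid_of_arrow' : ∀ r r' : Fin (n - 1), r'.1 = r.1 + 1 → ∀ i, i (hi r') = i (lo r) →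
    Arrow (i (hi r)) (i (lo r)) → ¬Arrow (i (lo r)) (i (hi r)) →
    (ψ r * ψ r' * ψ r - ψ r' * ψ r * ψ r') * ε i = ε i
  braid_of_far : ∀ r r' : Fin (n - 1), r'.1 = r.1 + 1 → ∀ i,
    (i (hi r') = i (lo r) → Far (i (lo r)) (i (hi r))) →
    (ψ r * ψ r' * ψ r - ψ r' * ψ r * ψ r') * ε i = 0
  cyclotomic : ∀ (h : 0 < n) i, y ⟨0, h⟩ ^ Λ (i ⟨0, h⟩) * ε i = 0

/-- Edges in both directions would give 2 = 0 in `ZMod e`. This removes the double-edge cases of the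
relations. -/
theorem Arrow.not_symm {e n : ℕ} (he : e = 0 ∨ n < e) (hn : 2 ≤ n) {i j : ZMod e}
    (h : Arrow i j) : ¬Arrow j i := by
  intro h'
  rw [Arrow] at h h'
  refine intCast_ne_zero he (x := 2) (by simp) (by simpa using hn) ?_
  push_cast
  rw [h] at h'
  linear_combination -h'

/-! ### Consequences of the relations: surviving idempotents and vanishing of y -/

namespace SatisfiesKLR

variable {A : Type*} [Ring A] {e n ℓ : ℕ} {κ : Fin ℓ → ℤ} {Λ : PosWeight e}
  {ψ : Fin (n - 1) → A} {y : Fin n → A} {ε : (Fin n → ZMod e) → A}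

theorem comp_swap_swap (i : Fin n → ZMod e) (r : Fin (n - 1)) :
    (i ∘ simpleSwap r) ∘ simpleSwap r = i := by
  funext k
  simp

theorem psi_psi_idem (H : SatisfiesKLR Λ ψ y ε) (r : Fin (n - 1)) (i : Fin n → ZMod e) :
    ψ r * ψ r * ε i = ψ r * ε (i ∘ simpleSwap r) * ψ r := by
  rw [mul_assoc, H.psi_idem, mul_assoc]

/-- Since y_r kills every idempotent, the two relations with δ = 1 become ψ y e(i) = e(i) and y ψ
e(i) = e(i), where y is y_{r+1}. Substituting one into the other gives e(i) = y ψ² e(i) y, and ψ²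
e(i) = 0. -/
theorem idem_eq_zero_of_eq (H : SatisfiesKLR Λ ψ y ε) {r : Fin (n - 1)} {i : Fin n → ZMod e}
    (hy : ∀ j, y (lo r) * ε j = 0) (h : i (lo r) = i (hi r)) : ε i = 0 := by
  have h₁ : ψ r * y (hi r) * ε i = ε i := by
    rw [H.psi_y_hi_of_eq r i h, add_mul, one_mul, mul_assoc, H.psi_idem, ← mul_assoc, hy,
      zero_mul, zero_add]
  have h₂ : y (hi r) * ψ r * ε i = ε i := by
    rw [H.y_hi_psi_of_eq r i h, add_mul, one_mul, mul_assoc, hy, mul_zero, zero_add]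
  calc ε i = y (hi r) * ψ r * ε i := h₂.symm
    _ = y (hi r) * ψ r * (ψ r * y (hi r) * ε i) := by rw [h₁]
    _ = y (hi r) * (ψ r * ψ r * ε i) * y (hi r) := by
      simp only [mul_assoc]
      rw [H.y_idem]
    _ = 0 := by rw [H.quadratic_of_eq r i h, mul_zero, zero_mul]

theorem idem_swap_ne_zero (H : SatisfiesKLR Λ ψ y ε) {r : Fin (n - 1)} {i : Fin n → ZMod e}
    (h : Far (i (lo r)) (i (hi r))) (hi : ε i ≠ 0) : ε (i ∘ simpleSwap r) ≠ 0 := by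
  intro h'
  apply hi
  rw [← H.quadratic_of_far r i h, H.psi_psi_idem, h', mul_zero, zero_mul]

/-- Writing e(i) = ψ_r e(s_r·i) ψ_r, the element y_{r+1} passes the first factor ψ_r and becomes
y_r, which kills the idempotent in the middle. -/
theorem y_hi_idem_of_far (H : SatisfiesKLR Λ ψ y ε) {r : Fin (n - 1)} {i : Fin n → ZMod e}
    (hy : ∀ j, y (lo r) * ε j = 0) (h : Far (i (lo r)) (i (hi r))) : y (hi r) * ε i = 0 := by
  rw [← H.quadratic_of_far r i h, H.psi_psi_idem, ← mul_assoc, ← mul_assoc,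
    H.y_hi_psi_of_ne, mul_assoc (ψ r), hy, mul_zero, zero_mul]
  simpa using h.1.symm

/-- If e(s_r·i) = 0 then ψ_r² e(i) = 0, while the quadratic relation equates it with ±(y_r -
y_{r+1}) e(i), where y_r contributes nothing. -/
theorem y_hi_idem_of_arrow (H : SatisfiesKLR Λ ψ y ε) (he : e = 0 ∨ n < e) {r : Fin (n - 1)}
    {i : Fin n → ZMod e} (hy : ∀ j, y (lo r) * ε j = 0) (hne : i (lo r) ≠ i (hi r))
    (h : Arrow (i (lo r)) (i (hi r)) ∨ Arrow (i (hi r)) (i (lo r)))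
    (h₀ : ε (i ∘ simpleSwap r) = 0) : y (hi r) * ε i = 0 := by
  have hn : 2 ≤ n := by have := r.2; omega
  have h₁ := H.psi_psi_idem r i
  rw [h₀, mul_zero, zero_mul] at h₁
  rcases h with h | h
  · rw [H.quadratic_of_arrow r i hne h (h.not_symm he hn), sub_mul, hy, zero_sub,
      neg_eq_zero] at h₁
    exact h₁
  · rw [H.quadratic_of_arrow' r i hne h (h.not_symm he hn), sub_mul, hy, sub_zero] at h₁
    exact h₁

/-- Swapping either neighbouring pair in (a, a ± 1, a) produces two equal neighbours, so both
swapped idempotents vanish. Both braid words then kill e(i), but the braid relation says that they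
differ by ±e(i). -/
theorem idem_eq_zero_of_arrow (H : SatisfiesKLR Λ ψ y ε) (he : e = 0 ∨ n < e)
    {r r' : Fin (n - 1)} (hr : r'.1 = r.1 + 1) {i : Fin n → ZMod e}
    (hy : ∀ j, y (lo r) * ε j = 0) (hy' : ∀ j, y (hi r) * ε j = 0) (h : i (hi r') = i (lo r))
    (harr : Arrow (i (lo r)) (i (hi r)) ∨ Arrow (i (hi r)) (i (lo r))) : ε i = 0 := by
  have hn : 2 ≤ n := by have := r.2; omega
  have e₀ : lo r' = hi r := by simp [lo, hi, hr]
  have e₁ : simpleSwap r (hi r') = hi r' := simpleSwap_of_ne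
    (by simp [lo, hi, Fin.ext_iff]; omega) (by simp [hi, Fin.ext_iff]; omega)
  have e₂ : simpleSwap r' (lo r) = lo r := simpleSwap_of_ne
    (by simp [lo, Fin.ext_iff]; omega) (by simp [lo, hi, Fin.ext_iff]; omega)
  have e₃ : simpleSwap r' (hi r) = hi r' := by rw [← e₀, simpleSwap_lo]
  have h₁ : ε (i ∘ simpleSwap r) = 0 :=
    H.idem_eq_zero_of_eq (r := r') (by rwa [e₀]) (by simp [e₀, e₁, h])
  have h₂ : ε (i ∘ simpleSwap r') = 0 :=
    H.idem_eq_zero_of_eq (r := r) hy (by simp [e₂, e₃, h])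
  have h₃ : (ψ r * ψ r' * ψ r - ψ r' * ψ r * ψ r') * ε i = 0 := by
    rw [sub_mul, mul_assoc _ (ψ r) (ε i), H.psi_idem, h₁, mul_assoc _ (ψ r') (ε i), H.psi_idem, h₂]
    simp
  rcases harr with harr | harr
  · rwa [H.braid_of_arrow r r' hr i h harr (harr.not_symm he hn), neg_eq_zero] at h₃
  · rwa [H.braid_of_arrow' r r' hr i h harr (harr.not_symm he hn)] at h₃

/-- A letter may be moved to the right past letters which are far from it. -/
theorem exists_idem_ne_zero (H : SatisfiesKLR Λ ψ y ε) (d : ℕ) {c m : Fin n}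
    (hd : c.1 + d = m) {i : Fin n → ZMod e} (hi₀ : ε i ≠ 0)
    (h : ∀ j, c < j → j ≤ m → Far (i c) (i j)) :
    ∃ i' : Fin n → ZMod e, ε i' ≠ 0 ∧ i' m = i c ∧ ∀ j, m < j → i' j = i j := by
  induction d generalizing c i with
  | zero =>
    obtain rfl : c = m := Fin.ext (by simpa using hd)
    exact ⟨i, hi₀, rfl, fun _ _ => rfl⟩
  | succ d ih =>
    let r : Fin (n - 1) := ⟨c, by omega⟩
    have hlo : lo r = c := rfl
    have hcr : c < hi r := by simp [hi, r, Fin.lt_def]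
    have hrm : hi r ≤ m := by simp [hi, r, Fin.le_def]; omega
    have hsw : ∀ j, hi r < j → (i ∘ simpleSwap r) j = i j := by
      intro j hj
      rw [Function.comp, simpleSwap_of_ne (hlo ▸ (hcr.trans hj).ne') hj.ne']
    have hsw' : (i ∘ simpleSwap r) (hi r) = i c := by simp [hlo]
    obtain ⟨i', h₁, h₂, h₃⟩ := ih (c := hi r) (by simp [hi, r]; omega)
      (H.idem_swap_ne_zero (r := r) (h _ hcr hrm) hi₀) (by
        intro j hj hjm
        rw [hsw', hsw j hj]
        exact h j (hcr.trans hj) hjm)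
    exact ⟨i', h₁, h₂.trans hsw', fun j hj => (h₃ j hj).trans (hsw j (lt_of_le_of_lt hrm hj))⟩

theorem exists_growth_one (H : SatisfiesKLR Λ ψ y ε) (hΛ : Λ = weightOf e κ) (hn : 0 < n)
    {i : Fin n → ZMod e} (hi : ε i ≠ 0) :
    ∃ x : Fin n → Box ℓ, IsGrowth 1 x ∧ ∀ j : Fin n, j.1 < 1 → (x j).res e κ = i j := by
  have h₀ : Λ (i ⟨0, hn⟩) ≠ 0 := by
    intro h
    have := H.cyclotomic hn i
    rw [h, pow_zero, one_mul] at this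
    exact hi this
  rw [hΛ, weightOf_apply] at h₀
  obtain ⟨l, _, hl⟩ := Finset.exists_ne_zero_of_sum_ne_zero h₀
  have hl : ((κ l : ℤ) : ZMod e) = i ⟨0, hn⟩ := by
    by_contra hne
    exact hl (if_neg hne)
  -- A growth of length 1 only looks at the first box, so a constant sequence serves.
  refine ⟨fun _ => (l, 0, 0), fun j hj => ⟨?_, ?_⟩, fun j hj => ?_⟩
  · rw [mem_shape]
    rintro ⟨k, hk, _⟩
    omega
  · rintro ⟨l', p, q⟩ ⟨rfl, hp, hq⟩ hne
    simp only [Nat.le_zero] at hp hq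
    subst hp hq
    exact absurd rfl hne
  · have : j = ⟨0, hn⟩ := Fin.ext (by simpa using hj)
    rw [this, ← hl]
    simp [Box.res]

/-- By induction, the first `k` letters of `i` are the residues of a growth if `ε i ≠ 0`, and
`y₁ = ⋯ = y_k = 0`. -/
theorem growth_and_y (H : SatisfiesKLR Λ ψ y ε) (he : e = 0 ∨ n < e) (hs : Separated e n κ)
    (hΛ : Λ = weightOf e κ) (hΛ₁ : ∀ i, Λ i ≤ 1) {k : ℕ} (hk : 1 ≤ k) (hkn : k ≤ n) :
    (∀ i, ε i ≠ 0 →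
      ∃ x : Fin n → Box ℓ, IsGrowth k x ∧ ∀ j : Fin n, j.1 < k → (x j).res e κ = i j) ∧
    ∀ j : Fin n, j.1 < k → ∀ i, y j * ε i = 0 := by
  induction k, hk using Nat.le_induction with
  | base =>
    refine ⟨fun i hi => H.exists_growth_one hΛ hkn hi, fun j hj i => ?_⟩
    have hj : j = ⟨0, hkn⟩ := Fin.ext (by simpa using hj)
    subst hj
    have h := H.cyclotomic hkn i
    -- The exponent in the cyclotomic relation is 0 or 1: either the idempotent vanishes or y_1
    -- itself kills it.
    rcases Nat.le_one_iff_eq_zero_or_eq_one.1 (hΛ₁ (i ⟨0, hkn⟩)) with h' | h'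
    · rw [h', pow_zero, one_mul] at h
      rw [h, mul_zero]
    · rwa [h', pow_one] at h
  | succ k hk ih =>
    obtain ⟨m, rfl⟩ := Nat.exists_eq_add_of_le' hk
    obtain ⟨hg, hy⟩ := ih (by omega)
    let r : Fin (n - 1) := ⟨m, by omega⟩
    have hlo : (lo r).1 = m := rfl
    have hhi : (hi r).1 = m + 1 := rfl
    have hylo : ∀ i, y (lo r) * ε i = 0 := hy (lo r) (Nat.lt_succ_self m)
    -- a growth for the swapped sequence adds the box of residue `i (hi r)` one step earlier
    have hswap : ∀ (i : Fin n → ZMod e) (x : Fin n → Box ℓ), IsGrowth (m + 1) x →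
        (∀ j : Fin n, j.1 < m + 1 → (x j).res e κ = i j) → ε (i ∘ simpleSwap r) ≠ 0 →
        ∃ b, Addable (shape x m) b ∧ b.res e κ = i (hi r) := by
      intro i x hx hxi hsi
      obtain ⟨x', hx', hxi'⟩ := hg _ hsi
      refine ⟨x' (lo r), ?_, by rw [hxi' (lo r) (Nat.lt_succ_self m)]; simp⟩
      rw [shape_congr (y := x')]
      · exact hx' (lo r) (Nat.lt_succ_self m)
      · refine (hx.mono (Nat.le_succ m)).eq_of_res_eq he hs (hx'.mono (Nat.le_succ m)) ?_
        intro j hj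
        rw [hxi j (by omega), hxi' j (by omega), Function.comp, simpleSwap_of_ne]
        · rintro rfl
          omega
        · rintro rfl
          omega
    have hextend : ∀ (i : Fin n → ZMod e) (x : Fin n → Box ℓ) (b : Box ℓ), IsGrowth (m + 1) x →
        (∀ j : Fin n, j.1 < m + 1 → (x j).res e κ = i j) → Addable (shape x (m + 1)) b →
        b.res e κ = i (hi r) → ∃ x : Fin n → Box ℓ, IsGrowth (m + 1 + 1) x ∧
          ∀ j : Fin n, j.1 < m + 1 + 1 → (x j).res e κ = i j := by
      intro i x b hx hxi hb hbi
      refine ⟨Function.update x (hi r) b, IsGrowth.update (k := hi r) hx hb, fun j hj => ?_⟩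
      rcases Nat.lt_succ_iff_lt_or_eq.1 hj with h | h
      · rw [Function.update_of_ne, hxi j h]
        rintro rfl
        omega
      · obtain rfl : j = hi r := Fin.ext h
        rw [Function.update_self, hbi]
    have hcard : ∀ x : Fin n → Box ℓ, (shape x m).card + 2 ≤ n := fun x => by
      have := shape_card_le x m
      omega
    have hcases : ∀ i : Fin n → ZMod e, i (lo r) = i (hi r) ∨ Far (i (lo r)) (i (hi r)) ∨
        (i (lo r) ≠ i (hi r) ∧ (Arrow (i (lo r)) (i (hi r)) ∨ Arrow (i (hi r)) (i (lo r)))) := by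
      intro i
      unfold Far
      tauto
    have main : ∀ i, ε i ≠ 0 → (∃ x : Fin n → Box ℓ, IsGrowth (m + 1 + 1) x ∧
        ∀ j : Fin n, j.1 < m + 1 + 1 → (x j).res e κ = i j) ∧ y (hi r) * ε i = 0 := by
      intro i hi₀
      obtain ⟨x, hx, hxi⟩ := hg i hi₀
      have hxm : (x (lo r)).res e κ = i (lo r) := hxi (lo r) (Nat.lt_succ_self m)
      have hxa : Addable (shape x m) (x (lo r)) := hx (lo r) (Nat.lt_succ_self m)
      rcases hcases i with h | h | ⟨hne, h⟩
      · exact absurd (H.idem_eq_zero_of_eq hylo h) hi₀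
      · refine ⟨?_, H.y_hi_idem_of_far hylo h⟩
        -- The box `b` fits one step early, and still fits after `x (lo r)`, from which it is
        -- distinct because its residue is different.
        obtain ⟨b, hb, hbi⟩ := hswap i x hx hxi (H.idem_swap_ne_zero h hi₀)
        refine hextend i x b hx hxi ⟨?_, fun a ha hne => ?_⟩ hbi
        · intro h'
          rcases (shape_succ_of_lt x (lo r)).1 h' with h' | h'
          · exact hb.1 h'
          · rw [h', hxm] at hbi
            exact h.1 hbi
        · exact (shape_succ_of_lt x (lo r)).2 (Or.inl (hb.2 a ha hne))
      · have hsi : ε (i ∘ simpleSwap r) = 0 := by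
          by_contra hsi
          obtain ⟨b, hb, hbi⟩ := hswap i x hx hxi hsi
          have := hxa.far he hs hb (hcard x) (by
            rintro h'
            rw [← h', hxm] at hbi
            exact hne hbi)
          rw [hxm, hbi] at this
          exact h.elim this.2.1 this.2.2
        refine ⟨?_, H.y_hi_idem_of_arrow he hylo hne h hsi⟩
        have hor : (∃ b, Addable (shape x (m + 1)) b ∧ b.res e κ = i (hi r)) ∨
            ∃ c < lo r, (x c).res e κ = i (hi r) ∧
              ∀ j, c < j → j < lo r → Far ((x c).res e κ) ((x j).res e κ) := by
          rw [← hxm] at h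
          exact h.elim (hx.addable_right_or (m := lo r) he hs)
            (hx.addable_below_or (m := lo r) he hs)
        rcases hor with ⟨b, hb, hbi⟩ | ⟨c, hc, hci, hcf⟩
        · exact hextend i x b hx hxi hb hbi
        -- No box fits, so the letter i_{r+1} already occurs at `c` and commutes past everything up
        -- to position m - 1. Moving it there creates a pattern (a, a ± 1, a) in a nonzero
        -- idempotent, which the braid relation forbids.
        exfalso
        have hcm : c.1 < m := hc
        rw [hxi c (by omega)] at hci
        let q : Fin (n - 1) := ⟨m - 1, by omega⟩
        have hq : (lo q).1 = m - 1 := rfl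
        have hq' : hi q = lo r := Fin.ext (by simp [hi, lo, q, r]; omega)
        obtain ⟨i', h₁, h₂, h₃⟩ := H.exists_idem_ne_zero (m - 1 - c.1) (c := c) (m := lo q)
          (by omega) hi₀ (by
            intro j hj hjq
            have hjm : j.1 < m := by
              rw [Fin.le_def] at hjq
              omega
            have := hcf j hj hjm
            rwa [hxi c (by omega), hxi j (by omega)] at this)
        have e₁ := h₃ (lo r) (by rw [Fin.lt_def]; omega)
        have e₂ := h₃ (hi r) (by rw [Fin.lt_def]; omega)
        refine h₁ (H.idem_eq_zero_of_arrow he (r := q) (r' := r) (by simp [q, r]; omega)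
          (hy (lo q) (by omega)) (by rwa [hq']) (by rw [e₂, h₂, hci]) ?_)
        rw [hq', e₁, h₂, hci]
        exact h.symm
    refine ⟨fun i hi => (main i hi).1, fun j hj i => ?_⟩
    rcases Nat.lt_succ_iff_lt_or_eq.1 hj with h | h
    · exact hy j h i
    · obtain rfl : j = hi r := Fin.ext h
      by_cases h₀ : ε i = 0
      · rw [h₀, mul_zero]
      · exact (main i h₀).2

end SatisfiesKLR
end CycKLR

/-! ### Products of ψ as matrix units -/

namespace CycKLR

open Multipartition

/-- The conditions on the quiver and on the weight under which the algebra is semisimple. -/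
structure IsSemisimpleWeight (e n : ℕ) {ℓ : ℕ} (κ : Fin ℓ → ℤ) (Λ : PosWeight e) : Prop where
  char : e = 0 ∨ n < e
  separated : Separated e n κ
  eq_weightOf : Λ = weightOf e κ
  le_one : 0 < n → ∀ i, Λ i ≤ 1

theorem isSemisimpleWeight {e n ℓ : ℕ} {κ : Fin ℓ → ℤ} {Λ : PosWeight e} (he : e = 0 ∨ n < e)
    (hκ : Λ = weightOf e κ) (hΛ : ∀ i : ZMod e, pairing Λ (rootString i n) ≤ 1) :
    IsSemisimpleWeight e n κ Λ where
  char := he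
  separated := separated_of_pairing_le (hκ ▸ hΛ)
  eq_weightOf := hκ
  le_one hn i := by
    have h := hΛ i
    rw [pairing_rootString] at h
    refine le_trans ?_ h
    have := Finset.single_le_sum (f := fun k : ℕ => Λ (i + k)) (fun _ _ => Nat.zero_le _)
      (Finset.mem_range.2 hn)
    simpa using this

namespace SatisfiesKLR

variable {A : Type*} [Ring A] {e n ℓ : ℕ} {κ : Fin ℓ → ℤ} {Λ : PosWeight e}
  {ψ : Fin (n - 1) → A} {y : Fin n → A} {ε : (Fin n → ZMod e) → A}

theorem exists_std (H : SatisfiesKLR Λ ψ y ε) (hw : IsSemisimpleWeight e n κ Λ)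
    {i : Fin n → ZMod e} (hi : ε i ≠ 0) :
    ∃ (lam : Multipartition ℓ n) (t : lam.Std), t.residues e κ = i := by
  rcases Nat.eq_zero_or_pos n with rfl | hn
  · obtain ⟨lam, t, -⟩ := exists_std_of_isGrowth (ℓ := ℓ) (x := fun k : Fin 0 => k.elim0)
      fun k => k.elim0
    exact ⟨lam, t, funext fun k => k.elim0⟩
  · obtain ⟨x, hx, hxi⟩ := (H.growth_and_y hw.char hw.separated hw.eq_weightOf (hw.le_one hn)
      hn le_rfl).1 i hi
    obtain ⟨lam, t, rfl⟩ := exists_std_of_isGrowth hx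
    exact ⟨lam, t, funext fun k => hxi k k.2⟩

theorem y_eq_zero (H : SatisfiesKLR Λ ψ y ε) (hw : IsSemisimpleWeight e n κ Λ) (r : Fin n) :
    y r = 0 :=
  H.ext _ _ fun i => by
    rw [zero_mul]
    have hn : 0 < n := r.pos
    exact (H.growth_and_y hw.char hw.separated hw.eq_weightOf (hw.le_one hn) hn le_rfl).2 r r.2 i

/-- Nonzero idempotents come from standard tableaux, whose residues avoid (i, i ± 1, i), so the
correction term is never seen. This makes Matsumoto's theorem applicable to ψ. -/
theorem braid (H : SatisfiesKLR Λ ψ y ε) (hw : IsSemisimpleWeight e n κ Λ) (r r' : Fin (n - 1))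
    (hr : r'.1 = r.1 + 1) : ψ r * ψ r' * ψ r = ψ r' * ψ r * ψ r' := by
  rw [← sub_eq_zero]
  refine H.ext _ _ fun i => ?_
  rw [zero_mul]
  by_cases hi₀ : ε i = 0
  · rw [hi₀, mul_zero]
  · obtain ⟨lam, t, rfl⟩ := H.exists_std hw hi₀
    exact H.braid_of_far r r' hr _ (t.far_of_residues_eq hw.char hw.separated hr)

/-- A nonzero idempotent for the swapped sequence would belong to a standard tableau, which would
force the swap to be possible in `t`. -/
theorem psi_idem_eq_zero (H : SatisfiesKLR Λ ψ y ε) (hw : IsSemisimpleWeight e n κ Λ)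
    {lam : Multipartition ℓ n} {t : lam.Std} {r : Fin (n - 1)} (h : ¬∃ u, Std.IsSwap r t u) :
    ψ r * ε (t.residues e κ) = 0 := by
  rw [H.psi_idem]
  by_cases h₀ : ε (t.residues e κ ∘ simpleSwap r) = 0
  · rw [h₀, zero_mul]
  · obtain ⟨mu, u, hu⟩ := H.exists_std hw h₀
    exact absurd (Std.exists_isSwap_of_residues_eq hw.char hw.separated hu) h

theorem idem_psi_eq_zero (H : SatisfiesKLR Λ ψ y ε) (hw : IsSemisimpleWeight e n κ Λ)
    {lam : Multipartition ℓ n} {t : lam.Std} {r : Fin (n - 1)} (h : ¬∃ u, Std.IsSwap r t u) :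
    ε (t.residues e κ) * ψ r = 0 := by
  rw [← comp_swap_swap (t.residues e κ) r, ← H.psi_idem]
  by_cases h₀ : ε (t.residues e κ ∘ simpleSwap r) = 0
  · rw [h₀, mul_zero]
  · obtain ⟨mu, u, hu⟩ := H.exists_std hw h₀
    exact absurd (Std.exists_isSwap_of_residues_eq hw.char hw.separated hu) h

theorem psi_psi_idem_of_isSwap (H : SatisfiesKLR Λ ψ y ε) (hw : IsSemisimpleWeight e n κ Λ)
    {lam : Multipartition ℓ n} {t u : lam.Std} {r : Fin (n - 1)} (h : Std.IsSwap r t u) :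
    ψ r * ψ r * ε (t.residues e κ) = ε (t.residues e κ) :=
  H.quadratic_of_far r _ (h.far hw.char hw.separated)

theorem idem_psi_of_isSwap (H : SatisfiesKLR Λ ψ y ε)
    {lam : Multipartition ℓ n} {t u : lam.Std} {r : Fin (n - 1)} (h : Std.IsSwap r t u) :
    ε (t.residues e κ) * ψ r = ψ r * ε (u.residues e κ) := by
  rw [H.psi_idem, h.symm.residues_eq]

theorem idem_psi_psi_of_isSwap (H : SatisfiesKLR Λ ψ y ε) (hw : IsSemisimpleWeight e n κ Λ)
    {lam : Multipartition ℓ n} {t u : lam.Std} {r : Fin (n - 1)} (h : Std.IsSwap r t u) :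
    ε (t.residues e κ) * ψ r * ψ r = ε (t.residues e κ) := by
  rw [H.idem_psi_of_isSwap h, mul_assoc, H.idem_psi_of_isSwap h.symm, ← mul_assoc,
    H.psi_psi_idem_of_isSwap hw h]

/-- The element `ψ_{d(s)⁻¹} ε(i^lam) ψ_{d(t)}`. -/
def matrixUnit (κ : Fin ℓ → ℤ) (ψ : Fin (n - 1) → A) (ε : (Fin n → ZMod e) → A)
    (red : Equiv.Perm (Fin n) → List (Fin (n - 1))) {lam : Multipartition ℓ n}
    (s t : lam.Std) : A :=
  ((red s.perm⁻¹).map ψ).prod * ε (lam.initial.residues e κ) * ((red t.perm).map ψ).prod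

variable {red : Equiv.Perm (Fin n) → List (Fin (n - 1))} {lam : Multipartition ℓ n}

theorem matrixUnit_right (H : SatisfiesKLR Λ ψ y ε) (hw : IsSemisimpleWeight e n κ Λ)
    (hred : ∀ σ, IsReduced σ (red σ)) {s t u : lam.Std} {r : Fin (n - 1)}
    (h : Std.IsSwap r t u) (hlt : t.perm.symm (lo r) < t.perm.symm (hi r)) :
    matrixUnit κ ψ ε red s u = matrixUnit κ ψ ε red s t * ψ r := by
  have := prod_eq_of_isReduced ψ H.psi_psi (H.braid hw) (hred u.perm)
    (h.perm_eq ▸ (hred t.perm).append hlt)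
  rw [matrixUnit, this, matrixUnit]
  simp [mul_assoc]

theorem matrixUnit_left (H : SatisfiesKLR Λ ψ y ε) (hw : IsSemisimpleWeight e n κ Λ)
    (hred : ∀ σ, IsReduced σ (red σ)) {s t u : lam.Std} {r : Fin (n - 1)}
    (h : Std.IsSwap r t u) (hlt : t.perm.symm (lo r) < t.perm.symm (hi r)) :
    matrixUnit κ ψ ε red u s = ψ r * matrixUnit κ ψ ε red t s := by
  have hsymm : (simpleSwap r).trans u.perm⁻¹ = t.perm⁻¹ := by
    change (simpleSwap r).trans u.perm.symm = t.perm.symm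
    rw [h.symm.perm_eq, Equiv.symm_trans, simpleSwap_symm]
  have hcons : IsReduced u.perm⁻¹ (r :: red t.perm⁻¹) := by
    refine IsReduced.cons (hsymm ▸ hred _) ?_
    change u.perm.symm (hi r) < u.perm.symm (lo r)
    rw [h.perm_eq, Equiv.symm_trans, simpleSwap_symm]
    simpa using hlt
  have := prod_eq_of_isReduced ψ H.psi_psi (H.braid hw) (hred u.perm⁻¹) hcons
  rw [matrixUnit, this, matrixUnit]
  simp [mul_assoc]

theorem matrixUnit_initial (hred : ∀ σ, IsReduced σ (red σ)) :
    matrixUnit κ ψ ε red lam.initial lam.initial = ε (lam.initial.residues e κ) := by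
  have h : red (Equiv.refl (Fin n)) = [] := by
    rw [← List.length_eq_zero_iff, (isReduced_iff.1 (hred _)).2, inv_refl]
  have h' : (Equiv.refl (Fin n))⁻¹ = Equiv.refl (Fin n) := rfl
  rw [matrixUnit, Std.initial_perm, h', h]
  simp

/-- Conjugation by ψ_r carries the idempotent of `t` to that of the swapped tableau, because ψ_r²
acts there as the identity. -/
theorem matrixUnit_self (H : SatisfiesKLR Λ ψ y ε) (hw : IsSemisimpleWeight e n κ Λ)
    (hred : ∀ σ, IsReduced σ (red σ)) (t : lam.Std) :
    matrixUnit κ ψ ε red t t = ε (t.residues e κ) := by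
  induction t using Std.induction_swap with
  | h₀ => exact matrixUnit_initial hred
  | hP t u r h hlt ih =>
    rw [H.matrixUnit_left hw hred h hlt, H.matrixUnit_right hw hred h hlt, ih,
      H.idem_psi_of_isSwap h, ← mul_assoc, H.psi_psi_idem_of_isSwap hw h.symm]

theorem matrixUnit_mul_idem (H : SatisfiesKLR Λ ψ y ε) (hw : IsSemisimpleWeight e n κ Λ)
    (hred : ∀ σ, IsReduced σ (red σ)) (s t : lam.Std) :
    matrixUnit κ ψ ε red s t * ε (t.residues e κ) = matrixUnit κ ψ ε red s t := by
  induction t using Std.induction_swap with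
  | h₀ =>
    have h : red (Equiv.refl (Fin n)) = [] := by
      rw [← List.length_eq_zero_iff, (isReduced_iff.1 (hred _)).2, inv_refl]
    rw [matrixUnit, Std.initial_perm, h]
    simp [mul_assoc, H.idem_mul_self]
  | hP t u r h hlt ih =>
    rw [H.matrixUnit_right hw hred h hlt, mul_assoc, ← H.idem_psi_of_isSwap h, ← mul_assoc, ih]

theorem matrixUnit_mul_idem_of_ne (H : SatisfiesKLR Λ ψ y ε) (hw : IsSemisimpleWeight e n κ Λ)
    (hred : ∀ σ, IsReduced σ (red σ)) (s t : lam.Std) {i : Fin n → ZMod e}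
    (h : t.residues e κ ≠ i) : matrixUnit κ ψ ε red s t * ε i = 0 := by
  rw [← H.matrixUnit_mul_idem hw hred, mul_assoc, H.idem_mul_ne _ _ h, mul_zero]

/-- In contrast to `matrixUnit_right` the swap may shorten the permutation. Then e_{st} is itself
e_{su} ψ_r, and ψ_r² cancels against the idempotent of `u`. -/
theorem matrixUnit_mul_psi (H : SatisfiesKLR Λ ψ y ε) (hw : IsSemisimpleWeight e n κ Λ)
    (hred : ∀ σ, IsReduced σ (red σ)) (s : lam.Std) {t u : lam.Std} {r : Fin (n - 1)}
    (h : Std.IsSwap r t u) :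
    matrixUnit κ ψ ε red s t * ψ r = matrixUnit κ ψ ε red s u := by
  rcases lt_or_gt_of_ne (t.perm.symm.injective.ne (lo_ne_hi r)) with hlt | hlt
  · exact (H.matrixUnit_right hw hred h hlt).symm
  · have hlt' : u.perm.symm (lo r) < u.perm.symm (hi r) := by
      rw [h.perm_eq, Equiv.symm_trans, simpleSwap_symm]
      simpa using hlt
    rw [H.matrixUnit_right hw hred h.symm hlt', ← H.matrixUnit_mul_idem hw hred s u]
    simp only [mul_assoc]
    rw [← mul_assoc (ε _), H.idem_psi_psi_of_isSwap hw h.symm]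

theorem matrixUnit_mul_psi_of_not_isSwap (H : SatisfiesKLR Λ ψ y ε)
    (hw : IsSemisimpleWeight e n κ Λ) (hred : ∀ σ, IsReduced σ (red σ)) (s : lam.Std)
    {t : lam.Std} {r : Fin (n - 1)} (h : ¬∃ u, Std.IsSwap r t u) :
    matrixUnit κ ψ ε red s t * ψ r = 0 := by
  rw [← H.matrixUnit_mul_idem hw hred, mul_assoc, H.idem_psi_eq_zero hw h, mul_zero]

end SatisfiesKLR

/-! ### The relations in the cyclotomic quiver Hecke algebra -/

section Relations

variable (Z : Type*) [CommRing Z] {e n : ℕ} (Λ : PosWeight e)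

theorem mk_eq_of_rel {β : PosRoot e} {a b : FreeAlgebra Z (Gen n β)} (h : Rel Z Λ β a b) :
    RingQuot.mkAlgHom Z (Rel Z Λ β) a = RingQuot.mkAlgHom Z (Rel Z Λ β) b :=
  RingQuot.mkAlgHom_rel Z h

theorem mk_fpsi {β : PosRoot e} (r : Fin (n - 1)) :
    RingQuot.mkAlgHom Z (Rel Z Λ β) (fpsi Z β r) = gen Z Λ (Gen.psi r) := rfl

theorem mk_fy {β : PosRoot e} (r : Fin n) :
    RingQuot.mkAlgHom Z (Rel Z Λ β) (fy Z β r) = gen Z Λ (Gen.y r) := rfl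

theorem mk_fe {β : PosRoot e} (i : Seq n β) :
    RingQuot.mkAlgHom Z (Rel Z Λ β) (fe Z i) = gen Z Λ (Gen.idem i) := rfl

theorem idem_apply (β : PosRoot e) (i : Seq n β) : idem Z Λ i.1 β = gen Z Λ (Gen.idem i) := by
  rw [idem, dif_pos i.2]
  rfl

theorem idem_apply_of_ne (β : PosRoot e) {i : Fin n → ZMod e} (h : rootSum i ≠ β) :
    idem Z Λ i β = 0 := by
  rw [idem, dif_neg h]

theorem sum_gen_idem (β : PosRoot e) : ∑ i : Seq n β, gen Z Λ (Gen.idem i) = 1 := by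
  have := mk_eq_of_rel Z Λ (Rel.sum_idem (n := n) (Λ := Λ) (β := β))
  simpa [mk_fe] using this

theorem rootSum_comp_swap (i : Fin n → ZMod e) (r : Fin (n - 1)) :
    rootSum (i ∘ simpleSwap r) = rootSum i :=
  Equiv.sum_comp (simpleSwap r) fun k => simpleRoot (i k)

theorem psi_apply (β : PosRoot e) (r : Fin (n - 1)) : psi Z Λ r β = gen Z Λ (Gen.psi r) := rfl

theorem y_apply (β : PosRoot e) (r : Fin n) : y Z Λ r β = gen Z Λ (Gen.y r) := rfl

theorem exists_seq_or_ne (β : PosRoot e) (i : Fin n → ZMod e) :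
    (∃ j : Seq n β, j.1 = i) ∨ rootSum i ≠ β := by
  by_cases h : rootSum i = β
  · exact Or.inl ⟨⟨i, h⟩, rfl⟩
  · exact Or.inr h

/-- Equalities of elements `a e(i)` may be verified in the block of `i`. -/
theorem mul_idem_congr {a b : Alg Z n Λ} {i : Fin n → ZMod e}
    (h : ∀ (β : PosRoot e) (j : Seq n β), j.1 = i →
      a β * gen Z Λ (Gen.idem j) = b β * gen Z Λ (Gen.idem j)) :
    a * idem Z Λ i = b * idem Z Λ i := by
  funext β
  rcases exists_seq_or_ne β i with ⟨j, rfl⟩ | hβ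
  · rw [Pi.mul_apply, Pi.mul_apply, idem_apply]
    exact h β j rfl
  · rw [Pi.mul_apply, Pi.mul_apply, idem_apply_of_ne Z Λ β hβ, mul_zero, mul_zero]

/-- Each e(i) lives in a single block, so every relation involving it is checked there. Elements are
detected by the e(i) because these sum to 1 in each block. -/
theorem satisfiesKLR : SatisfiesKLR Λ (psi Z Λ) (y Z Λ) (idem (n := n) Z Λ) where
  ext a b h := by
    funext β
    rw [← mul_one (a β), ← mul_one (b β), ← sum_gen_idem Z Λ β, Finset.mul_sum, Finset.mul_sum]
    refine Finset.sum_congr rfl fun i _ => ?_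
    rw [← idem_apply]
    exact congrFun (h i.1) β
  idem_mul_self i := by
    conv_rhs => rw [← one_mul (idem Z Λ i)]
    refine mul_idem_congr Z Λ fun β j hj => ?_
    rw [← hj, idem_apply]
    simpa [mk_fe] using mk_eq_of_rel Z Λ (Rel.idem_mul_self (Λ := Λ) j)
  idem_mul_ne i j h := by
    conv_rhs => rw [← zero_mul (idem Z Λ j)]
    refine mul_idem_congr Z Λ fun β k hk => ?_
    rcases exists_seq_or_ne β i with ⟨m, rfl⟩ | hi
    · have hne : m ≠ k := fun h' => h ((congrArg Subtype.val h').trans hk)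
      rw [idem_apply]
      simpa [psi_apply, y_apply, mk_fe] using mk_eq_of_rel Z Λ (Rel.idem_mul_ne (Λ := Λ) _ _ hne)
    · rw [idem_apply_of_ne Z Λ β hi]
      simp
  y_idem r i := by
    funext β
    rcases exists_seq_or_ne β i with ⟨m, rfl⟩ | hi
    · rw [Pi.mul_apply, Pi.mul_apply, idem_apply]
      simpa [psi_apply, y_apply, mk_fe, mk_fy] using mk_eq_of_rel Z Λ (Rel.y_idem (Λ := Λ) r m)
    · rw [Pi.mul_apply, Pi.mul_apply, idem_apply_of_ne Z Λ β hi, mul_zero, zero_mul]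
  psi_idem r i := by
    funext β
    rcases exists_seq_or_ne β i with ⟨m, rfl⟩ | hi
    · have h := idem_apply Z Λ β (Seq.swap r m)
      rw [Pi.mul_apply, Pi.mul_apply, idem_apply]
      refine Eq.trans ?_ (congrArg (· * _) (Eq.symm h))
      simpa [psi_apply, y_apply, mk_fe, mk_fpsi] using mk_eq_of_rel Z Λ (Rel.psi_idem (Λ := Λ) r m)
    · rw [Pi.mul_apply, Pi.mul_apply, idem_apply_of_ne Z Λ β hi,
        idem_apply_of_ne Z Λ β (by rwa [rootSum_comp_swap]), mul_zero, zero_mul]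
  psi_psi r s h := by
    funext β
    simpa [psi_apply, y_apply, mk_fpsi] using mk_eq_of_rel Z Λ (Rel.psi_psi (Λ := Λ) (β := β) r s (Or.inl h))
  psi_y_hi_of_eq r i h := by
    refine mul_idem_congr Z Λ fun β j hj => ?_
    subst hj
    have := mk_eq_of_rel Z Λ (Rel.psi_y_hi (Λ := Λ) r j)
    rw [if_pos h] at this
    simpa [psi_apply, y_apply, mk_fpsi, mk_fy, mk_fe] using this
  y_hi_psi_of_eq r i h := by
    refine mul_idem_congr Z Λ fun β j hj => ?_
    subst hj
    have := mk_eq_of_rel Z Λ (Rel.y_hi_psi (Λ := Λ) r j)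
    rw [if_pos h] at this
    simpa [psi_apply, y_apply, mk_fpsi, mk_fy, mk_fe] using this
  y_hi_psi_of_ne r i h := by
    refine mul_idem_congr Z Λ fun β j hj => ?_
    subst hj
    have := mk_eq_of_rel Z Λ (Rel.y_hi_psi (Λ := Λ) r j)
    rw [if_neg h] at this
    simpa [psi_apply, y_apply, mk_fpsi, mk_fy, mk_fe] using this
  quadratic_of_eq r i h := by
    rw [← zero_mul (idem Z Λ i)]
    refine mul_idem_congr Z Λ fun β j hj => ?_
    subst hj
    have := mk_eq_of_rel Z Λ (Rel.quadratic (Λ := Λ) r j)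
    rw [quadRHS, if_pos h] at this
    simpa [psi_apply, y_apply, mk_fpsi, mk_fy, mk_fe, pow_two] using this
  quadratic_of_far r i h := by
    conv_rhs => rw [← one_mul (idem Z Λ i)]
    refine mul_idem_congr Z Λ fun β j hj => ?_
    subst hj
    have := mk_eq_of_rel Z Λ (Rel.quadratic (Λ := Λ) r j)
    rw [quadRHS, if_neg h.1, if_neg (fun h' => h.2.1 h'.1), if_neg h.2.1, if_neg h.2.2] at this
    simpa [psi_apply, y_apply, mk_fpsi, mk_fy, mk_fe, pow_two] using this
  quadratic_of_arrow r i hne h h' := by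
    refine mul_idem_congr Z Λ fun β j hj => ?_
    subst hj
    have := mk_eq_of_rel Z Λ (Rel.quadratic (Λ := Λ) r j)
    rw [quadRHS, if_neg hne, if_neg (fun h'' => h' h''.2), if_pos h] at this
    simpa [psi_apply, y_apply, mk_fpsi, mk_fy, mk_fe, pow_two] using this
  quadratic_of_arrow' r i hne h h' := by
    refine mul_idem_congr Z Λ fun β j hj => ?_
    subst hj
    have := mk_eq_of_rel Z Λ (Rel.quadratic (Λ := Λ) r j)
    rw [quadRHS, if_neg hne, if_neg (fun h'' => h' h''.1), if_neg h', if_pos h] at this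
    simpa [psi_apply, y_apply, mk_fpsi, mk_fy, mk_fe, pow_two] using this
  braid_of_arrow r r' hr i h h₁ h₂ := by
    rw [← neg_one_mul (idem Z Λ i)]
    refine mul_idem_congr Z Λ fun β j hj => ?_
    subst hj
    have := mk_eq_of_rel Z Λ (Rel.braid (Λ := Λ) r r' hr j)
    rw [braidRHS, if_pos h, if_neg (fun h'' => h₂ h''.2), if_pos h₁] at this
    simpa [psi_apply, y_apply, mk_fpsi, mk_fy, mk_fe] using this
  braid_of_arrow' r r' hr i h h₁ h₂ := by
    conv_rhs => rw [← one_mul (idem Z Λ i)]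
    refine mul_idem_congr Z Λ fun β j hj => ?_
    subst hj
    have := mk_eq_of_rel Z Λ (Rel.braid (Λ := Λ) r r' hr j)
    rw [braidRHS, if_pos h, if_neg (fun h'' => h₂ h''.1), if_neg h₂, if_pos h₁] at this
    simpa [psi_apply, y_apply, mk_fpsi, mk_fy, mk_fe] using this
  braid_of_far r r' hr i h := by
    rw [← zero_mul (idem Z Λ i)]
    refine mul_idem_congr Z Λ fun β j hj => ?_
    subst hj
    have := mk_eq_of_rel Z Λ (Rel.braid (Λ := Λ) r r' hr j)
    have h₀ : braidRHS Z r r' j = 0 := by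
      rw [braidRHS]
      split_ifs with h₁ h₂ h₃ h₄
      · exact absurd h₂.1 (h h₁).2.1
      · exact absurd h₃ (h h₁).2.1
      · exact absurd h₄ (h h₁).2.2
      · rfl
      · rfl
    rw [h₀] at this
    simpa [psi_apply, y_apply, mk_fpsi, mk_fy, mk_fe] using this
  cyclotomic hn i := by
    rw [← zero_mul (idem Z Λ i)]
    refine mul_idem_congr Z Λ fun β j hj => ?_
    subst hj
    have := mk_eq_of_rel Z Λ (Rel.cyclotomic (Λ := Λ) hn j)
    rw [pairing_simpleRoot] at this
    simpa [psi_apply, y_apply, mk_fpsi, mk_fy, mk_fe] using this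

end Relations

end CycKLR

namespace CycKLR

open Multipartition

/-! ### Matrices of partial maps -/

section RelMatrix

variable (Z : Type*) [CommRing Z] {T : Type*}

open Classical in
/-- The 0-1-matrix of a relation. -/
noncomputable def relMatrix (R : T → T → Prop) : Matrix T T Z := Matrix.of fun t u => if R t u then 1 else 0

open Classical in
theorem relMatrix_apply (R : T → T → Prop) (t u : T) :
    relMatrix Z R t u = if R t u then 1 else 0 := rfl

theorem relMatrix_congr {R S : T → T → Prop} (h : ∀ t u, R t u ↔ S t u) :
    relMatrix Z R = relMatrix Z S := by
  have : R = S := funext fun t => funext fun u => propext (h t u)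
  rw [this]

theorem relMatrix_eq_zero {R : T → T → Prop} (h : ∀ t u, ¬R t u) : relMatrix Z R = 0 := by
  ext t u
  rw [relMatrix_apply, if_neg (h t u)]
  rfl

/-- A relation is functional if it relates every element to at most one element. -/
def Functional (R : T → T → Prop) : Prop := ∀ t u v, R t u → R t v → u = v

theorem Functional.comp {R S : T → T → Prop} (hR : Functional R) (hS : Functional S) :
    Functional (Relation.Comp R S) := by
  rintro t u v ⟨a, ha, hu⟩ ⟨b, hb, hv⟩
  obtain rfl := hR t a b ha hb
  exact hS a u v hu hv

/-- For functional `R` each entry of the product has at most one nonzero summand, so no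
multiplicities arise. Matrix identities thereby become identities of relations. -/
theorem relMatrix_mul [Fintype T] {R : T → T → Prop} (hR : Functional R) (S : T → T → Prop) :
    relMatrix Z R * relMatrix Z S = relMatrix Z (Relation.Comp R S) := by
  classical
  ext t u
  rw [Matrix.mul_apply, relMatrix_apply]
  by_cases h : ∃ v, R t v
  · obtain ⟨v, hv⟩ := h
    rw [Finset.sum_eq_single v]
    · have : Relation.Comp R S t u ↔ S v u := by
        constructor
        · rintro ⟨w, hw, hwu⟩
          rwa [hR t v w hv hw]
        · exact fun h => ⟨v, hv, h⟩
      rw [relMatrix_apply, relMatrix_apply, if_pos hv, one_mul]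
      exact if_congr this.symm rfl rfl
    · intro w _ hw
      rw [relMatrix_apply, if_neg fun h => hw (hR t w v h hv), zero_mul]
    · exact fun h => absurd (Finset.mem_univ v) h
  · rw [if_neg, Finset.sum_eq_zero]
    · intro w _
      rw [relMatrix_apply, if_neg fun h' => h ⟨w, h'⟩, zero_mul]
    · rintro ⟨v, hv, _⟩
      exact h ⟨v, hv⟩

end RelMatrix

/-! ### Swap relations on standard tableaux -/

namespace Multipartition

variable {e n ℓ : ℕ} {κ : Fin ℓ → ℤ} {lam mu : Multipartition ℓ n}

noncomputable instance (lam : Multipartition ℓ n) : DecidableEq lam.Std := Classical.decEq _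

/-- The sum of the simple roots of the residues of a multipartition. -/
noncomputable def root (e : ℕ) (κ : Fin ℓ → ℤ) (lam : Multipartition ℓ n) : PosRoot e :=
  rootSum (lam.initial.residues e κ)

theorem Std.residues_eq_comp (t : lam.Std) :
    t.residues e κ = lam.initial.residues e κ ∘ t.perm.symm := by
  funext k
  rw [Std.residues_apply, Function.comp, Std.residues_apply, Std.perm_symm_apply, Std.box_entry]
  rfl

theorem Std.rootSum_residues (t : lam.Std) : rootSum (t.residues e κ) = lam.root e κ := by
  rw [t.residues_eq_comp]
  exact Equiv.sum_comp t.perm.symm fun k => simpleRoot (lam.initial.residues e κ k)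

theorem Std.eq_of_residues_eq (he : e = 0 ∨ n < e) (hs : Separated e n κ) {t u : lam.Std}
    (h : t.residues e κ = u.residues e κ) : t = u :=
  Std.ext_box (Std.box_eq_of_residues_eq he hs h)

theorem Std.functional_isSwap (r : Fin (n - 1)) : Functional (Std.IsSwap (lam := lam) r) :=
  fun _ _ _ h h' => h.unique h'

/-- The relation which restricts equality to the tableaux with residue sequence `i`. -/
def Std.HasResidues (κ : Fin ℓ → ℤ) (i : Fin n → ZMod e) (t u : lam.Std) : Prop :=
  t = u ∧ t.residues e κ = i

theorem Std.functional_hasResidues (i : Fin n → ZMod e) :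
    Functional (Std.HasResidues (lam := lam) κ i) :=
  fun _ _ _ h h' => h.1.symm.trans h'.1

theorem Std.exists_isSwap_iff (he : e = 0 ∨ n < e) (hs : Separated e n κ) {t : lam.Std}
    {r : Fin (n - 1)} :
    (∃ u, Std.IsSwap r t u) ↔ Far (t.residues e κ (lo r)) (t.residues e κ (hi r)) := by
  constructor
  · rintro ⟨u, h⟩
    exact h.far he hs
  · intro h
    by_contra hu
    rcases Std.arrow_of_not_isSwap (κ := κ) (e := e) hu with h' | h'
    · exact h.2.1 h'
    · exact h.2.2 h'

theorem Std.comp_isSwap_self {r : Fin (n - 1)} {t u : lam.Std} :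
    Relation.Comp (Std.IsSwap r) (Std.IsSwap r) t u ↔ t = u ∧ ∃ v, Std.IsSwap r t v := by
  constructor
  · rintro ⟨v, h, h'⟩
    exact ⟨h.symm.unique h', v, h⟩
  · rintro ⟨rfl, v, h⟩
    exact ⟨v, h, h.symm⟩

/-- The intermediate tableau of the other order is standard because the entries moved by `s` are
already reversed between the standard tableaux `t` and `u`. -/
theorem Std.comp_isSwap_comm {r s : Fin (n - 1)} (hrs : r.1 + 1 < s.1 ∨ s.1 + 1 < r.1)
    {t u : lam.Std} (h : Relation.Comp (Std.IsSwap r) (Std.IsSwap s) t u) :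
    Relation.Comp (Std.IsSwap s) (Std.IsSwap r) t u := by
  obtain ⟨v, h, h'⟩ := h
  have hcomm : (simpleSwap r).trans (simpleSwap s) = (simpleSwap s).trans (simpleSwap r) := by
    rcases hrs with hrs | hrs
    · simpa using (simpleSwap_comm hrs (Equiv.refl _)).symm
    · simpa using simpleSwap_comm hrs (Equiv.refl _)
  have hu : u.entry = t.entry.trans ((simpleSwap r).trans (simpleSwap s)) := by
    rw [h', h, Equiv.trans_assoc]
  have e₁ : simpleSwap r (lo s) = lo s := simpleSwap_of_ne
    (by simp [lo, Fin.ext_iff]; omega) (by simp [lo, hi, Fin.ext_iff]; omega)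
  have e₂ : simpleSwap r (hi s) = hi s := simpleSwap_of_ne
    (by simp [lo, hi, Fin.ext_iff]; omega) (by simp [hi, Fin.ext_iff]; omega)
  obtain ⟨w, hw⟩ := Std.exists_isSwap_of_lt (r := s) hu (by simp [e₁, e₂, lo_lt_hi])
  refine ⟨w, hw, ?_⟩
  rw [Std.IsSwap, hw, hu, hcomm, Equiv.trans_assoc]

/-- Only the step out of `t` and the step into `u` have to exist. The middle step is then an
identity of permutations. -/
theorem Std.IsSwap.braid_of_exists {r s : Fin (n - 1)} {t u w : lam.Std}
    (hbraid : (simpleSwap r).trans ((simpleSwap s).trans (simpleSwap r)) =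
      (simpleSwap s).trans ((simpleSwap r).trans (simpleSwap s)))
    (hu : u.entry = t.entry.trans ((simpleSwap r).trans ((simpleSwap s).trans (simpleSwap r))))
    (hw : Std.IsSwap s t w) (hu' : ∃ w', Std.IsSwap s u w') :
    Relation.Comp (Relation.Comp (Std.IsSwap s) (Std.IsSwap r)) (Std.IsSwap s) t u := by
  obtain ⟨w', hw'⟩ := hu'
  refine ⟨w', ⟨w, hw, ?_⟩, hw'.symm⟩
  rw [Std.IsSwap, hw, hw', hu, hbraid, Equiv.trans_assoc, Equiv.trans_assoc, Equiv.trans_assoc,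
    Equiv.trans_assoc, simpleSwap_trans_self, Equiv.trans_refl]

theorem Std.comp_isSwap_braid {r s : Fin (n - 1)} (hrs : s.1 = r.1 + 1) {t u : lam.Std} :
    Relation.Comp (Relation.Comp (Std.IsSwap r) (Std.IsSwap s)) (Std.IsSwap r) t u ↔
      Relation.Comp (Relation.Comp (Std.IsSwap s) (Std.IsSwap r)) (Std.IsSwap s) t u := by
  have hbraid : (simpleSwap r).trans ((simpleSwap s).trans (simpleSwap r)) =
      (simpleSwap s).trans ((simpleSwap r).trans (simpleSwap s)) := by
    simpa using simpleSwap_braid hrs (Equiv.refl _)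
  have e₀ : lo s = hi r := by simp [lo, hi, hrs]
  have e₂ : simpleSwap r (hi s) = hi s := simpleSwap_of_ne
    (by simp [lo, hi, Fin.ext_iff]; omega) (by simp [hi, Fin.ext_iff]; omega)
  have e₃ : simpleSwap s (lo r) = lo r := simpleSwap_of_ne
    (by simp [lo, Fin.ext_iff]; omega) (by simp [lo, hi, Fin.ext_iff]; omega)
  have e₄ : simpleSwap s (hi r) = hi s := by rw [← e₀, simpleSwap_lo]
  have hlt₁ : lo r < hi r := lo_lt_hi r
  have hlt₂ : hi r < hi s := e₀ ▸ lo_lt_hi s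
  -- the product of the three transpositions
  have key : ∀ {t u : lam.Std},
      u.entry = t.entry.trans ((simpleSwap r).trans ((simpleSwap s).trans (simpleSwap r))) →
      (∃ w, Std.IsSwap r t w) ∧ (∃ w, Std.IsSwap s t w) ∧
      t.entry = u.entry.trans ((simpleSwap r).trans ((simpleSwap s).trans (simpleSwap r))) := by
    intro t u hu
    -- The product reverses all three entries, so both neighbouring pairs are reversed between `t`
    -- and `u`. It is an involution, so `t` and `u` play symmetric roles.
    refine ⟨Std.exists_isSwap_of_lt hu ?_, Std.exists_isSwap_of_lt hu ?_, ?_⟩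
    · simpa [e₀, e₂, e₃, e₄] using hlt₂
    · simpa [e₀, e₂, e₃, e₄] using hlt₁
    · rw [hu]
      ext x
      simp
  constructor
  · rintro ⟨v', ⟨v, h₁, h₂⟩, h₃⟩
    have hu : u.entry =
        t.entry.trans ((simpleSwap r).trans ((simpleSwap s).trans (simpleSwap r))) := by
      rw [h₃, h₂, h₁, Equiv.trans_assoc, Equiv.trans_assoc]
    obtain ⟨-, ⟨w, hw⟩, ht⟩ := key hu
    exact Std.IsSwap.braid_of_exists hbraid hu hw (key ht).2.1
  · rintro ⟨v', ⟨v, h₁, h₂⟩, h₃⟩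
    have hu : u.entry =
        t.entry.trans ((simpleSwap s).trans ((simpleSwap r).trans (simpleSwap s))) := by
      rw [h₃, h₂, h₁, Equiv.trans_assoc, Equiv.trans_assoc]
    obtain ⟨⟨w, hw⟩, -, ht⟩ := key (hbraid ▸ hu)
    exact Std.IsSwap.braid_of_exists hbraid.symm hu hw (key ht).1

/-- The first entry sits in the corner of some component, and the residue there is the charge of
that component. -/
theorem Std.weightOf_residues_ne_zero (t : lam.Std) (hn : 0 < n) :
    weightOf e κ (t.residues e κ ⟨0, hn⟩) ≠ 0 := by
  have h := t.isGrowth n ⟨0, hn⟩ hn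
  have hsh : ∀ a, a ∉ shape t.box 0 := fun a ha => by
    obtain ⟨j, hj, -⟩ := mem_shape.1 ha
    omega
  have hbox : t.box ⟨0, hn⟩ = ((t.box ⟨0, hn⟩).1, 0, 0) := by
    by_contra hne
    exact hsh _ (h.2 ((t.box ⟨0, hn⟩).1, 0, 0) ⟨rfl, Nat.zero_le _, Nat.zero_le _⟩ (Ne.symm hne))
  rw [Std.residues_apply, hbox, weightOf_apply]
  intro h₀
  have := (Finset.sum_eq_zero_iff.1 h₀) (t.box ⟨0, hn⟩).1 (Finset.mem_univ _)
  simp [Box.res] at this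

end Multipartition

/-! ### The representation on standard tableaux -/

section Representation

variable (Z : Type*) [CommRing Z] {e n ℓ : ℕ} {κ : Fin ℓ → ℤ} {lam : Multipartition ℓ n}

/-- The matrix of `e(i)` in the seminormal representation. -/
noncomputable def idemMatrix (κ : Fin ℓ → ℤ) (lam : Multipartition ℓ n) (i : Fin n → ZMod e) :
    Matrix lam.Std lam.Std Z :=
  relMatrix Z (Std.HasResidues κ i)

/-- The matrix of `ψ_r` in the seminormal representation. -/
noncomputable def psiMatrix (lam : Multipartition ℓ n) (r : Fin (n - 1)) :
    Matrix lam.Std lam.Std Z :=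
  relMatrix Z (Std.IsSwap r)

theorem idemMatrix_eq_zero {i : Fin n → ZMod e} (h : ∀ t : lam.Std, t.residues e κ ≠ i) :
    idemMatrix Z κ lam i = 0 :=
  relMatrix_eq_zero Z fun t _ h' => h t h'.2

theorem idemMatrix_mul_self (i : Fin n → ZMod e) :
    idemMatrix Z κ lam i * idemMatrix Z κ lam i = idemMatrix Z κ lam i := by
  rw [idemMatrix, relMatrix_mul Z (Std.functional_hasResidues i)]
  refine relMatrix_congr Z fun t u => ⟨?_, ?_⟩
  · rintro ⟨v, ⟨rfl, h⟩, ⟨rfl, _⟩⟩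
    exact ⟨rfl, h⟩
  · rintro ⟨rfl, h⟩
    exact ⟨t, ⟨rfl, h⟩, ⟨rfl, h⟩⟩

theorem idemMatrix_mul_ne {i j : Fin n → ZMod e} (h : i ≠ j) :
    idemMatrix Z κ lam i * idemMatrix Z κ lam j = 0 := by
  rw [idemMatrix, idemMatrix, relMatrix_mul Z (Std.functional_hasResidues i)]
  refine relMatrix_eq_zero Z fun t u => ?_
  rintro ⟨v, ⟨rfl, h₁⟩, ⟨rfl, h₂⟩⟩
  exact h (h₁.symm.trans h₂)

theorem sum_idemMatrix : ∑ i : Seq n (lam.root e κ), idemMatrix Z κ lam i.1 = 1 := by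
  ext t u
  rw [Matrix.sum_apply, Matrix.one_apply]
  by_cases h : t = u
  · subst h
    rw [if_pos rfl]
    refine (Finset.sum_eq_single (⟨t.residues e κ, t.rootSum_residues⟩ : Seq n (lam.root e κ))
      ?_ ?_).trans ?_
    · intro i _ hi
      exact if_neg fun h => hi (Subtype.ext h.2.symm)
    · exact fun h => (h (Finset.mem_univ (α := Seq n (lam.root e κ)) _)).elim
    · exact if_pos ⟨rfl, rfl⟩
  · rw [if_neg h]
    exact Finset.sum_eq_zero fun i _ => if_neg fun h' => h h'.1

theorem psiMatrix_mul_idemMatrix (r : Fin (n - 1)) (i : Fin n → ZMod e) :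
    psiMatrix Z lam r * idemMatrix Z κ lam i =
      idemMatrix Z κ lam (i ∘ simpleSwap r) * psiMatrix Z lam r := by
  rw [idemMatrix, idemMatrix, psiMatrix, relMatrix_mul Z (Std.functional_hasResidues _),
    relMatrix_mul Z (Std.functional_isSwap r)]
  refine relMatrix_congr Z fun t u => ⟨?_, ?_⟩
  · rintro ⟨v, hv, ⟨rfl, rfl⟩⟩
    exact ⟨t, ⟨rfl, hv.symm.residues_eq⟩, hv⟩
  · rintro ⟨v, ⟨rfl, h⟩, hv⟩
    refine ⟨u, hv, rfl, ?_⟩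
    rw [hv.residues_eq, h, SatisfiesKLR.comp_swap_swap]

theorem psiMatrix_comm {r s : Fin (n - 1)} (h : r.1 + 1 < s.1 ∨ s.1 + 1 < r.1) :
    psiMatrix Z lam r * psiMatrix Z lam s = psiMatrix Z lam s * psiMatrix Z lam r := by
  rw [psiMatrix, psiMatrix, relMatrix_mul Z (Std.functional_isSwap _),
    relMatrix_mul Z (Std.functional_isSwap _)]
  exact relMatrix_congr Z fun t u => ⟨Std.comp_isSwap_comm h, Std.comp_isSwap_comm h.symm⟩

theorem psiMatrix_braid {r s : Fin (n - 1)} (h : s.1 = r.1 + 1) :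
    psiMatrix Z lam r * psiMatrix Z lam s * psiMatrix Z lam r =
      psiMatrix Z lam s * psiMatrix Z lam r * psiMatrix Z lam s := by
  have hf := fun r => Std.functional_isSwap (lam := lam) r
  simp only [psiMatrix, relMatrix_mul Z (hf _), relMatrix_mul Z ((hf _).comp (hf _))]
  exact relMatrix_congr Z fun t u => Std.comp_isSwap_braid h

theorem psiMatrix_mul_self_mul_idemMatrix (he : e = 0 ∨ n < e) (hs : Separated e n κ)
    {r : Fin (n - 1)} {i : Fin n → ZMod e} (h : Far (i (lo r)) (i (hi r))) :
    psiMatrix Z lam r * psiMatrix Z lam r * idemMatrix Z κ lam i = idemMatrix Z κ lam i := by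
  have hf := Std.functional_isSwap (lam := lam) r
  rw [idemMatrix, psiMatrix, relMatrix_mul Z hf, relMatrix_mul Z (hf.comp hf)]
  refine relMatrix_congr Z fun t u => ⟨?_, ?_⟩
  · rintro ⟨v, hv, rfl, hi⟩
    exact ⟨(Std.comp_isSwap_self.1 hv).1, (Std.comp_isSwap_self.1 hv).1 ▸ hi⟩
  · rintro ⟨rfl, rfl⟩
    exact ⟨t, Std.comp_isSwap_self.2 ⟨rfl, (Std.exists_isSwap_iff he hs).2 h⟩, rfl, rfl⟩

theorem psiMatrix_mul_self_mul_idemMatrix_eq_zero (he : e = 0 ∨ n < e) (hs : Separated e n κ)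
    {r : Fin (n - 1)} {i : Fin n → ZMod e} (h : ¬Far (i (lo r)) (i (hi r))) :
    psiMatrix Z lam r * psiMatrix Z lam r * idemMatrix Z κ lam i = 0 := by
  have hf := Std.functional_isSwap (lam := lam) r
  rw [idemMatrix, psiMatrix, relMatrix_mul Z hf, relMatrix_mul Z (hf.comp hf)]
  refine relMatrix_eq_zero Z fun t u => ?_
  rintro ⟨v, hv, rfl, rfl⟩
  have hv := Std.comp_isSwap_self.1 hv
  exact h (hv.1 ▸ (Std.exists_isSwap_iff he hs).1 hv.2)

/-- The images of the generators in the seminormal representation. -/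
noncomputable def genMatrix (κ : Fin ℓ → ℤ) (lam : Multipartition ℓ n) {β : PosRoot e} :
    Gen n β → Matrix lam.Std lam.Std Z
  | .psi r => psiMatrix Z lam r
  | .y _ => 0
  | .idem i => idemMatrix Z κ lam i.1

/-- The seminormal representation of the free algebra. -/
noncomputable def freeRep (κ : Fin ℓ → ℤ) (lam : Multipartition ℓ n) (β : PosRoot e) :
    FreeAlgebra Z (Gen n β) →ₐ[Z] Matrix lam.Std lam.Std Z :=
  FreeAlgebra.lift Z (genMatrix Z κ lam)

section

variable {β : PosRoot e}

@[simp] theorem freeRep_fpsi (r : Fin (n - 1)) :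
    freeRep Z κ lam β (fpsi Z β r) = psiMatrix Z lam r :=
  FreeAlgebra.lift_ι_apply _ _

@[simp] theorem freeRep_fy (r : Fin n) : freeRep Z κ lam β (fy Z β r) = 0 :=
  FreeAlgebra.lift_ι_apply _ _

@[simp] theorem freeRep_fe (i : Seq n β) :
    freeRep Z κ lam β (fe Z i) = idemMatrix Z κ lam i.1 :=
  FreeAlgebra.lift_ι_apply _ _

end

/-- With y_r = 0 the relations reduce to the behaviour of swaps. Every correction term either
contains a y or belongs to a residue pattern (i, i) or (i, i ± 1, i) that no standard tableau has,
where the matrix of e(i) is 0. -/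
theorem freeRep_rel {Λ : PosWeight e} (hw : IsSemisimpleWeight e n κ Λ)
    {a b : FreeAlgebra Z (Gen n (lam.root e κ))} (h : Rel Z Λ (lam.root e κ) a b) :
    freeRep Z κ lam _ a = freeRep Z κ lam _ b := by
  have he := hw.char
  have hs := hw.separated
  have hzero : ∀ (r : Fin (n - 1)) (i : Seq n (lam.root e κ)), i.1 (lo r) = i.1 (hi r) →
      idemMatrix Z κ lam i.1 = 0 := fun r i hi => idemMatrix_eq_zero Z fun t ht =>
    t.residues_lo_ne_hi he hs r (by rw [ht, hi])
  cases h with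
  | idem_mul_self i => simp [idemMatrix_mul_self]
  | idem_mul_ne i j h => simpa using idemMatrix_mul_ne Z fun h' => h (Subtype.ext h')
  | sum_idem => simp [sum_idemMatrix]
  | y_idem r i => simp
  | psi_idem r i =>
    simp only [map_mul, freeRep_fpsi, freeRep_fe]
    exact psiMatrix_mul_idemMatrix Z r i.1
  | y_y r s => simp
  | psi_psi r s h => simpa using psiMatrix_comm Z h
  | psi_y r s h₁ h₂ => simp
  | psi_y_hi r i =>
    split_ifs with h
    · simp [hzero r i h]
    · simp
  | y_hi_psi r i =>
    split_ifs with h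
    · simp [hzero r i h]
    · simp
  | quadratic r i =>
    simp only [pow_two, map_mul, freeRep_fpsi, freeRep_fe]
    by_cases h : Far (i.1 (lo r)) (i.1 (hi r))
    · rw [psiMatrix_mul_self_mul_idemMatrix Z he hs h, quadRHS, if_neg h.1,
        if_neg (fun h' => h.2.1 h'.1), if_neg h.2.1, if_neg h.2.2, freeRep_fe]
    · rw [psiMatrix_mul_self_mul_idemMatrix_eq_zero Z he hs h, quadRHS]
      split_ifs with h₁ h₂ h₃ h₄
      · simp
      · simp
      · simp
      · simp
      · exact absurd ⟨h₁, h₃, h₄⟩ h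
  | braid r r' h i =>
    simp only [map_mul, map_sub, freeRep_fpsi, freeRep_fe, psiMatrix_braid Z h, sub_self,
      zero_mul]
    rw [braidRHS]
    by_cases h₁ : i.1 (hi r') = i.1 (lo r)
    · by_cases h₂ : Far (i.1 (lo r)) (i.1 (hi r))
      · rw [if_pos h₁, if_neg (fun h' => h₂.2.1 h'.1), if_neg h₂.2.1, if_neg h₂.2.2, map_zero]
      · have h₀ : idemMatrix Z κ lam i.1 = 0 := idemMatrix_eq_zero Z fun t ht =>
          h₂ (ht ▸ t.far_of_residues_eq he hs h (by rw [ht, h₁]))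
        split_ifs <;> simp [h₀]
    · rw [if_neg h₁, map_zero]
  | cyclotomic hn i =>
    rw [pairing_simpleRoot]
    rcases Nat.eq_zero_or_pos (Λ (i.1 ⟨0, hn⟩)) with h | h
    · have h₀ : idemMatrix Z κ lam i.1 = 0 := idemMatrix_eq_zero Z fun t ht =>
        t.weightOf_residues_ne_zero (e := e) (κ := κ) hn (by rw [ht, ← hw.eq_weightOf, h])
      simp [h₀]
    · simp [h.ne']

/-- The seminormal representation of a block. -/
noncomputable def blockRep {Λ : PosWeight e} (hw : IsSemisimpleWeight e n κ Λ)
    (lam : Multipartition ℓ n) : Block Z n Λ (lam.root e κ) →ₐ[Z] Matrix lam.Std lam.Std Z :=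
  RingQuot.liftAlgHom Z ⟨freeRep Z κ lam _, fun _ _ h => freeRep_rel Z hw h⟩

theorem blockRep_gen {Λ : PosWeight e} (hw : IsSemisimpleWeight e n κ Λ)
    (lam : Multipartition ℓ n) (g : Gen n (lam.root e κ)) :
    blockRep Z hw lam (gen Z Λ g) = genMatrix Z κ lam g := by
  rw [blockRep, gen, RingQuot.liftAlgHom_mkAlgHom_apply]
  exact FreeAlgebra.lift_ι_apply _ _

/-- The sum of the seminormal representations. -/
noncomputable def rep {Λ : PosWeight e} (hw : IsSemisimpleWeight e n κ Λ) :
    Alg Z n Λ →ₐ[Z] ((lam : Multipartition ℓ n) → Matrix lam.Std lam.Std Z) :=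
  AlgHom.pi fun lam => (blockRep Z hw lam).comp (Pi.evalAlgHom Z _ (lam.root e κ))

theorem rep_psi {Λ : PosWeight e} (hw : IsSemisimpleWeight e n κ Λ) (r : Fin (n - 1)) :
    rep Z hw (psi Z Λ r) = fun lam => psiMatrix Z lam r :=
  funext fun lam => blockRep_gen Z hw lam _

theorem rep_idem {Λ : PosWeight e} (hw : IsSemisimpleWeight e n κ Λ) (i : Fin n → ZMod e) :
    rep Z hw (idem Z Λ i) = fun lam => idemMatrix Z κ lam i := by
  funext lam
  change blockRep Z hw lam (idem Z Λ i (lam.root e κ)) = _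
  rcases exists_seq_or_ne (lam.root e κ) i with ⟨j, rfl⟩ | h
  · rw [idem_apply, blockRep_gen]
    rfl
  · rw [idem_apply_of_ne Z Λ _ h, map_zero, idemMatrix_eq_zero]
    rintro t rfl
    exact h t.rootSum_residues

end Representation
end CycKLR

namespace CycKLR

open Multipartition

/-! ### The elements e_{st} span -/

section Spanning

variable (Z : Type*) [CommRing Z] {e n ℓ : ℕ} {Λ : PosWeight e} {κ : Fin ℓ → ℤ}
  {red : Equiv.Perm (Fin n) → List (Fin (n - 1))}

theorem eElt_eq_matrixUnit {lam : Multipartition ℓ n} (s t : lam.Std) :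
    eElt Z Λ κ red s t = SatisfiesKLR.matrixUnit κ (psi Z Λ) (idem Z Λ) red s t := rfl

/-- A submodule of a block which contains `1` and is stable under right multiplication by the
generators is the whole block. -/
theorem block_submodule_eq_top {β : PosRoot e} (S : Submodule Z (Block Z n Λ β)) (h₁ : 1 ∈ S)
    (hS : ∀ x ∈ S, ∀ g : Gen n β, x * gen Z Λ g ∈ S) : S = ⊤ := by
  have key : ∀ f : FreeAlgebra Z (Gen n β), ∀ x ∈ S,
      x * RingQuot.mkAlgHom Z (Rel Z Λ β) f ∈ S := by
    intro f
    induction f using FreeAlgebra.induction with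
    | grade0 r =>
      intro x hx
      rw [AlgHom.commutes, ← Algebra.commutes, ← Algebra.smul_def]
      exact S.smul_mem r hx
    | grade1 g => exact fun x hx => hS x hx g
    | mul a b ha hb =>
      intro x hx
      rw [map_mul, ← mul_assoc]
      exact hb _ (ha x hx)
    | add a b ha hb =>
      intro x hx
      rw [map_add, mul_add]
      exact S.add_mem (ha x hx) (hb x hx)
  rw [eq_top_iff]
  intro x _
  obtain ⟨f, rfl⟩ := RingQuot.mkAlgHom_surjective Z (Rel Z Λ β) x
  simpa using key f 1 h₁

theorem exists_std_of_gen_idem_ne_zero (hw : IsSemisimpleWeight e n κ Λ) {β : PosRoot e}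
    {i : Seq n β} (h : gen Z Λ (Gen.idem i) ≠ 0) :
    ∃ (lam : Multipartition ℓ n) (t : lam.Std), t.residues e κ = i.1 := by
  refine (satisfiesKLR Z Λ).exists_std hw fun h' => h ?_
  rw [← idem_apply, h', Pi.zero_apply]

/-- In a nonzero block some e(i) is nonzero because they sum to 1. Then i comes from a tableau, and
β is determined by one of the finitely many shapes. -/
theorem finite_nontrivial_block (hw : IsSemisimpleWeight e n κ Λ) :
    {β : PosRoot e | Nontrivial (Block Z n Λ β)}.Finite := by
  refine (Set.finite_range fun lam : Multipartition ℓ n => lam.root e κ).subset ?_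
  intro β (hβ : Nontrivial (Block Z n Λ β))
  have h₁ : ∑ i : Seq n β, gen Z Λ (Gen.idem i) ≠ 0 := by
    rw [sum_gen_idem]
    exact one_ne_zero
  obtain ⟨i, -, hi⟩ := Finset.exists_ne_zero_of_sum_ne_zero h₁
  obtain ⟨lam, t, ht⟩ := exists_std_of_gen_idem_ne_zero Z hw hi
  exact ⟨lam, by rw [← i.2, ← ht, t.rootSum_residues]⟩

open Classical in
/-- The elements `e_{st}` span the algebra. -/
theorem span_eElt (hw : IsSemisimpleWeight e n κ Λ) (hred : ∀ σ, IsReduced σ (red σ)) :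
    Submodule.span Z (Set.range fun x : Σ lam : Multipartition ℓ n, lam.Std × lam.Std =>
      eElt Z Λ κ red x.2.1 x.2.2) = ⊤ := by
  have H := satisfiesKLR (n := n) Z Λ
  set S := Submodule.span Z (Set.range fun x : Σ lam : Multipartition ℓ n, lam.Std × lam.Std =>
      eElt Z Λ κ red x.2.1 x.2.2) with hSdef
  have hmem : ∀ {lam : Multipartition ℓ n} (s t : lam.Std), eElt Z Λ κ red s t ∈ S :=
    fun {lam} s t => Submodule.subset_span ⟨⟨lam, s, t⟩, rfl⟩
  have hmul : ∀ b : Alg Z n Λ,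
      (∀ {lam : Multipartition ℓ n} (s t : lam.Std), eElt Z Λ κ red s t * b ∈ S) →
      ∀ a ∈ S, a * b ∈ S := by
    intro b hb a ha
    induction ha using Submodule.span_induction with
    | mem x hx =>
      obtain ⟨x, rfl⟩ := hx
      exact hb _ _
    | zero => rw [zero_mul]; exact S.zero_mem
    | add x z _ _ hx hz => rw [add_mul]; exact S.add_mem hx hz
    | smul r x _ hx => rw [smul_mul_assoc]; exact S.smul_mem r hx
  have hpsi : ∀ (r : Fin (n - 1)), ∀ a ∈ S, a * psi Z Λ r ∈ S := by
    intro r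
    refine hmul _ fun {lam} s t => ?_
    by_cases h : ∃ u, Std.IsSwap r t u
    · obtain ⟨u, hu⟩ := h
      rw [eElt_eq_matrixUnit, H.matrixUnit_mul_psi hw hred s hu]
      exact hmem s u
    · rw [eElt_eq_matrixUnit, H.matrixUnit_mul_psi_of_not_isSwap hw hred s h]
      exact S.zero_mem
  have hidem : ∀ (i : Fin n → ZMod e), ∀ a ∈ S, a * idem Z Λ i ∈ S := by
    intro i
    refine hmul _ fun {lam} s t => ?_
    by_cases h : t.residues e κ = i
    · rw [← h, eElt_eq_matrixUnit, H.matrixUnit_mul_idem hw hred]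
      exact hmem s t
    · rw [eElt_eq_matrixUnit, H.matrixUnit_mul_idem_of_ne hw hred s t h]
      exact S.zero_mem
  have hidem_mem : ∀ i : Fin n → ZMod e, idem Z Λ i ∈ S := by
    intro i
    by_cases h : idem Z Λ i = 0
    · rw [h]
      exact S.zero_mem
    · obtain ⟨lam, t, rfl⟩ := H.exists_std hw h
      rw [← H.matrixUnit_self hw hred t]
      exact hmem t t
  -- The product is reached one block at a time: the unit of a block is a finite sum of elements
  -- e(i), and `S` is stable under right multiplication by the generators.
  have hsingle : ∀ (β : PosRoot e) (x : Block Z n Λ β), (Pi.single β x : Alg Z n Λ) ∈ S := by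
    intro β
    have hmulsingle : ∀ (x : Block Z n Λ β) (b : Alg Z n Λ),
        (Pi.single β (x * b β) : Alg Z n Λ) = Pi.single β x * b := by
      intro x b
      funext γ
      by_cases h : γ = β
      · subst h
        simp
      · simp [h]
    have htop := block_submodule_eq_top Z
      (S.comap (LinearMap.single Z (fun β => Block Z n Λ β) β)) ?_ ?_
    · intro x
      have : x ∈ S.comap (LinearMap.single Z (fun β => Block Z n Λ β) β) := by
        rw [htop]
        trivial
      exact this
    · have : (Pi.single β 1 : Alg Z n Λ) = ∑ i : Seq n β, idem Z Λ i.1 := by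
        funext γ
        rw [Finset.sum_apply]
        by_cases h : γ = β
        · subst h
          rw [Pi.single_eq_same, ← sum_gen_idem]
          exact Finset.sum_congr rfl fun i _ => (idem_apply Z Λ γ i).symm
        · rw [Pi.single_eq_of_ne h]
          refine (Finset.sum_eq_zero fun i _ => ?_).symm
          exact idem_apply_of_ne Z Λ γ fun h' => h (h'.symm.trans i.2)
      change (Pi.single β 1 : Alg Z n Λ) ∈ S
      rw [this]
      exact S.sum_mem fun i _ => hidem_mem i.1
    · intro x hx g
      change (Pi.single β (x * gen Z Λ g) : Alg Z n Λ) ∈ S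
      cases g with
      | psi r =>
        rw [← psi_apply, hmulsingle]
        exact hpsi r _ hx
      | y r =>
        rw [← y_apply, H.y_eq_zero hw, Pi.zero_apply, mul_zero, Pi.single_zero]
        exact S.zero_mem
      | idem i =>
        rw [← idem_apply, hmulsingle]
        exact hidem i.1 _ hx
  rw [eq_top_iff]
  intro a _
  -- A finite sum suffices because all but finitely many blocks are zero.
  have ha : a = ∑ β ∈ (finite_nontrivial_block Z hw).toFinset, Pi.single β (a β) := by
    funext γ
    rw [Finset.sum_apply]
    by_cases hγ : Nontrivial (Block Z n Λ γ)
    · rw [Finset.sum_eq_single γ, Pi.single_eq_same]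
      · exact fun β _ hne => Pi.single_eq_of_ne hne.symm _
      · exact fun h => absurd ((finite_nontrivial_block Z hw).mem_toFinset.2 hγ) h
    · rw [not_nontrivial_iff_subsingleton] at hγ
      exact Subsingleton.elim _ _
  rw [ha]
  exact S.sum_mem fun β _ => hsingle β _

end Spanning

/-! ### Matrix units, the isomorphism and cellularity -/

section MatrixUnits

variable (Z : Type*) [CommRing Z] {e n ℓ : ℕ} {Λ : PosWeight e} {κ : Fin ℓ → ℤ}
  {red : Equiv.Perm (Fin n) → List (Fin (n - 1))}

/-- For s = t = t^λ the matrix is that of e(i^λ), which has a single entry 1 since residues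
determine tableaux. Each further swap multiplies by a matrix of ψ_r and moves this 1 to another row
or column. -/
theorem rep_eElt_apply_self (hw : IsSemisimpleWeight e n κ Λ)
    (hred : ∀ σ, IsReduced σ (red σ)) {lam : Multipartition ℓ n} (s t : lam.Std) :
    rep Z hw (eElt Z Λ κ red s t) lam = relMatrix Z fun a b => a = s ∧ b = t := by
  have H := satisfiesKLR (n := n) Z Λ
  rw [eElt_eq_matrixUnit]
  have hf : ∀ s t : lam.Std, Functional fun a b => a = s ∧ b = t :=
    fun s t _ _ _ h h' => h.2.trans h'.2.symm
  induction t using Std.induction_swap with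
  | h₀ =>
    induction s using Std.induction_swap with
    | h₀ =>
      rw [SatisfiesKLR.matrixUnit_initial hred, rep_idem]
      refine relMatrix_congr Z fun a b => ⟨?_, ?_⟩
      · rintro ⟨rfl, h⟩
        have := Std.eq_of_residues_eq hw.char hw.separated h
        exact ⟨this, this⟩
      · rintro ⟨rfl, rfl⟩
        exact ⟨rfl, rfl⟩
    | hP t u r h hlt ih =>
      rw [H.matrixUnit_left hw hred h hlt, map_mul, Pi.mul_apply, ih, rep_psi]
      dsimp only
      rw [psiMatrix, relMatrix_mul Z (Std.functional_isSwap r)]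
      refine relMatrix_congr Z fun a b => ⟨?_, ?_⟩
      · rintro ⟨v, hv, rfl, rfl⟩
        exact ⟨hv.symm.unique h, rfl⟩
      · rintro ⟨rfl, rfl⟩
        exact ⟨t, h.symm, rfl, rfl⟩
  | hP t u r h hlt ih =>
    rw [H.matrixUnit_right hw hred h hlt, map_mul, Pi.mul_apply, ih, rep_psi]
    dsimp only
    rw [psiMatrix, relMatrix_mul Z (hf s t)]
    refine relMatrix_congr Z fun a b => ⟨?_, ?_⟩
    · rintro ⟨v, ⟨rfl, rfl⟩, hv⟩
      exact ⟨rfl, hv.unique h⟩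
    · rintro ⟨rfl, rfl⟩
      exact ⟨t, ⟨rfl, rfl⟩, h⟩

/-- Already the idempotent of `t` acts as 0, since no tableau of another shape has the residues of
`t`. -/
theorem rep_eElt_apply_of_ne (hw : IsSemisimpleWeight e n κ Λ)
    (hred : ∀ σ, IsReduced σ (red σ)) {lam mu : Multipartition ℓ n} (hne : lam ≠ mu)
    (s t : lam.Std) : rep Z hw (eElt Z Λ κ red s t) mu = 0 := by
  have H := satisfiesKLR (n := n) Z Λ
  rw [eElt_eq_matrixUnit, ← H.matrixUnit_mul_idem hw hred, map_mul, Pi.mul_apply, rep_idem]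
  dsimp only
  rw [idemMatrix_eq_zero, mul_zero]
  intro u hu
  exact hne (Std.shape_eq_of_box_eq (Std.box_eq_of_residues_eq hw.char hw.separated hu.symm))

open Classical in
theorem rep_eElt (hw : IsSemisimpleWeight e n κ Λ) (hred : ∀ σ, IsReduced σ (red σ))
    (x : Σ lam : Multipartition ℓ n, lam.Std × lam.Std) (mu : Multipartition ℓ n)
    (a b : mu.Std) : rep Z hw (eElt Z Λ κ red x.2.1 x.2.2) mu a b =
      if x = ⟨mu, a, b⟩ then 1 else 0 := by
  obtain ⟨lam, s, t⟩ := x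
  by_cases h : lam = mu
  · subst h
    rw [rep_eElt_apply_self Z hw hred, relMatrix_apply]
    congr 1
    simp [eq_comm]
  · rw [rep_eElt_apply_of_ne Z hw hred h, if_neg]
    · rfl
    · exact fun h' => h (congrArg Sigma.fst h')

noncomputable instance : Fintype (Multipartition ℓ n) := Fintype.ofFinite _

/-- Matrix entries read off coefficients. Linear independence, injectivity and surjectivity all
follow from this formula. -/
theorem rep_sum_eElt (hw : IsSemisimpleWeight e n κ Λ) (hred : ∀ σ, IsReduced σ (red σ))
    (g : (Σ lam : Multipartition ℓ n, lam.Std × lam.Std) → Z) (mu : Multipartition ℓ n)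
    (a b : mu.Std) : rep Z hw (∑ x, g x • eElt Z Λ κ red x.2.1 x.2.2) mu a b = g ⟨mu, a, b⟩ := by
  classical
  rw [map_sum, Finset.sum_apply, Matrix.sum_apply, Finset.sum_eq_single ⟨mu, a, b⟩]
  · rw [map_smul, Pi.smul_apply, Matrix.smul_apply, rep_eElt Z hw hred, if_pos rfl, smul_eq_mul, mul_one]
  · intro x _ hx
    rw [map_smul, Pi.smul_apply, Matrix.smul_apply, rep_eElt Z hw hred, if_neg hx, smul_zero]
  · exact fun h => absurd (Finset.mem_univ _) h

theorem exists_eq_sum_eElt (hw : IsSemisimpleWeight e n κ Λ) (hred : ∀ σ, IsReduced σ (red σ))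
    (a : Alg Z n Λ) : ∃ g : (Σ lam : Multipartition ℓ n, lam.Std × lam.Std) → Z,
      ∑ x, g x • eElt Z Λ κ red x.2.1 x.2.2 = a :=
  (Submodule.mem_span_range_iff_exists_fun Z).1 (by rw [span_eElt Z hw hred]; trivial)

theorem rep_bijective (hw : IsSemisimpleWeight e n κ Λ) (hred : ∀ σ, IsReduced σ (red σ)) :
    Function.Bijective (rep Z hw) := by
  constructor
  · rw [injective_iff_map_eq_zero]
    intro a ha
    obtain ⟨g, rfl⟩ := exists_eq_sum_eElt Z hw hred a
    refine Finset.sum_eq_zero fun x _ => ?_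
    have := rep_sum_eElt Z hw hred g x.1 x.2.1 x.2.2
    rw [ha] at this
    rw [show g x = 0 from this.symm, zero_smul]
  · intro M
    refine ⟨∑ x : Σ lam : Multipartition ℓ n, lam.Std × lam.Std,
      M x.1 x.2.1 x.2.2 • eElt Z Λ κ red x.2.1 x.2.2, ?_⟩
    funext mu
    ext a b
    exact rep_sum_eElt Z hw hred _ mu a b

theorem linearIndependent_eElt (hw : IsSemisimpleWeight e n κ Λ)
    (hred : ∀ σ, IsReduced σ (red σ)) :
    LinearIndependent Z fun x : Σ lam : Multipartition ℓ n, lam.Std × lam.Std =>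
      eElt Z Λ κ red x.2.1 x.2.2 := by
  rw [Fintype.linearIndependent_iff]
  intro g hg x
  have := rep_sum_eElt Z hw hred g x.1 x.2.1 x.2.2
  rw [hg, map_zero] at this
  exact this.symm

theorem eElt_mul_eElt (hw : IsSemisimpleWeight e n κ Λ) (hred : ∀ σ, IsReduced σ (red σ))
    {lam : Multipartition ℓ n} (s t u v : lam.Std) :
    eElt Z Λ κ red s t * eElt Z Λ κ red u v = if t = u then eElt Z Λ κ red s v else 0 := by
  apply (rep_bijective Z hw hred).1
  funext mu
  rw [map_mul, Pi.mul_apply]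
  by_cases h : lam = mu
  · subst h
    rw [rep_eElt_apply_self Z hw hred, rep_eElt_apply_self Z hw hred,
      relMatrix_mul Z fun _ _ _ h h' => h.2.trans h'.2.symm]
    split_ifs with htu
    · rw [rep_eElt_apply_self Z hw hred]
      refine relMatrix_congr Z fun a b => ⟨?_, ?_⟩
      · rintro ⟨w, ⟨rfl, rfl⟩, rfl, rfl⟩
        exact ⟨rfl, rfl⟩
      · rintro ⟨rfl, rfl⟩
        exact ⟨t, ⟨rfl, rfl⟩, htu, rfl⟩
    · rw [map_zero]
      refine relMatrix_eq_zero Z fun a b => ?_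
      rintro ⟨w, ⟨rfl, rfl⟩, rfl, rfl⟩
      exact htu rfl
  · rw [rep_eElt_apply_of_ne Z hw hred h, zero_mul]
    split_ifs
    · rw [rep_eElt_apply_of_ne Z hw hred h]
    · rw [map_zero, Pi.zero_apply]

theorem eElt_mul_eElt_of_ne (hw : IsSemisimpleWeight e n κ Λ)
    (hred : ∀ σ, IsReduced σ (red σ)) {lam mu : Multipartition ℓ n} (h : lam ≠ mu)
    (s t : lam.Std) (u v : mu.Std) : eElt Z Λ κ red s t * eElt Z Λ κ red u v = 0 := by
  apply (rep_bijective Z hw hred).1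
  funext nu
  rw [map_mul, Pi.mul_apply, map_zero, Pi.zero_apply]
  by_cases h' : lam = nu
  · subst h'
    rw [rep_eElt_apply_of_ne Z hw hred h.symm, mul_zero]
  · rw [rep_eElt_apply_of_ne Z hw hred h', zero_mul]

/-- The isomorphism with a product of matrix algebras. -/
noncomputable def repEquiv (hw : IsSemisimpleWeight e n κ Λ)
    (hred : ∀ σ, IsReduced σ (red σ)) :
    Alg Z n Λ ≃ₐ[Z] ((lam : Multipartition ℓ n) → Matrix lam.Std lam.Std Z) :=
  AlgEquiv.ofBijective (rep Z hw) (rep_bijective Z hw hred)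

theorem isCellularBasis_eElt [Nontrivial Z] (hw : IsSemisimpleWeight e n κ Λ)
    (hred : ∀ σ, IsReduced σ (red σ)) :
    IsCellularBasis Z (Alg Z n Λ) (fun lam : Multipartition ℓ n => lam.Std)
      fun _ s t => eElt Z Λ κ red s t where
  free := Module.Free.of_basis
    (Module.Basis.mk (linearIndependent_eElt Z hw hred) (span_eElt Z hw hred).ge)
  finite := Module.Finite.of_basis
    (Module.Basis.mk (linearIndependent_eElt Z hw hred) (span_eElt Z hw hred).ge)
  injective := (linearIndependent_eElt Z hw hred).injective
  linearIndependent := linearIndependent_eElt Z hw hred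
  span_eq_top := span_eElt Z hw hred
  mul_right lam t a := by
    -- The coefficients form row `t` of the matrix of `a`. The formula is exact, with no term from
    -- more dominant shapes.
    refine ⟨fun v => rep Z hw a lam t v, fun s => ?_⟩
    have : eElt Z Λ κ red s t * a = ∑ v, rep Z hw a lam t v • eElt Z Λ κ red s v := by
      obtain ⟨g, rfl⟩ := exists_eq_sum_eElt Z hw hred a
      simp only [rep_sum_eElt Z hw hred, Finset.mul_sum, mul_smul_comm]
      rw [Fintype.sum_sigma, Finset.sum_eq_single lam]
      · rw [Fintype.sum_prod_type, Finset.sum_eq_single t]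
        · refine Finset.sum_congr rfl fun v _ => ?_
          rw [eElt_mul_eElt Z hw hred, if_pos rfl]
        · intro u _ hu
          refine Finset.sum_eq_zero fun v _ => ?_
          rw [eElt_mul_eElt Z hw hred, if_neg hu.symm, smul_zero]
        · exact fun h => absurd (Finset.mem_univ _) h
      · intro mu _ hmu
        refine Finset.sum_eq_zero fun x _ => ?_
        rw [eElt_mul_eElt_of_ne Z hw hred hmu.symm, smul_zero]
      · exact fun h => absurd (Finset.mem_univ _) h
    rw [this, sub_self]
    exact Submodule.zero_mem _
  star := by
    -- The anti-involution is transposition of matrices, transported along the isomorphism `ρ`.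
    let τ : ((lam : Multipartition ℓ n) → Matrix lam.Std lam.Std Z) ≃ₐ[Z]
        ((lam : Multipartition ℓ n) → Matrix lam.Std lam.Std Z)ᵐᵒᵖ :=
      (AlgEquiv.piCongrRight fun lam : Multipartition ℓ n =>
        Matrix.transposeAlgEquiv lam.Std Z Z).trans (AlgEquiv.piMulOpposite Z _).symm
    let ρ := repEquiv Z hw hred
    refine ⟨ρ.trans (τ.trans (AlgEquiv.op ρ.symm)), fun lam s t => ?_⟩
    change MulOpposite.op (ρ.symm fun mu => (rep Z hw (eElt Z Λ κ red s t) mu).transpose) = _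
    congr 1
    rw [AlgEquiv.symm_apply_eq]
    funext mu
    change _ = rep Z hw (eElt Z Λ κ red t s) mu
    by_cases h : lam = mu
    · subst h
      rw [rep_eElt_apply_self Z hw hred, rep_eElt_apply_self Z hw hred]
      ext a b
      rw [Matrix.transpose_apply, relMatrix_apply, relMatrix_apply]
      congr 1
      exact propext and_comm
    · rw [rep_eElt_apply_of_ne Z hw hred h, rep_eElt_apply_of_ne Z hw hred h,
        Matrix.transpose_zero]

end MatrixUnits

/-! ### The grading is concentrated in degree zero -/

section Grading

variable (Z : Type*) [CommRing Z] {e n ℓ : ℕ} {Λ : PosWeight e} {κ : Fin ℓ → ℤ}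

theorem cartan_eq_zero_of_far {i j : ZMod e} (h : Far i j) : cartan i j = 0 := by
  rw [cartan, if_neg h.1, if_neg fun h' => h.2.1 h'.1, if_neg]
  exact fun h' => h'.elim h.2.1 h.2.2

/-- If ψ_r e(i) is nonzero, then i comes from a tableau in which r and r+1 can be swapped. Their
residues are then far, and the degree is 0. -/
theorem cartan_eq_zero_or (hw : IsSemisimpleWeight e n κ Λ) {β : PosRoot e} (r : Fin (n - 1))
    (i : Seq n β) : cartan (i.1 (lo r)) (i.1 (hi r)) = 0 ∨
      gen Z Λ (Gen.psi r) * gen Z Λ (Gen.idem i) = 0 := by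
  by_cases h : gen Z Λ (Gen.idem i) = 0
  · exact Or.inr (by rw [h, mul_zero])
  obtain ⟨lam, t, ht⟩ := exists_std_of_gen_idem_ne_zero Z hw h
  by_cases hs : ∃ u, Std.IsSwap r t u
  · refine Or.inl (cartan_eq_zero_of_far ?_)
    rw [← ht]
    exact (Std.exists_isSwap_iff hw.char hw.separated).1 hs
  · have := congrFun ((satisfiesKLR Z Λ).psi_idem_eq_zero hw hs) β
    rw [ht, Pi.mul_apply, idem_apply] at this
    exact Or.inr this

theorem gen_y_eq_zero (hw : IsSemisimpleWeight e n κ Λ) {β : PosRoot e} (r : Fin n) :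
    gen Z Λ (Gen.y r : Gen n β) = 0 :=
  congrFun ((satisfiesKLR Z Λ).y_eq_zero hw r) β

theorem Monomial.eq_zero_or (hw : IsSemisimpleWeight e n κ Λ) {β : PosRoot e} {d : ℤ}
    {x : Block Z n Λ β} (h : Monomial Z Λ β d x) : d = 0 ∨ x = 0 := by
  induction h with
  | one => exact Or.inl rfl
  | idem d x i _ ih => exact ih.imp_right fun h => by rw [h, zero_mul]
  | y d x r _ _ => exact Or.inr (by rw [gen_y_eq_zero Z hw, mul_zero])
  | psi d x r i _ ih =>
    rcases cartan_eq_zero_or Z hw r i with h | h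
    · rw [h, sub_zero]
      exact ih.imp_right fun h => by rw [h, zero_mul]
    · exact Or.inr (by rw [h, mul_zero])

theorem span_monomial_zero (hw : IsSemisimpleWeight e n κ Λ) (β : PosRoot e) :
    Submodule.span Z {x : Block Z n Λ β | Monomial Z Λ β 0 x} = ⊤ := by
  have key : ∀ b : Block Z n Λ β, (∀ x, Monomial Z Λ β 0 x →
      x * b ∈ Submodule.span Z {x : Block Z n Λ β | Monomial Z Λ β 0 x}) →
      ∀ x ∈ Submodule.span Z {x : Block Z n Λ β | Monomial Z Λ β 0 x},
        x * b ∈ Submodule.span Z {x : Block Z n Λ β | Monomial Z Λ β 0 x} := by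
    intro b hb x hx
    induction hx using Submodule.span_induction with
    | mem x hx => exact hb x hx
    | zero => rw [zero_mul]; exact Submodule.zero_mem _
    | add x z _ _ hx hz => rw [add_mul]; exact Submodule.add_mem _ hx hz
    | smul r x _ hx => rw [smul_mul_assoc]; exact Submodule.smul_mem _ r hx
  refine block_submodule_eq_top Z _ (Submodule.subset_span Monomial.one) fun x hx g => ?_
  cases g with
  | psi r =>
    refine key _ (fun x hx => ?_) x hx
    -- Only the products ψ_r e(i) carry a degree, so ψ_r is first split as the sum of these.
    rw [← mul_one (gen Z Λ (Gen.psi r)), ← sum_gen_idem, Finset.mul_sum, Finset.mul_sum]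
    refine Submodule.sum_mem _ fun i _ => ?_
    rcases cartan_eq_zero_or Z hw r i with h | h
    · have := Monomial.psi 0 x r i hx
      rw [h, sub_zero] at this
      exact Submodule.subset_span this
    · rw [h, mul_zero]
      exact Submodule.zero_mem _
  | y r =>
    rw [gen_y_eq_zero Z hw, mul_zero]
    exact Submodule.zero_mem _
  | idem i => exact key _ (fun x hx => Submodule.subset_span (Monomial.idem 0 x i hx)) x hx

theorem homogeneous_zero (hw : IsSemisimpleWeight e n κ Λ) : homogeneous Z n Λ 0 = ⊤ := by
  rw [homogeneous, eq_top_iff]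
  intro x _ β _
  have : x β ∈ Submodule.span Z {x : Block Z n Λ β | Monomial Z Λ β 0 x} := by
    rw [span_monomial_zero Z hw]
    trivial
  exact this

theorem homogeneous_of_ne_zero (hw : IsSemisimpleWeight e n κ Λ) {d : ℤ} (hd : d ≠ 0) :
    homogeneous Z n Λ d = ⊥ := by
  rw [eq_bot_iff]
  intro x hx
  rw [Submodule.mem_bot]
  funext β
  have h := hx β (Set.mem_univ β)
  have hle : Submodule.span Z {x : Block Z n Λ β | Monomial Z Λ β d x} ≤ ⊥ :=
    Submodule.span_le.2 fun x hx => (Monomial.eq_zero_or Z hw hx).resolve_left hd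
  exact (Submodule.mem_bot Z).1 (hle h)

/-- A grading which is concentrated in degree zero. -/
theorem nonempty_gradedAlgebra {A : Type*} [Ring A] [Algebra Z A] {𝒜 : ℤ → Submodule Z A}
    (h₀ : 𝒜 0 = ⊤) (h : ∀ d, d ≠ 0 → 𝒜 d = ⊥) : Nonempty (GradedAlgebra 𝒜) := by
  have hmem : ∀ a, a ∈ 𝒜 0 := fun a => by rw [h₀]; trivial
  have hz : DirectSum.of (fun i => 𝒜 i) 0 ⟨0, hmem 0⟩ = 0 := map_zero _
  refine ⟨{
    one_mem := hmem 1
    mul_mem := ?_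
    decompose' := fun a => DirectSum.of (fun i => 𝒜 i) 0 ⟨a, hmem a⟩
    left_inv := ?_
    right_inv := ?_ }⟩
  · intro i j a b ha hb
    by_cases hi : i = 0
    · by_cases hj : j = 0
      · subst hi hj
        exact hmem _
      · rw [h j hj, Submodule.mem_bot] at hb
        rw [hb, mul_zero]
        exact Submodule.zero_mem _
    · rw [h i hi, Submodule.mem_bot] at ha
      rw [ha, zero_mul]
      exact Submodule.zero_mem _
  · intro a
    exact DirectSum.coeAddMonoidHom_of _ _ _
  · intro x
    induction x using DirectSum.induction_on with
    | zero => simpa using hz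
    | of i x =>
      rw [DirectSum.coeAddMonoidHom_of]
      by_cases hi : i = 0
      · subst hi
        rfl
      · have hx : x = 0 := by
          have := x.2
          simp only [h i hi, Submodule.mem_bot] at this
          exact Subtype.ext this
        subst hx
        simpa using hz
    | add x z hx hz =>
      rw [map_add]
      conv_rhs => rw [← hx, ← hz, ← map_add]
      rfl

end Grading

end CycKLR

theorem theoremT (Z : Type*) [CommRing Z] [IsDomain Z] (e n ℓ : ℕ) (he : e = 0 ∨ n < e)
    (κ : Fin ℓ → ℤ) (Λ : CycKLR.PosWeight e) (hκ : Λ = CycKLR.weightOf e κ)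
    (hΛ : ∀ i : ZMod e, CycKLR.pairing Λ (CycKLR.rootString i n) ≤ 1)
    (red : Equiv.Perm (Fin n) → List (Fin (n - 1)))
    (hred : ∀ σ : Equiv.Perm (Fin n), CycKLR.IsReduced σ (red σ)) :
    -- only finitely many of the algebras `R_β^Λ` are non-zero
    {β : CycKLR.PosRoot e | Nontrivial (CycKLR.Block Z n Λ β)}.Finite ∧
    -- graded cellular basis, in degree zero
    CycKLR.IsGradedCellularBasis Z (CycKLR.Alg Z n Λ) (CycKLR.homogeneous Z n Λ)
      (fun lam : CycKLR.Multipartition ℓ n => lam.Std)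
      (fun _ s t => CycKLR.eElt Z Λ κ red s t) (fun _ _ => 0) ∧
    -- matrix units
    (∀ (lam : CycKLR.Multipartition ℓ n) (s t u v : lam.Std),
      (t = u → CycKLR.eElt Z Λ κ red s t * CycKLR.eElt Z Λ κ red u v =
        CycKLR.eElt Z Λ κ red s v) ∧
      (t ≠ u → CycKLR.eElt Z Λ κ red s t * CycKLR.eElt Z Λ κ red u v = 0)) ∧
    (∀ (lam mu : CycKLR.Multipartition ℓ n) (s t : lam.Std) (u v : mu.Std), lam ≠ mu →
      CycKLR.eElt Z Λ κ red s t * CycKLR.eElt Z Λ κ red u v = 0) ∧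
    -- direct sum of matrix rings
    Nonempty (CycKLR.Alg Z n Λ ≃ₐ[Z]
      ((lam : CycKLR.Multipartition ℓ n) →
        Matrix (Fin (Nat.card lam.Std)) (Fin (Nat.card lam.Std)) Z)) := by
  have hw := CycKLR.isSemisimpleWeight he hκ hΛ
  refine ⟨CycKLR.finite_nontrivial_block Z hw, ⟨?_, CycKLR.isCellularBasis_eElt Z hw hred, ?_⟩,
    fun lam s t u v => ⟨fun h => ?_, fun h => ?_⟩,
    fun lam mu s t u v h => CycKLR.eElt_mul_eElt_of_ne Z hw hred h s t u v, ⟨?_⟩⟩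
  · exact CycKLR.nonempty_gradedAlgebra Z (CycKLR.homogeneous_zero Z hw)
      fun d hd => CycKLR.homogeneous_of_ne_zero Z hw hd
  · intro lam s t
    rw [add_zero, CycKLR.homogeneous_zero Z hw]
    trivial
  · rw [CycKLR.eElt_mul_eElt Z hw hred, if_pos h]
  · rw [CycKLR.eElt_mul_eElt Z hw hred, if_neg h]
  · exact (CycKLR.repEquiv Z hw hred).trans (AlgEquiv.piCongrRight fun lam =>
      Matrix.reindexAlgEquiv Z Z (Finite.equivFin lam.Std))
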